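/- Let $n \ge 0$, let $w \in S_n$ be a permutation of $[n]=\{1,\dots,n\}$, let $X=(x_{i,j})$ be an $n\times n$ matrix of distinct indeterminates, and let $R=\mathbb{C}[x_{i,j} \mid 1\le i,j\le n]$. Put \[ D_w=\{(i,j)\in[n]\times[n] : w(i)>j,\ w^{-1}(j)>i\},\qquad \operatorname{rank}_w(i,j)=|\{k\le i : w(k)\le j\}|, \] \[ \operatorname{Ess}(w)=\{(i,j)\in D_w : (i+1,j),(i,j+1)\notin D_w\},\qquad \operatorname{Dom}(w)=\{(i,j)\in D_w : \operatorname{rank}_w(i,j)=0\}. \] For a matrix $M$ let $M_{[i],[j]}$ be the submatrix of its first $i$ rows and first $j$ columns. The Schubert determinantal ideal $I_w\subseteq R$ is generated by all $(\operatorname{rank}_w(i,j)+1)$-minors of $X_{[i],[j]}$ for all $(i,j)\in[n]\times[n]$. Let $X'$ be obtained from $X$ by replacing $x_{i,j}$ by $0$ for $(i,j)\in\operatorname{Dom}(w)$. The set $G_w$ of CDG generators of $I_w$ consists of the variables $x_{i,j}$ with $(i,j)\in\operatorname{Dom}(w)$ and of the $(\operatorname{rank}_w(i,j)+1)$-minors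 of $X'_{[i],[j]}$ for $(i,j)\in\operatorname{Ess}(w)\setminus\operatorname{Dom}(w)$. A term order on $R$ is called diagonal if the leading term of every minor of $X$ is the product of the entries on the main diagonal of the corresponding submatrix. A subset $G$ of an ideal $I$ is a Gröbner basis of $I$ if the leading terms of the elements of $G$ generate the ideal generated by the leading terms of all elements of $I$. If $G_w$ is a Gröbner basis of $I_w$ with respect to some diagonal term order (in particular, if it is one with respect to every diagonal term order), then $w$ avoids all eight of the patterns \[ 13254,\ 21543,\ 214635,\ 215364,\ 215634,\ 241635,\ 315264,\ 4261735, \] where $w$ contains $v\in S_k$ if there are positions $i_1<\dots<i_k$ such that $w(i_a)<w(i_b)$ exactly when $v(a)<v(b)$, and avoids $v$ otherwise. -/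

import Mathlib

/-! Rows and columns of an `n × n` matrix are indexed by `Fin n`, so that the index `i` of the
mathematical text, with `1 ≤ i ≤ n`, is `i - 1` here. A permutation `w ∈ S_n` is a
`w : Equiv.Perm (Fin n)`. -/

namespace MatrixSchubert

/-- The Rothe diagram `D_w = {(i, j) | w(i) > j, w⁻¹(j) > i}`. -/
def rotheDiagram {n : ℕ} (w : Equiv.Perm (Fin n)) : Set (Fin n × Fin n) :=
  {p | p.2 < w p.1 ∧ p.1 < w.symm p.2}

/-- The rank function `rank_w(i, j) = #{k ≤ i | w(k) ≤ j}`. -/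
def rk {n : ℕ} (w : Equiv.Perm (Fin n)) (i j : Fin n) : ℕ :=
  (Finset.univ.filter fun k : Fin n => k ≤ i ∧ w k ≤ j).card

/-- The essential set: the boxes `(i, j)` of `D_w` with `(i + 1, j) ∉ D_w` and `(i, j + 1) ∉ D_w`
(positions outside the grid are not in `D_w`). -/
def essentialSet {n : ℕ} (w : Equiv.Perm (Fin n)) : Set (Fin n × Fin n) :=
  {p | p ∈ rotheDiagram w ∧
    (∀ i : Fin n, (i : ℕ) = (p.1 : ℕ) + 1 → (i, p.2) ∉ rotheDiagram w) ∧
    (∀ j : Fin n, (j : ℕ) = (p.2 : ℕ) + 1 → (p.1, j) ∉ rotheDiagram w)}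

/-- The dominant part of the Rothe diagram: the boxes of rank `0`. -/
def dominantPart {n : ℕ} (w : Equiv.Perm (Fin n)) : Set (Fin n × Fin n) :=
  {p | p ∈ rotheDiagram w ∧ rk w p.1 p.2 = 0}

/-- The polynomial ring `ℂ[x_{i,j} | 1 ≤ i, j ≤ n]`. -/
abbrev Poly (n : ℕ) : Type := MvPolynomial (Fin n × Fin n) ℂ

/-- The generic matrix `X = (x_{i,j})`. -/
noncomputable def genericMatrix (n : ℕ) : Matrix (Fin n) (Fin n) (Poly n) :=
  Matrix.of fun i j => MvPolynomial.X (i, j)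

open Classical in
/-- The matrix `X'` obtained from `X` by setting `x_{i,j}` to `0` for `(i, j)` in the dominant
part. -/
noncomputable def cdgMatrix {n : ℕ} (w : Equiv.Perm (Fin n)) : Matrix (Fin n) (Fin n) (Poly n) :=
  Matrix.of fun i j => if (i, j) ∈ dominantPart w then 0 else MvPolynomial.X (i, j)

/-- The set of `k`-minors of the northwest submatrix `M_{[i],[j]}` (rows `≤ i`, columns `≤ j`);
row and column sets of size `k` are given by increasing maps from `Fin k`. -/
def nwMinors {n : ℕ} (M : Matrix (Fin n) (Fin n) (Poly n)) (k : ℕ) (i j : Fin n) :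
    Set (Poly n) :=
  {f | ∃ r c : Fin k ↪o Fin n, (∀ a, r a ≤ i) ∧ (∀ a, c a ≤ j) ∧ f = (M.submatrix r c).det}

/-- The Schubert determinantal ideal `I_w`, generated by the `(rank_w(i, j) + 1)`-minors of
`X_{[i],[j]}` for all `(i, j)`. -/
noncomputable def schubertIdeal {n : ℕ} (w : Equiv.Perm (Fin n)) : Ideal (Poly n) :=
  Ideal.span {f | ∃ i j : Fin n, f ∈ nwMinors (genericMatrix n) (rk w i j + 1) i j}

/-- The CDG generators `G_w`: the variables `x_{i,j}` with `(i, j)` in the dominant part, and the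
`(rank_w(i, j) + 1)`-minors of `X'_{[i],[j]}` for `(i, j)` in the essential set but not in the
dominant part. -/
def cdgGenerators {n : ℕ} (w : Equiv.Perm (Fin n)) : Set (Poly n) :=
  {f | ∃ p ∈ essentialSet w \ dominantPart w,
      f ∈ nwMinors (cdgMatrix w) (rk w p.1 p.2 + 1) p.1 p.2} ∪
    {f | ∃ p ∈ dominantPart w, f = MvPolynomial.X p}

/-- A term order is diagonal if the leading term of every minor of the generic matrix is the
product of the entries on the main diagonal of the corresponding submatrix. -/
def IsDiagonal {n : ℕ} (m : MonomialOrder (Fin n × Fin n)) : Prop :=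
  ∀ (k : ℕ) (r c : Fin k ↪o Fin n),
    m.leadingTerm (((genericMatrix n).submatrix r c).det) = ∏ a, genericMatrix n (r a) (c a)

/-- `G` is a Gröbner basis of the ideal `I` with respect to the term order `m`: it is contained in
`I`, and the leading terms of its elements generate the initial ideal of `I`. -/
def IsGroebnerBasis {σ : Type*} (m : MonomialOrder σ) (G : Set (MvPolynomial σ ℂ))
    (I : Ideal (MvPolynomial σ ℂ)) : Prop :=
  G ⊆ (I : Set (MvPolynomial σ ℂ)) ∧
    Ideal.span (m.leadingTerm '' G) = Ideal.span (m.leadingTerm '' (I : Set (MvPolynomial σ ℂ)))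

/-- `w` contains the pattern `v = v_1 ⋯ v_k` (given in one-line notation): there are positions
`i_1 < ⋯ < i_k` such that `w(i_a) < w(i_b)` exactly when `v_a < v_b`. -/
def ContainsPattern {n k : ℕ} (w : Equiv.Perm (Fin n)) (v : Fin k → ℕ) : Prop :=
  ∃ f : Fin k ↪o Fin n, ∀ a b : Fin k, w (f a) < w (f b) ↔ v a < v b

/-- `w` avoids the pattern `v` if it does not contain it. -/
def AvoidsPattern {n k : ℕ} (w : Equiv.Perm (Fin n)) (v : Fin k → ℕ) : Prop :=
  ¬ ContainsPattern w v

end MatrixSchubert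

/-! The Gröbner property enters only through a weak consequence: every nonzero element of the
determinantal ideal has some monomial divisible by a variable of the zero set or by the leading term
of a minor larger than the rank allows (`HasReducibleMonomials`). All such minors are admitted as
divisors, not only those of essential boxes, and the property makes sense for a partial permutation,
`w` restricted to a set `S` of rows. To exclude a pattern it suffices to exhibit, for a suitable
`S`, a nonzero element of the ideal none of whose monomials is divisible in this way.

The reduction to suitable `S` is `HasReducibleMonomials.erase`: the property survives the deletion
of an entry with no other entry weakly northwest of it. An element of the smaller ideal is bordered
by the row and column of that entry, which gives an element of the larger ideal that is linear in
the corresponding variable; after reduction of the rest, a monomial reducible in the larger ideal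
gives one in the smaller. By `HasReducibleMonomials.of_upper`, the property passes to every set of
entries closed under going southeast. Entries outside the southeast region of a few entries of the
pattern can thus be discarded.

Bad elements are built in two ways. For 13254, 241635 and 4261735 one minor suffices
(`not_hasReducibleMonomials_of_transversal`): a 0/1 matrix on which it is 1 violates the rank
conditions only through the entry at one corner, so a remainder of the minor is nonzero and could be
reduced only by a minor with the same rows and columns; but the diagonal of that minor already
violates another rank condition, by a smaller minor that vanishes on the 0/1 matrix. For 214635,
21543 and 215634 (`not_hasReducibleMonomials_of_two_minors`), two minors share a variable; the
combination that eliminates it is nonzero, and counting rows and columns shows that no leading term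
divides its monomials. The patterns 315264 and 215364 are inverse to 241635 and 214635 and follow by
transposition.

A pattern sits in an arbitrary `w`, so its entries are chosen extremal, and patterns already
excluded control the remaining entries in the relevant rectangles. -/

namespace MvPolynomial

/-! ### Division with remainder inside a subset of the variables -/

section Projection

variable {σ R : Type*} [CommRing R]

open Classical in
/-- The projection of a polynomial ring that kills the variables outside `W`. -/
noncomputable def killOutside (W : Set σ) : MvPolynomial σ R →ₐ[R] MvPolynomial σ R :=
  aeval fun v => if v ∈ W then X v else 0

theorem mem_supported_iff_support {W : Set σ} {f : MvPolynomial σ R} :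
    f ∈ supported R W ↔ ∀ d ∈ f.support, ∀ v, d v ≠ 0 → v ∈ W := by
  rw [mem_supported]
  constructor
  · intro h d hd v hv
    exact h (Finset.mem_coe.2 ((mem_vars_iff_mem_support v).2 ⟨d, hd, Finsupp.mem_support_iff.2 hv⟩))
  · intro h v hv
    obtain ⟨d, hd, hv⟩ := (mem_vars_iff_mem_support v).1 (Finset.mem_coe.1 hv)
    exact h d hd v (Finsupp.mem_support_iff.1 hv)

open Classical in
theorem coeff_killOutside (W : Set σ) (f : MvPolynomial σ R) (d : σ →₀ ℕ) :
    coeff d (killOutside W f) = if ∀ v, d v ≠ 0 → v ∈ W then coeff d f else 0 := by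
  induction f using MvPolynomial.induction_on' with
  | add p q hp hq =>
    rw [map_add, coeff_add, coeff_add, hp, hq]
    split_ifs <;> simp
  | monomial u a =>
    rw [killOutside, aeval_monomial, algebraMap_eq]
    by_cases hu : ∀ v, u v ≠ 0 → v ∈ W
    · have : (u.prod fun v k => (if v ∈ W then X v else (0 : MvPolynomial σ R)) ^ k) =
          u.prod fun v k => X v ^ k := by
        refine Finsupp.prod_congr fun v hv => ?_
        rw [if_pos (hu v (Finsupp.mem_support_iff.1 hv))]
      rw [this, ← monomial_eq, coeff_monomial]
      split_ifs with h1 h2 h2 <;> first | rfl | (subst h1; exact absurd hu h2)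
    · push Not at hu
      obtain ⟨v, hv, hvW⟩ := hu
      have : (u.prod fun v k => (if v ∈ W then X v else (0 : MvPolynomial σ R)) ^ k) = 0 := by
        refine Finset.prod_eq_zero (Finsupp.mem_support_iff.2 hv) ?_
        simp [hvW, hv]
      rw [this, mul_zero, coeff_zero, coeff_monomial]
      split_ifs with h1 h2 <;> first | rfl | (subst h2; exact absurd (h1 v hv) hvW)

theorem killOutside_mem_supported (W : Set σ) (f : MvPolynomial σ R) :
    killOutside W f ∈ supported R W := by
  classical
  rw [mem_supported_iff_support]
  intro d hd
  rw [mem_support_iff, coeff_killOutside] at hd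
  by_contra h
  exact hd (if_neg h)

theorem support_killOutside_subset (W : Set σ) (f : MvPolynomial σ R) :
    (killOutside W f).support ⊆ f.support := by
  classical
  intro d hd
  rw [mem_support_iff, coeff_killOutside] at hd
  rw [mem_support_iff]
  split_ifs at hd with h
  · exact hd
  · exact absurd rfl hd

theorem killOutside_eq_self {W : Set σ} {f : MvPolynomial σ R} (hf : f ∈ supported R W) :
    killOutside W f = f := by
  classical
  ext d
  rw [coeff_killOutside]
  split_ifs with h
  · rfl
  · by_contra hne
    exact h (mem_supported_iff_support.1 hf d (mem_support_iff.2 (Ne.symm hne)))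

/-- Division by polynomials in the variables `W` of a polynomial in the variables `W`. -/
theorem exists_remainder (m : MonomialOrder σ) {W : Set σ} {B : Set (MvPolynomial σ R)}
    (hB : ∀ b ∈ B, IsUnit (m.leadingCoeff b)) (hW : ∀ b ∈ B, b ∈ supported R W)
    {F : MvPolynomial σ R} (hF : F ∈ supported R W) :
    ∃ r ∈ supported R W, F - r ∈ Ideal.span B ∧
      ∀ d ∈ r.support, ∀ b ∈ B, ¬ m.degree b ≤ d := by
  obtain ⟨g, r, h1, -, h3⟩ := m.div_set hB F
  refine ⟨killOutside W r, killOutside_mem_supported W r, ?_, fun d hd =>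
    h3 d (support_killOutside_subset W r hd)⟩
  -- Division may introduce variables outside `W`. Projecting the whole identity removes them, fixes
  -- `F` and the divisors, and can only shrink the support of the remainder.
  have h := congrArg (killOutside W) h1
  rw [map_add, killOutside_eq_self hF] at h
  rw [h, add_sub_cancel_right, Finsupp.linearCombination_apply, Finsupp.sum, map_sum]
  refine Ideal.sum_mem _ fun b _ => ?_
  rw [smul_eq_mul, map_mul, killOutside_eq_self (hW b b.2)]
  exact Ideal.mul_mem_left _ _ (Ideal.subset_span b.2)

end Projection

end MvPolynomial

/-! ### Minors with prescribed zeros and their leading transversals -/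

namespace MatrixSchubert

open MvPolynomial

open scoped MonomialOrder

variable {n : ℕ}

/-- The exponent of the monomial `∏ a, x_{r a, c a}`. -/
noncomputable def matchExp {k : ℕ} (r c : Fin k → Fin n) : Fin n × Fin n →₀ ℕ :=
  ∑ a, Finsupp.single (r a, c a) 1

theorem matchExp_apply {k : ℕ} (r c : Fin k → Fin n) (v : Fin n × Fin n) :
    matchExp r c v = (Finset.univ.filter fun a => (r a, c a) = v).card := by
  rw [matchExp, Finsupp.finsetSum_apply, Finset.card_filter]
  exact Finset.sum_congr rfl fun a _ => by rw [Finsupp.single_apply]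

theorem matchExp_apply_ne_zero {k : ℕ} {r c : Fin k → Fin n} {v : Fin n × Fin n} :
    matchExp r c v ≠ 0 ↔ ∃ a, (r a, c a) = v := by
  rw [matchExp_apply, Finset.card_ne_zero, Finset.filter_nonempty_iff]
  simp

theorem matchExp_le_iff {k : ℕ} {r c : Fin k → Fin n} (hc : Function.Injective c)
    {d : Fin n × Fin n →₀ ℕ} : matchExp r c ≤ d ↔ ∀ a, d (r a, c a) ≠ 0 := by
  constructor
  · intro h a h0
    have h1 := h (r a, c a)
    rw [h0, Nat.le_zero] at h1
    exact matchExp_apply_ne_zero.2 ⟨a, rfl⟩ h1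
  · intro h v
    by_cases hv : ∃ a, (r a, c a) = v
    · obtain ⟨a, rfl⟩ := hv
      refine le_trans ?_ (Nat.one_le_iff_ne_zero.2 (h a))
      rw [matchExp_apply, Finset.card_le_one]
      intro b hb b' hb'
      simp only [Finset.mem_filter, Finset.mem_univ, true_and, Prod.mk.injEq] at hb hb'
      exact hc (hb.2.trans hb'.2.symm)
    · rw [not_not.1 fun h' => hv (matchExp_apply_ne_zero.1 h')]
      exact Nat.zero_le _

/-- Distinct permutations contribute distinct monomials to a minor, so nothing cancels and its
support can be read off. -/
theorem matchExp_perm_injective {k : ℕ} {r c : Fin k → Fin n} (hr : Function.Injective r)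
    (hc : Function.Injective c) {σ τ : Equiv.Perm (Fin k)}
    (h : matchExp (r ∘ σ) c = matchExp (r ∘ τ) c) : σ = τ := by
  ext a : 1
  have h1 : matchExp (r ∘ τ) c ((r ∘ σ) a, c a) ≠ 0 := by
    rw [← h]
    exact matchExp_apply_ne_zero.2 ⟨a, rfl⟩
  obtain ⟨b, hb⟩ := matchExp_apply_ne_zero.1 h1
  rw [Prod.mk.injEq] at hb
  have := hc hb.2
  subst this
  exact hr hb.1.symm

open Classical in
/-- The minor with rows `r` and columns `c` of the generic matrix in which the entries in `Z` are
replaced by `0`. -/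
noncomputable def minor {k : ℕ} (Z : Set (Fin n × Fin n)) (r c : Fin k → Fin n) : Poly n :=
  Matrix.det (Matrix.of fun i j => if (r i, c j) ∈ Z then (0 : Poly n) else X (r i, c j))

theorem minor_empty {k : ℕ} (r c : Fin k → Fin n) :
    minor ∅ r c = ((genericMatrix n).submatrix r c).det := by
  unfold minor
  congr 1
  ext i j : 1
  simp [genericMatrix]

open Classical in
theorem minor_eq_sum {k : ℕ} (Z : Set (Fin n × Fin n)) (r c : Fin k → Fin n) :
    minor Z r c = ∑ σ : Equiv.Perm (Fin k), monomial (matchExp (r ∘ σ) c)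
      (if ∀ a, (r (σ a), c a) ∉ Z then ((Equiv.Perm.sign σ : ℤ) : ℂ) else 0) := by
  rw [minor, Matrix.det_apply']
  refine Finset.sum_congr rfl fun σ _ => ?_
  simp only [Matrix.of_apply]
  split_ifs with h
  · have : ∀ a, (if (r (σ a), c a) ∈ Z then (0 : Poly n) else X (r (σ a), c a)) =
        monomial (Finsupp.single (r (σ a), c a) 1) 1 := fun a => by rw [if_neg (h a)]; rfl
    rw [Finset.prod_congr rfl fun a _ => this a, ← monomial_sum_one, matchExp]
    rw [← map_intCast (C : ℂ →+* Poly n), C_mul_monomial, mul_one]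
    rfl
  · push Not at h
    obtain ⟨a, ha⟩ := h
    have : ∏ a, (if (r (σ a), c a) ∈ Z then (0 : Poly n) else X (r (σ a), c a)) = 0 :=
      Finset.prod_eq_zero (Finset.mem_univ a) (if_pos ha)
    rw [this, mul_zero, map_zero]

open Classical in
theorem coeff_minor {k : ℕ} (Z : Set (Fin n × Fin n)) {r c : Fin k → Fin n}
    (hr : Function.Injective r) (hc : Function.Injective c) (σ : Equiv.Perm (Fin k)) :
    coeff (matchExp (r ∘ σ) c) (minor Z r c) =
      if ∀ a, (r (σ a), c a) ∉ Z then ((Equiv.Perm.sign σ : ℤ) : ℂ) else 0 := by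
  rw [minor_eq_sum, coeff_sum, Finset.sum_eq_single σ]
  · rw [coeff_monomial, if_pos rfl]
  · intro τ _ hτ
    rw [coeff_monomial, if_neg fun h => hτ (matchExp_perm_injective hr hc h)]
  · intro h
    exact absurd (Finset.mem_univ _) h

theorem exists_of_mem_support_minor {k : ℕ} {Z : Set (Fin n × Fin n)} {r c : Fin k → Fin n}
    {d : Fin n × Fin n →₀ ℕ} (hd : d ∈ (minor Z r c).support) :
    ∃ σ : Equiv.Perm (Fin k), d = matchExp (r ∘ σ) c ∧ ∀ a, (r (σ a), c a) ∉ Z := by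
  classical
  rw [mem_support_iff, minor_eq_sum, coeff_sum] at hd
  obtain ⟨σ, -, hσ⟩ := Finset.exists_ne_zero_of_sum_ne_zero hd
  rw [coeff_monomial] at hσ
  split_ifs at hσ with h1 h2
  · exact ⟨σ, h1.symm, h2⟩
  · exact absurd rfl hσ
  · exact absurd rfl hσ

theorem matchExp_mem_support_minor {k : ℕ} {Z : Set (Fin n × Fin n)} {r c : Fin k → Fin n}
    (hr : Function.Injective r) (hc : Function.Injective c) {σ : Equiv.Perm (Fin k)}
    (hσ : ∀ a, (r (σ a), c a) ∉ Z) : matchExp (r ∘ σ) c ∈ (minor Z r c).support := by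
  classical
  rw [mem_support_iff, coeff_minor Z hr hc, if_pos hσ]
  exact Int.cast_ne_zero.2 (Units.ne_zero _)

theorem minor_mem_supported {k : ℕ} {Z W : Set (Fin n × Fin n)} {r c : Fin k → Fin n}
    (h : ∀ i j, (r i, c j) ∉ Z → (r i, c j) ∈ W) : minor Z r c ∈ supported ℂ W := by
  rw [mem_supported_iff_support]
  intro d hd v hv
  obtain ⟨σ, rfl, hσ⟩ := exists_of_mem_support_minor hd
  obtain ⟨a, rfl⟩ := matchExp_apply_ne_zero.1 hv
  exact h _ _ (hσ a)

/-- The transversal `(r a, c a)` avoids `Z` and is maximal, for the monomial order `m`, among the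
transversals with the same rows and columns that avoid `Z`. -/
structure IsLead (m : MonomialOrder (Fin n × Fin n)) (Z : Set (Fin n × Fin n)) {k : ℕ}
    (r c : Fin k → Fin n) : Prop where
  inj_row : Function.Injective r
  inj_col : Function.Injective c
  notMem : ∀ a, (r a, c a) ∉ Z
  le : ∀ σ : Equiv.Perm (Fin k), (∀ a, (r (σ a), c a) ∉ Z) →
    matchExp (r ∘ σ) c ≼[m] matchExp r c

variable {m : MonomialOrder (Fin n × Fin n)}

theorem IsLead.degree_minor {Z : Set (Fin n × Fin n)} {k : ℕ} {r c : Fin k → Fin n}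
    (h : IsLead m Z r c) : m.degree (minor Z r c) = matchExp r c := by
  have h1 : matchExp r c ∈ (minor Z r c).support :=
    matchExp_mem_support_minor h.inj_row h.inj_col (σ := 1) h.notMem
  refine m.toSyn.injective (le_antisymm ?_ (m.le_degree h1))
  have h2 : m.degree (minor Z r c) ∈ (minor Z r c).support := by
    rw [m.degree_mem_support_iff]
    intro h0
    rw [h0] at h1
    simp at h1
  obtain ⟨σ, h3, h4⟩ := exists_of_mem_support_minor h2
  rw [h3]
  exact h.le σ h4

theorem IsLead.isUnit_leadingCoeff {Z : Set (Fin n × Fin n)} {k : ℕ} {r c : Fin k → Fin n}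
    (h : IsLead m Z r c) : IsUnit (m.leadingCoeff (minor Z r c)) := by
  rw [isUnit_iff_ne_zero, MonomialOrder.leadingCoeff, h.degree_minor, ← mem_support_iff]
  exact matchExp_mem_support_minor h.inj_row h.inj_col (σ := 1) h.notMem

open Classical in
theorem matchExp_comp_add {k l : ℕ} (r c : Fin k → Fin n) (ψ : Fin l ↪ Fin k) :
    matchExp (r ∘ ψ) (c ∘ ψ) + ∑ a with a ∉ Set.range ψ, Finsupp.single (r a, c a) 1 =
      matchExp r c := by
  rw [matchExp, matchExp, ← Finset.sum_filter_add_sum_filter_not Finset.univ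
    (fun a => a ∈ Set.range ψ)]
  congr 1
  rw [show (Finset.univ.filter fun a => a ∈ Set.range ψ) = Finset.univ.map ψ by ext; simp,
    Finset.sum_map]
  rfl

/-- A part of a leading transversal is leading. -/
theorem IsLead.comp {Z : Set (Fin n × Fin n)} {k l : ℕ} {r c : Fin k → Fin n}
    (h : IsLead m Z r c) (ψ : Fin l ↪ Fin k) : IsLead m Z (r ∘ ψ) (c ∘ ψ) where
  inj_row := h.inj_row.comp ψ.injective
  inj_col := h.inj_col.comp ψ.injective
  notMem a := h.notMem (ψ a)
  le σ hσ := by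
    classical
    -- A permutation of the part is extended by the identity; the entries outside the part
    -- contribute a common factor, which cancels from the comparison.
    have h2 : ∀ a, a ∉ Set.range ψ → σ.viaEmbedding ψ a = a := fun a ha =>
      Equiv.Perm.viaEmbedding_apply_of_notMem σ ψ a ha
    have h3 := h.le (σ.viaEmbedding ψ) (fun a => by
      by_cases ha : a ∈ Set.range ψ
      · obtain ⟨b, rfl⟩ := ha
        rw [Equiv.Perm.viaEmbedding_apply]
        exact hσ b
      · rw [h2 a ha]
        exact h.notMem a)
    rw [← matchExp_comp_add (r ∘ σ.viaEmbedding ψ) c ψ, ← matchExp_comp_add r c ψ] at h3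
    have h4 : (r ∘ σ.viaEmbedding ψ) ∘ ψ = (r ∘ ψ) ∘ σ := by
      ext b
      simp [Equiv.Perm.viaEmbedding_apply]
    have h5 : ∑ a with a ∉ Set.range ψ, Finsupp.single ((r ∘ σ.viaEmbedding ψ) a, c a) 1 =
        ∑ a with a ∉ Set.range ψ, Finsupp.single (r a, c a) 1 := by
      refine Finset.sum_congr rfl fun a ha => ?_
      rw [Function.comp_apply, h2 a (Finset.mem_filter.1 ha).2]
    rw [h4, h5, map_add, map_add] at h3
    exact le_of_add_le_add_right h3

/-- The leading term of every `2 × 2` minor is its diagonal. -/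
def IsDiagonalTwo (m : MonomialOrder (Fin n × Fin n)) : Prop :=
  ∀ i i' j j' : Fin n, i < i' → j < j' →
    Finsupp.single (i, j') 1 + Finsupp.single (i', j) 1 ≺[m]
      Finsupp.single (i, j) 1 + Finsupp.single (i', j') 1

/-- Exchanging the rows of the two entries would give a larger monomial, by the 2 × 2 case of
diagonality. So one of the two new positions lies in `Z`, and it cannot be the southeast one, which
lies below an entry outside the lower set `Z`. -/
theorem IsLead.mem_of_inversion (hm : IsDiagonalTwo m) {Z : Set (Fin n × Fin n)}
    (hZ : IsLowerSet Z) {k : ℕ} {r c : Fin k → Fin n} (h : IsLead m Z r c) {a b : Fin k}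
    (hr : r a < r b) (hc : c b < c a) : (r a, c b) ∈ Z := by
  classical
  by_contra hZab
  have hab : a ≠ b := fun h => by subst h; exact lt_irrefl _ hr
  have h1 : (r b, c a) ∉ Z := fun h' => h.notMem a (hZ (Prod.mk_le_mk.2 ⟨hr.le, le_rfl⟩) h')
  have h2 := h.le (Equiv.swap a b) (fun x => by
    by_cases hxa : x = a
    · subst hxa; rwa [Equiv.swap_apply_left]
    · by_cases hxb : x = b
      · subst hxb; rwa [Equiv.swap_apply_right]
      · rw [Equiv.swap_apply_of_ne_of_ne hxa hxb]; exact h.notMem x)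
  have h3 : ∀ r' : Fin k → Fin n, matchExp r' c = (Finsupp.single (r' a, c a) 1 +
      Finsupp.single (r' b, c b) 1) +
      ∑ x ∈ (Finset.univ.erase a).erase b, Finsupp.single (r' x, c x) 1 := fun r' => by
    rw [matchExp, ← Finset.add_sum_erase _ _ (Finset.mem_univ a),
      ← Finset.add_sum_erase (Finset.univ.erase a) _ (Finset.mem_erase.2 ⟨hab.symm,
        Finset.mem_univ b⟩), add_assoc]
  have h4 : ∑ x ∈ (Finset.univ.erase a).erase b, Finsupp.single ((r ∘ Equiv.swap a b) x, c x) 1 =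
      ∑ x ∈ (Finset.univ.erase a).erase b, Finsupp.single (r x, c x) 1 := by
    refine Finset.sum_congr rfl fun x hx => ?_
    simp only [Finset.mem_erase, Finset.mem_univ, and_true] at hx
    rw [Function.comp_apply, Equiv.swap_apply_of_ne_of_ne hx.2 hx.1]
  rw [h3, h3 r, h4, map_add, map_add _ (Finsupp.single (r a, c a) 1 +
    Finsupp.single (r b, c b) 1)] at h2
  have h5 := le_of_add_le_add_right h2
  simp only [Function.comp_apply, Equiv.swap_apply_left, Equiv.swap_apply_right] at h5
  have h6 := hm (r a) (r b) (c b) (c a) hr hc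
  rw [add_comm (Finsupp.single (r b, c a) 1)] at h5
  exact absurd h5 (not_le.2 h6)

/-- Only this 2 × 2 case of diagonality is used afterwards; it is visibly symmetric under
transposition. -/
theorem IsDiagonal.isDiagonalTwo (hm : IsDiagonal m) : IsDiagonalTwo m := by
  intro i i' j j' hi hj
  have hr : StrictMono ![i, i'] := by
    intro a b hab
    fin_cases a <;> fin_cases b <;> simp_all
  have hc : StrictMono ![j, j'] := by
    intro a b hab
    fin_cases a <;> fin_cases b <;> simp_all
  have h := hm 2 (OrderEmbedding.ofStrictMono _ hr) (OrderEmbedding.ofStrictMono _ hc)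
  rw [← minor_empty] at h
  have h1 : ∏ a, genericMatrix n ((OrderEmbedding.ofStrictMono _ hr) a)
      ((OrderEmbedding.ofStrictMono _ hc) a) =
      monomial (Finsupp.single (i, j) 1 + Finsupp.single (i', j') 1) 1 := by
    rw [Fin.prod_univ_two]
    simp [genericMatrix, X, monomial_mul]
  rw [h1] at h
  have h2 := congrArg m.degree h
  rw [m.degree_leadingTerm, m.degree_monomial, if_neg one_ne_zero] at h2
  have h3 := matchExp_mem_support_minor (Z := ∅) (OrderEmbedding.ofStrictMono _ hr).injective
    (OrderEmbedding.ofStrictMono _ hc).injective (σ := Equiv.swap 0 1) (fun _ h => h)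
  have h4 := m.le_degree h3
  have h5 : matchExp ((OrderEmbedding.ofStrictMono _ hr) ∘ Equiv.swap 0 1)
      (OrderEmbedding.ofStrictMono _ hc) =
      Finsupp.single (i, j') 1 + Finsupp.single (i', j) 1 := by
    rw [matchExp, Fin.sum_univ_two, add_comm]
    simp
  rw [h2, h5] at h4
  refine lt_of_le_of_ne h4 fun h6 => ?_
  have h7 := DFunLike.congr_fun (m.toSyn.injective h6) (i, j')
  simp [hi.ne', hj.ne] at h7

end MatrixSchubert

/-! ### Partial permutations and the deletion of minimal entries -/

namespace MatrixSchubert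

open MvPolynomial

open scoped MonomialOrder

variable {n : ℕ}

/-- The rank function of the partial permutation obtained from `w` by keeping the rows in `S`. -/
def rkOn (w : Equiv.Perm (Fin n)) (S : Finset (Fin n)) (x y : Fin n) : ℕ :=
  (S.filter fun k => k ≤ x ∧ w k ≤ y).card

/-- The positions of rank `0` of the partial permutation `w` on `S`. -/
def zeroSet (w : Equiv.Perm (Fin n)) (S : Finset (Fin n)) : Set (Fin n × Fin n) :=
  {v | ∀ k ∈ S, k ≤ v.1 → ¬ w k ≤ v.2}

/-- The positions in the rows and columns of the partial permutation `w` on `S`. -/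
def grid (w : Equiv.Perm (Fin n)) (S : Finset (Fin n)) : Set (Fin n × Fin n) :=
  {v | v.1 ∈ S ∧ w.symm v.2 ∈ S}

theorem isLowerSet_zeroSet (w : Equiv.Perm (Fin n)) (S : Finset (Fin n)) :
    IsLowerSet (zeroSet w S) := fun _ _ h hv k hk h1 h2 =>
  hv k hk (h1.trans h.1) (h2.trans h.2)

/-- The rows `r` and columns `c` define a minor that vanishes on the matrix Schubert variety of the
partial permutation `w` on `S` for rank reasons. -/
structure IsBig (w : Equiv.Perm (Fin n)) (S : Finset (Fin n)) {k : ℕ} (r c : Fin k → Fin n) :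
    Prop where
  row_mem : ∀ a, r a ∈ S
  col_mem : ∀ a, w.symm (c a) ∈ S
  exists_rkOn_lt : ∃ x y, (∀ a, r a ≤ x) ∧ (∀ a, c a ≤ y) ∧ rkOn w S x y < k

/-- The Schubert determinantal ideal of the partial permutation `w` on `S`. -/
noncomputable def minorIdeal (w : Equiv.Perm (Fin n)) (S : Finset (Fin n)) : Ideal (Poly n) :=
  Ideal.span {f | ∃ (k : ℕ) (r c : Fin k → Fin n), IsBig w S r c ∧ f = minor ∅ r c}

/-- The monomial with exponent `d` lies in the monomial ideal generated by the leading terms of the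
CDG generators of the partial permutation `w` on `S`. -/
def IsReducible (m : MonomialOrder (Fin n × Fin n)) (w : Equiv.Perm (Fin n))
    (S : Finset (Fin n)) (d : Fin n × Fin n →₀ ℕ) : Prop :=
  (∃ v ∈ zeroSet w S, d v ≠ 0) ∨
    ∃ (k : ℕ) (r c : Fin k → Fin n), IsBig w S r c ∧ IsLead m (zeroSet w S) r c ∧
      ∀ a, d (r a, c a) ≠ 0

/-- Every nonzero element of the determinantal ideal has a monomial that is divisible by the
leading term of a CDG generator. -/
def HasReducibleMonomials (m : MonomialOrder (Fin n × Fin n)) (w : Equiv.Perm (Fin n))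
    (S : Finset (Fin n)) : Prop :=
  ∀ f ∈ minorIdeal w S, f ∈ supported ℂ (grid w S) → f ≠ 0 →
    ∃ d ∈ f.support, IsReducible m w S d

variable {m : MonomialOrder (Fin n × Fin n)} {w : Equiv.Perm (Fin n)} {S : Finset (Fin n)}

theorem det_mem_subalgebra {A : Type*} [CommRing A] {R : Type*} [CommRing R] [Algebra R A]
    (B : Subalgebra R A) {k : ℕ} {M : Matrix (Fin k) (Fin k) A} (h : ∀ i j, M i j ∈ B) :
    M.det ∈ B := by
  rw [Matrix.det_apply']
  exact sum_mem fun σ _ => mul_mem (intCast_mem B _) (prod_mem fun i _ => h _ _)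

theorem minor_mem_minorIdeal {k : ℕ} {r c : Fin k → Fin n} (h : IsBig w S r c) :
    minor ∅ r c ∈ minorIdeal w S :=
  Ideal.subset_span ⟨k, r, c, h, rfl⟩

theorem X_mem_minorIdeal {v : Fin n × Fin n} (hv : v ∈ zeroSet w S) (hg : v ∈ grid w S) :
    (X v : Poly n) ∈ minorIdeal w S := by
  have h : IsBig w S (fun _ : Fin 1 => v.1) (fun _ => v.2) := by
    refine ⟨fun _ => hg.1, fun _ => hg.2, v.1, v.2, fun _ => le_rfl, fun _ => le_rfl, ?_⟩
    rw [rkOn, Nat.lt_one_iff, Finset.card_eq_zero, Finset.filter_eq_empty_iff]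
    exact fun k hk h => hv k hk h.1 h.2
  have h2 := minor_mem_minorIdeal h
  rwa [minor_empty, Matrix.det_fin_one] at h2

theorem IsBig.mem_grid {k : ℕ} {r c : Fin k → Fin n} (h : IsBig w S r c) (a b : Fin k) :
    (r a, c b) ∈ grid w S := ⟨h.row_mem a, h.col_mem b⟩

/-- The variables at rank-zero positions of the grid lie in the ideal, so replacing them by zero
does not change the minor modulo the ideal. -/
theorem minor_zeroSet_mem_minorIdeal {k : ℕ} {r c : Fin k → Fin n} (h : IsBig w S r c) :
    minor (zeroSet w S) r c ∈ minorIdeal w S := by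
  classical
  have h1 := minor_mem_minorIdeal h
  rw [← Ideal.Quotient.eq_zero_iff_mem] at h1 ⊢
  rw [← h1, minor, minor, RingHom.map_det, RingHom.map_det]
  congr 1
  ext i j : 1
  simp only [RingHom.mapMatrix_apply, Matrix.map_apply, Matrix.of_apply, Set.mem_empty_iff_false,
    if_false]
  split_ifs with hz
  · rw [map_zero, eq_comm, Ideal.Quotient.eq_zero_iff_mem]
    exact X_mem_minorIdeal hz (h.mem_grid i j)
  · rfl

theorem rkOn_mono {S T : Finset (Fin n)} (h : S ⊆ T) (x y : Fin n) :
    rkOn w S x y ≤ rkOn w T x y :=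
  Finset.card_le_card (Finset.filter_subset_filter _ h)

theorem rkOn_erase_add_one {p x y : Fin n} (hp : p ∈ S) (hx : p ≤ x) (hy : w p ≤ y) :
    rkOn w (S.erase p) x y + 1 = rkOn w S x y := by
  rw [rkOn, rkOn, Finset.filter_erase, Finset.card_erase_add_one]
  exact Finset.mem_filter.2 ⟨hp, hx, hy⟩

theorem rkOn_erase_eq {p x y : Fin n} (h : ¬ (p ≤ x ∧ w p ≤ y)) :
    rkOn w (S.erase p) x y = rkOn w S x y := by
  rw [rkOn, rkOn, Finset.filter_erase, Finset.erase_eq_of_notMem]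
  exact fun h' => h (Finset.mem_filter.1 h').2

theorem zeroSet_anti {S T : Finset (Fin n)} (h : S ⊆ T) : zeroSet w T ⊆ zeroSet w S :=
  fun _ hv k hk => hv k (h hk)

theorem grid_mono {S T : Finset (Fin n)} (h : S ⊆ T) : grid w S ⊆ grid w T :=
  fun _ hv => ⟨h hv.1, h hv.2⟩

/-- Bordering: an element of the ideal of `S.erase p` is lifted to an element of the ideal of `S`
that is linear in the variable at `(p, w p)`. -/
theorem exists_border {p : Fin n} (hp : p ∈ S) {f : Poly n} (hf : f ∈ minorIdeal w (S.erase p)) :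
    ∃ F ∈ supported ℂ (grid w S \ {(p, w p)}),
      X (p, w p) * killOutside (grid w (S.erase p)) f + F ∈ minorIdeal w S := by
  have hsub : grid w (S.erase p) ⊆ grid w S \ {(p, w p)} := fun v hv =>
    ⟨grid_mono (Finset.erase_subset p S) hv, fun h => by
      rw [Set.mem_singleton_iff] at h
      subst h
      exact Finset.notMem_erase p S hv.1⟩
  refine Submodule.span_induction (p := fun f _ => ∃ F ∈ supported ℂ (grid w S \ {(p, w p)}),
      X (p, w p) * killOutside (grid w (S.erase p)) f + F ∈ minorIdeal w S) ?_ ?_ ?_ ?_ hf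
  · rintro _ ⟨k, r, c, h, rfl⟩
    have h0 : minor ∅ r c ∈ supported ℂ (grid w (S.erase p)) :=
      minor_mem_supported fun i j _ => h.mem_grid i j
    rw [killOutside_eq_self h0]
    obtain ⟨x, y, hx, hy, hxy⟩ := h.exists_rkOn_lt
    -- If the region of `(x, y)` contains the entry in row `p`, restoring that entry raises the rank
    -- by one, and the minor bordered by row `p` and column `w p` is still too large. Otherwise the
    -- rank is unchanged and the minor itself already lies in the ideal of `S`.
    by_cases hpq : p ≤ x ∧ w p ≤ y
    · have h1 : IsBig w S (Fin.cons p r : Fin (k + 1) → Fin n) (Fin.cons (w p) c) := by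
        refine ⟨fun a => ?_, fun a => ?_, x, y, fun a => ?_, fun a => ?_, ?_⟩
        · refine Fin.cases ?_ (fun b => ?_) a
          · simpa using hp
          · simpa using (Finset.mem_erase.1 (h.row_mem b)).2
        · refine Fin.cases ?_ (fun b => ?_) a
          · simpa using hp
          · simpa using (Finset.mem_erase.1 (h.col_mem b)).2
        · refine Fin.cases ?_ (fun b => ?_) a
          · simpa using hpq.1
          · simpa using hx b
        · refine Fin.cases ?_ (fun b => ?_) a
          · simpa using hpq.2
          · simpa using hy b
        · rw [← rkOn_erase_add_one hp hpq.1 hpq.2]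
          omega
      refine ⟨minor ∅ (Fin.cons p r : Fin (k + 1) → Fin n) (Fin.cons (w p) c) -
        X (p, w p) * minor ∅ r c, ?_, by
          rw [add_sub_cancel]; exact minor_mem_minorIdeal h1⟩
      rw [minor_empty, minor_empty, Matrix.det_succ_row_zero, Fin.sum_univ_succ]
      have h2 : (((genericMatrix n).submatrix (Fin.cons p r : Fin (k + 1) → Fin n)
          (Fin.cons (w p) c)).submatrix Fin.succ (Fin.succAbove 0)) =
          (genericMatrix n).submatrix r c := by
        ext i j : 1
        simp
      rw [h2]
      simp only [Fin.val_zero, pow_zero, one_mul, Matrix.submatrix_apply, Fin.cons_zero,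
        Fin.cons_succ, genericMatrix, Matrix.of_apply]
      rw [add_sub_cancel_left]
      have hpc : ∀ j, (p, c j) ∈ grid w S \ {(p, w p)} := fun j =>
        ⟨⟨hp, (Finset.mem_erase.1 (h.col_mem j)).2⟩, fun h' => by
          rw [Set.mem_singleton_iff, Prod.mk.injEq] at h'
          have := h.col_mem j
          rw [h'.2, Equiv.symm_apply_apply] at this
          exact Finset.notMem_erase p S this⟩
      have hrq : ∀ j, (r j, w p) ∈ grid w S \ {(p, w p)} := fun j =>
        ⟨⟨(Finset.mem_erase.1 (h.row_mem j)).2, by simpa using hp⟩, fun h' => by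
          rw [Set.mem_singleton_iff, Prod.mk.injEq] at h'
          have := h.row_mem j
          rw [h'.1] at this
          exact Finset.notMem_erase p S this⟩
      refine sum_mem fun j _ => mul_mem (mul_mem (pow_mem (neg_mem (one_mem _)) _)
        (X_mem_supported.2 (hpc j))) (det_mem_subalgebra _ fun a b => ?_)
      rw [Matrix.submatrix_apply, Matrix.submatrix_apply, Matrix.of_apply, X_mem_supported,
        Fin.cons_succ]
      refine Fin.cases ?_ (fun b' => ?_) (j.succ.succAbove b)
      · simpa using hrq a
      · simpa using hsub (h.mem_grid a b')
    · refine ⟨0, zero_mem _, ?_⟩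
      rw [add_zero]
      refine Ideal.mul_mem_left _ _ (minor_mem_minorIdeal ⟨fun a =>
        (Finset.mem_erase.1 (h.row_mem a)).2, fun a => (Finset.mem_erase.1 (h.col_mem a)).2,
        x, y, hx, hy, ?_⟩)
      rwa [← rkOn_erase_eq hpq]
  · exact ⟨0, zero_mem _, by simp⟩
  · rintro f g - - ⟨F, hF, hF'⟩ ⟨G, hG, hG'⟩
    refine ⟨F + G, add_mem hF hG, ?_⟩
    have := add_mem hF' hG'
    rw [map_add]
    convert this using 1
    ring
  · rintro a f - ⟨F, hF, hF'⟩
    -- A coefficient may involve any variable; projecting it to the smaller grid keeps `F` free of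
    -- the variable at `(p, w p)`.
    refine ⟨killOutside (grid w (S.erase p)) a * F, mul_mem
      (supported_mono hsub (killOutside_mem_supported _ a)) hF, ?_⟩
    have := Ideal.mul_mem_left _ (killOutside (grid w (S.erase p)) a) hF'
    rw [smul_eq_mul, map_mul]
    convert this using 1
    ring

/-- A dominance-minimal position of the partial permutation is used by every leading transversal
that meets its row and its column. -/
theorem IsLead.eq_of_minimal (hm : IsDiagonalTwo m) {p : Fin n} (hp : p ∈ S)
    (hmin : ∀ k ∈ S, k ≤ p → w k ≤ w p → k = p) {k : ℕ} {r c : Fin k → Fin n}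
    (h : IsLead m (zeroSet w S) r c) {a b : Fin k} (ha : r a = p) (hb : c b = w p) : a = b := by
  by_contra hab
  have h1 := h.notMem a
  have h2 := h.notMem b
  simp only [zeroSet, Set.mem_ofPred_eq, not_forall, not_not] at h1 h2
  obtain ⟨k1, hk1, h3, h4⟩ := h1
  obtain ⟨k2, hk2, h5, h6⟩ := h2
  -- Some entry of `S` lies weakly northwest of `(p, c a)`; if `c a < w p`, minimality would make it
  -- the entry in row `p`, which is absurd. So `c a` is to the right of `w p`, and likewise `r b` is
  -- below `p`: an inversion with corner `(p, w p)`.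
  have hc : c b < c a := by
    refine lt_of_le_of_ne ?_ fun h' => hab (h.inj_col h').symm
    by_contra hlt
    rw [not_le, hb] at hlt
    have := hmin k1 hk1 (ha ▸ h3) (h4.trans hlt.le)
    subst this
    exact absurd (h4.trans_lt hlt) (lt_irrefl _)
  have hr : r a < r b := by
    refine lt_of_le_of_ne ?_ fun h' => hab (h.inj_row h')
    by_contra hlt
    rw [not_le, ha] at hlt
    have := hmin k2 hk2 (h5.trans hlt.le) (hb ▸ h6)
    subst this
    exact absurd (h5.trans_lt hlt) (lt_irrefl _)
  have := h.mem_of_inversion hm (isLowerSet_zeroSet w S) hr hc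
  rw [ha, hb] at this
  exact this p hp le_rfl le_rfl

theorem IsLead.mono {Z Z' : Set (Fin n × Fin n)} (hZ : Z ⊆ Z') {k : ℕ} {r c : Fin k → Fin n}
    (h : IsLead m Z r c) (hn : ∀ a, (r a, c a) ∉ Z') : IsLead m Z' r c :=
  ⟨h.inj_row, h.inj_col, hn, fun σ hσ => h.le σ fun a ha => hσ a (hZ ha)⟩

/-- When entries are deleted the zero set grows. A leading transversal either meets the new zeros,
and then a variable divides the monomial, or it stays leading because there are fewer competitors.
-/
theorem isReducible_of_isLead {Z : Set (Fin n × Fin n)} (hZ : Z ⊆ zeroSet w S) {k : ℕ}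
    {r c : Fin k → Fin n} (hb : IsBig w S r c) (hl : IsLead m Z r c)
    {d : Fin n × Fin n →₀ ℕ} (hd : ∀ a, d (r a, c a) ≠ 0) : IsReducible m w S d := by
  by_cases h : ∃ a, (r a, c a) ∈ zeroSet w S
  · obtain ⟨a, ha⟩ := h
    exact Or.inl ⟨_, ha, hd a⟩
  · exact Or.inr ⟨k, r, c, hb, hl.mono hZ (not_exists.1 h), hd⟩

/-- If a monomial in the variables of `S.erase p` becomes reducible for `S` when multiplied by the
variable at `(p, w p)`, then it was reducible. -/
theorem IsReducible.erase {p : Fin n} (hp : p ∈ S) {d : Fin n × Fin n →₀ ℕ}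
    (hd : ∀ v, d v ≠ 0 → v ∈ grid w (S.erase p))
    (h : IsReducible m w S (Finsupp.single (p, w p) 1 + d)) :
    IsReducible m w (S.erase p) d := by
  have hne : ∀ v, v ≠ (p, w p) → (Finsupp.single (p, w p) 1 + d : Fin n × Fin n →₀ ℕ) v ≠ 0 → d v ≠ 0 := by
    intro v hv h
    rwa [Finsupp.add_apply, Finsupp.single_eq_of_ne hv, zero_add] at h
  have hZ := zeroSet_anti (w := w) (Finset.erase_subset p S)
  have hcol : ∀ i, d (i, w p) = 0 := fun i => by
    by_contra h
    have := (hd _ h).2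
    simp at this
  have hrow : ∀ j, d (p, j) = 0 := fun i => by
    by_contra h
    have := (hd _ h).1
    simp at this
  rcases h with ⟨v, hv, hdv⟩ | ⟨k, r, c, hb, hl, hle⟩
  · refine Or.inl ⟨v, hZ hv, hne v ?_ hdv⟩
    rintro rfl
    exact hv p hp le_rfl le_rfl
  · obtain ⟨x, y, hx, hy, hxy⟩ := hb.exists_rkOn_lt
    -- Since `d` has no variable in row `p` or column `w p`, the transversal meets them at most in
    -- `(p, w p)`. Deleting that entry lowers size and rank by one each; if it is absent, the rank
    -- does not increase.
    by_cases ha : ∃ a, r a = p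
    · obtain ⟨a, ha⟩ := ha
      have hca : c a = w p := by
        by_contra hca
        refine hne (r a, c a) (fun h => hca (Prod.mk.inj h).2) (hle a) ?_
        rw [ha, hrow]
      obtain ⟨l, rfl⟩ : ∃ l, k = l + 1 := ⟨k - 1, by have := a.pos; omega⟩
      have hra : ∀ b, r (a.succAbove b) ≠ p := fun b h =>
        Fin.succAbove_ne a b (hl.inj_row (h.trans ha.symm))
      have hcb : ∀ b, c (a.succAbove b) ≠ w p := fun b h =>
        Fin.succAbove_ne a b (hl.inj_col (h.trans hca.symm))
      refine isReducible_of_isLead (r := r ∘ a.succAbove) (c := c ∘ a.succAbove) hZ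
        ⟨fun b => Finset.mem_erase.2 ⟨hra b, hb.row_mem _⟩, fun b => Finset.mem_erase.2
          ⟨fun h => hcb b ?_, hb.col_mem _⟩, x, y, fun b => hx _, fun b => hy _, ?_⟩
        (hl.comp a.succAboveEmb) fun b => hne _ (fun h => hra b (Prod.mk.inj h).1) (hle _)
      · exact (Equiv.symm_apply_eq w).1 h
      · have := rkOn_erase_add_one hp (ha ▸ hx a) (hca ▸ hy a)
        omega
    · push Not at ha
      have hcb : ∀ b, c b ≠ w p := fun b h => by
        refine hne (r b, c b) (fun h' => ha b (Prod.mk.inj h').1) (hle b) ?_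
        rw [h, hcol]
      refine isReducible_of_isLead hZ ⟨fun b => Finset.mem_erase.2 ⟨ha b, hb.row_mem _⟩,
        fun b => Finset.mem_erase.2 ⟨fun h => hcb b ((Equiv.symm_apply_eq w).1 h), hb.col_mem _⟩,
        x, y, hx, hy, (rkOn_mono (Finset.erase_subset p S) x y).trans_lt hxy⟩ hl
        fun b => hne _ (fun h => ha b (Prod.mk.inj h).1) (hle b)

/-- A counterexample `f` for the smaller set is bordered to `x f + F`, with `x` the variable at `(p,
w p)`, and `F` is reduced as far as possible without `x`. Minimality of `p` ensures that a leading
transversal meeting both row `p` and column `w p` contains `x`, so it cannot divide a monomial of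
the remainder. -/
theorem HasReducibleMonomials.erase (hm : IsDiagonalTwo m) (h : HasReducibleMonomials m w S)
    {p : Fin n} (hp : p ∈ S) (hmin : ∀ k ∈ S, k ≤ p → w k ≤ w p → k = p) :
    HasReducibleMonomials m w (S.erase p) := by
  intro f hf hfs hf0
  by_contra hcon
  push Not at hcon
  obtain ⟨F, hF, hFI⟩ := exists_border hp hf
  rw [killOutside_eq_self hfs] at hFI
  set Z := zeroSet w S with hZdef
  have hpZ : (p, w p) ∉ Z := fun h => h p hp le_rfl le_rfl
  -- These divisors do not involve `x`, so the remainder of `F` is also free of `x`, and the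
  -- coefficient of `x` stays equal to `f`.
  let B : Set (Poly n) := {g | ∃ v ∈ Z, v ∈ grid w S ∧ g = X v} ∪
    {g | ∃ (k : ℕ) (r c : Fin k → Fin n), IsBig w S r c ∧ IsLead m Z r c ∧
      (¬ ∃ a b, r a = p ∧ c b = w p) ∧ g = minor Z r c}
  have hBu : ∀ b ∈ B, IsUnit (m.leadingCoeff b) := by
    rintro b (⟨v, -, -, rfl⟩ | ⟨k, r, c, -, hl, -, rfl⟩)
    · rw [m.leadingCoeff_X]
      exact isUnit_one
    · exact hl.isUnit_leadingCoeff
  have hBs : ∀ b ∈ B, b ∈ supported ℂ (grid w S \ {(p, w p)}) := by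
    rintro b (⟨v, hv, hg, rfl⟩ | ⟨k, r, c, hb, hl, hn, rfl⟩)
    · rw [X_mem_supported]
      exact ⟨hg, fun h => hpZ (by rw [Set.mem_singleton_iff] at h; rwa [← h])⟩
    · refine minor_mem_supported fun i j _ => ⟨hb.mem_grid i j, fun h => hn ⟨i, j, ?_⟩⟩
      exact Prod.mk.inj h
  have hBI : Ideal.span B ≤ minorIdeal w S := by
    rw [Ideal.span_le]
    rintro b (⟨v, hv, hg, rfl⟩ | ⟨k, r, c, hb, hl, hn, rfl⟩)
    · exact X_mem_minorIdeal hv hg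
    · exact minor_zeroSet_mem_minorIdeal hb
  obtain ⟨q, hq, hFq, hqB⟩ := exists_remainder m hBu hBs hF
  have hsub : grid w (S.erase p) ⊆ grid w S := grid_mono (Finset.erase_subset p S)
  have hG : X (p, w p) * f + q ∈ minorIdeal w S := by
    have := sub_mem hFI (hBI hFq)
    convert this using 1
    ring
  have hGs : X (p, w p) * f + q ∈ supported ℂ (grid w S) := by
    refine add_mem (mul_mem (X_mem_supported.2 ⟨hp, by simpa using hp⟩)
      (supported_mono hsub hfs)) (supported_mono Set.sdiff_subset hq)
  have hG0 : X (p, w p) * f + q ≠ 0 := by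
    obtain ⟨d, hd⟩ := support_nonempty.2 hf0
    intro h0
    have h1 := congrArg (coeff (Finsupp.single (p, w p) 1 + d)) h0
    rw [coeff_add, coeff_X_mul, coeff_zero] at h1
    have h2 : coeff (Finsupp.single (p, w p) 1 + d) q = 0 := by
      by_contra h
      have := (mem_supported_iff_support.1 hq _ (mem_support_iff.2 h) (p, w p) (by simp)).2
      exact this rfl
    rw [h2, add_zero] at h1
    exact (mem_support_iff.1 hd) h1
  obtain ⟨D, hD, hred⟩ := h _ hG hGs hG0
  rcases Finset.mem_union.1 (support_add hD) with hD | hD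
  · rw [support_X_mul, Finset.mem_map] at hD
    obtain ⟨d, hd, rfl⟩ := hD
    exact hcon d hd (IsReducible.erase hp (mem_supported_iff_support.1 hfs d hd) hred)
  · have hDs := mem_supported_iff_support.1 hq D hD
    rcases hred with ⟨v, hv, hDv⟩ | ⟨k, r, c, hb, hl, hle⟩
    · refine hqB D hD (X v) (Or.inl ⟨v, hv, (hDs v hDv).1, rfl⟩) ?_
      rw [m.degree_X, Finsupp.single_le_iff]
      exact Nat.one_le_iff_ne_zero.2 hDv
    · refine hqB D hD (minor Z r c) (Or.inr ⟨k, r, c, hb, hl, ?_, rfl⟩) ?_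
      -- A leading minor excluded from `B` has `(p, w p)` on its leading transversal, a variable
      -- absent from `q`.
      · rintro ⟨a, b, ha, hb'⟩
        obtain rfl := hl.eq_of_minimal hm hp hmin ha hb'
        have := (hDs _ (hle a)).2
        rw [ha, hb'] at this
        exact this rfl
      · rw [hl.degree_minor, matchExp_le_iff hl.inj_col]
        exact hle

/-- The bottom row `p` of the complement is put back first: any other entry southeast of it lies
lower, hence in `S`, so `insert p S` is again closed. No entry of `S` is weakly northwest of the one
in row `p`, as closedness would then put `p` into `S`; so it may be erased. -/
theorem HasReducibleMonomials.of_upper (hm : IsDiagonalTwo m)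
    (h : HasReducibleMonomials m w Finset.univ)
    (hS : ∀ i ∈ S, ∀ k, i ≤ k → w i ≤ w k → k ∈ S) : HasReducibleMonomials m w S := by
  induction hc : (Sᶜ).card generalizing S with
  | zero =>
    rw [Finset.card_eq_zero, Finset.compl_eq_empty_iff] at hc
    exact hc ▸ h
  | succ k ih =>
    have hne : Sᶜ.Nonempty := Finset.card_pos.1 (by omega)
    obtain ⟨p, hp, hmax⟩ := Sᶜ.exists_maximal hne
    rw [Finset.mem_compl] at hp
    have h1 : HasReducibleMonomials m w (insert p S) := by
      refine ih (fun i hi k hik hwik => ?_) ?_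
      · rcases Finset.mem_insert.1 hi with rfl | hi
        · by_contra hk
          rw [Finset.mem_insert, not_or] at hk
          exact hk.1 (le_antisymm (hmax (Finset.mem_compl.2 hk.2) hik) hik)
        · exact Finset.mem_insert_of_mem (hS i hi k hik hwik)
      · rw [Finset.compl_insert, Finset.card_erase_of_mem (Finset.mem_compl.2 hp), hc,
          Nat.add_sub_cancel]
    have h2 := h1.erase hm (Finset.mem_insert_self p S) (fun k hk hkp hwk => by
      rcases Finset.mem_insert.1 hk with rfl | hk
      · rfl
      · exact absurd (hS k hk p hkp hwk) hp)
    rwa [Finset.erase_insert hp] at h2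

end MatrixSchubert

namespace MatrixSchubert

open MvPolynomial

open scoped MonomialOrder

variable {n : ℕ} {m : MonomialOrder (Fin n × Fin n)} {w : Equiv.Perm (Fin n)}
  {S : Finset (Fin n)}

/-! ### From the Gröbner property to reducible monomials -/

section Groebner

theorem span_nwMinors_succ_le (M : Matrix (Fin n) (Fin n) (Poly n)) (k : ℕ) (i j : Fin n) :
    Ideal.span (nwMinors M (k + 1) i j) ≤ Ideal.span (nwMinors M k i j) := by
  rw [Ideal.span_le]
  rintro _ ⟨r, c, hr, hc, rfl⟩
  rw [SetLike.mem_coe, Matrix.det_succ_row_zero]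
  refine Ideal.sum_mem _ fun l _ => Ideal.mul_mem_left _ _ (Ideal.subset_span
    ⟨(Fin.succOrderEmb k).trans r, (Fin.succAboveOrderEmb l).trans c, fun a => hr _, fun a => hc _,
      rfl⟩)

theorem span_nwMinors_anti (M : Matrix (Fin n) (Fin n) (Poly n)) {k l : ℕ} (h : k ≤ l)
    (i j : Fin n) : Ideal.span (nwMinors M l i j) ≤ Ideal.span (nwMinors M k i j) := by
  induction l, h using Nat.le_induction with
  | base => exact le_rfl
  | succ l _ ih => exact (span_nwMinors_succ_le M l i j).trans ih

/-- Sorting rows and columns changes the determinant by a sign, and a repetition makes it zero. -/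
theorem det_submatrix_mem_span_nwMinors (M : Matrix (Fin n) (Fin n) (Poly n)) {k : ℕ}
    (r c : Fin k → Fin n) {i j : Fin n} (hr : ∀ a, r a ≤ i) (hc : ∀ a, c a ≤ j) :
    (M.submatrix r c).det ∈ Ideal.span (nwMinors M k i j) := by
  by_cases hri : Function.Injective r
  · by_cases hci : Function.Injective c
    · have h1 : StrictMono (r ∘ Tuple.sort r) :=
        (Tuple.monotone_sort r).strictMono_of_injective (hri.comp (Tuple.sort r).injective)
      have h2 : StrictMono (c ∘ Tuple.sort c) :=
        (Tuple.monotone_sort c).strictMono_of_injective (hci.comp (Tuple.sort c).injective)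
      have h3 : (M.submatrix r c).det = (((Equiv.Perm.sign (Tuple.sort r)⁻¹ : ℤ) : Poly n) *
          ((Equiv.Perm.sign (Tuple.sort c)⁻¹ : ℤ) : Poly n)) *
          (M.submatrix (r ∘ Tuple.sort r) (c ∘ Tuple.sort c)).det := by
        rw [mul_assoc, ← Matrix.det_permute', ← Matrix.det_permute]
        congr 1
        ext a b : 1
        simp
      rw [h3]
      exact Ideal.mul_mem_left _ _ (Ideal.subset_span ⟨OrderEmbedding.ofStrictMono _ h1,
        OrderEmbedding.ofStrictMono _ h2, fun a => hr _, fun a => hc _, rfl⟩)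
    · simp only [Function.Injective, not_forall] at hci
      obtain ⟨a, b, h, hab⟩ := hci
      rw [Matrix.det_zero_of_column_eq hab fun x => by simp [h]]
      exact zero_mem _
  · simp only [Function.Injective, not_forall] at hri
    obtain ⟨a, b, h, hab⟩ := hri
    rw [Matrix.det_zero_of_row_eq hab (by ext x : 1; simp [h])]
    exact zero_mem _

theorem minorIdeal_univ_le (w : Equiv.Perm (Fin n)) :
    minorIdeal w Finset.univ ≤ schubertIdeal w := by
  rw [minorIdeal, Ideal.span_le]
  rintro _ ⟨k, r, c, h, rfl⟩
  obtain ⟨x, y, hx, hy, hxy⟩ := h.exists_rkOn_lt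
  rw [minor_empty]
  have h1 := span_nwMinors_anti _ (Nat.succ_le_of_lt hxy) x y
    (det_submatrix_mem_span_nwMinors (genericMatrix n) r c hx hy)
  have h2 : nwMinors (genericMatrix n) (rkOn w Finset.univ x y).succ x y ⊆
      {f | ∃ i j : Fin n, f ∈ nwMinors (genericMatrix n) (rk w i j + 1) i j} :=
    fun f hf => ⟨x, y, hf⟩
  exact Ideal.span_mono h2 h1

/-- Rank zero already forces a box of the Rothe diagram: otherwise the entry of `w` in row `i` or in
column `j` would be counted. -/
theorem dominantPart_eq_zeroSet (w : Equiv.Perm (Fin n)) :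
    dominantPart w = zeroSet w Finset.univ := by
  ext ⟨i, j⟩
  constructor
  · rintro ⟨-, h⟩ k - hk hk'
    rw [rk, Finset.card_eq_zero, Finset.filter_eq_empty_iff] at h
    exact h (Finset.mem_univ k) ⟨hk, hk'⟩
  · intro h
    refine ⟨⟨not_le.1 fun h' => h i (Finset.mem_univ _) le_rfl h', not_le.1 fun h' =>
      h (w.symm j) (Finset.mem_univ _) h' (by simp)⟩, ?_⟩
    rw [rk, Finset.card_eq_zero, Finset.filter_eq_empty_iff]
    exact fun k _ hk => h k (Finset.mem_univ k) hk.1 hk.2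

theorem cdgMatrix_submatrix_det {k : ℕ} (r c : Fin k → Fin n) :
    ((cdgMatrix w).submatrix r c).det = minor (zeroSet w Finset.univ) r c := by
  classical
  rw [minor, ← dominantPart_eq_zeroSet]
  congr 1

theorem exists_isLead_degree_minor {Z : Set (Fin n × Fin n)} {k : ℕ} {r c : Fin k → Fin n}
    (hr : Function.Injective r) (hc : Function.Injective c) (h : minor Z r c ≠ 0) :
    ∃ σ : Equiv.Perm (Fin k), IsLead m Z (r ∘ σ) c ∧
      m.degree (minor Z r c) = matchExp (r ∘ σ) c := by
  obtain ⟨σ, h1, h2⟩ := exists_of_mem_support_minor ((m.degree_mem_support_iff _).2 h)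
  refine ⟨σ, ⟨hr.comp σ.injective, hc, h2, fun τ hτ => ?_⟩, h1⟩
  rw [← h1]
  exact m.le_degree (matchExp_mem_support_minor hr hc (σ := σ * τ) hτ)

/-- The leading term of `f` lies in a monomial ideal, so its exponent is divisible by that of one
nonzero generator. For a minor, that exponent is a leading transversal once the rows are permuted.
-/
theorem hasReducibleMonomials_of_isGroebnerBasis
    (hG : IsGroebnerBasis m (cdgGenerators w) (schubertIdeal w)) :
    HasReducibleMonomials m w Finset.univ := by
  intro f hf _ hf0
  refine ⟨m.degree f, (m.degree_mem_support_iff f).2 hf0, ?_⟩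
  have h1 : m.leadingTerm f ∈ Ideal.span (m.leadingTerm '' cdgGenerators w) := by
    rw [hG.2]
    exact Ideal.subset_span ⟨f, minorIdeal_univ_le w hf, rfl⟩
  have h2 : Ideal.span (m.leadingTerm '' cdgGenerators w) ≤
      Ideal.span ((fun s => monomial s (1 : ℂ)) ''
        {s | ∃ g ∈ cdgGenerators w, g ≠ 0 ∧ s = m.degree g}) := by
    rw [Ideal.span_le]
    rintro _ ⟨g, hg, rfl⟩
    -- A minor of the matrix with zeros may vanish; such generators contribute nothing.
    by_cases hg0 : g = 0
    · rw [hg0, m.leadingTerm_zero]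
      exact zero_mem _
    · rw [SetLike.mem_coe, ← m.C_mul_leadingCoeff_monomial_degree]
      exact Ideal.mul_mem_left _ _ (Ideal.subset_span ⟨_, ⟨g, hg, hg0, rfl⟩, rfl⟩)
  obtain ⟨_, ⟨g, hg, hg0, rfl⟩, hle⟩ := mem_ideal_span_monomial_image.1 (h2 h1) (m.degree f) (by
    rw [m.support_leadingTerm' hf0]
    exact Finset.mem_singleton_self _)
  rcases hg with ⟨p, -, r, c, hr, hc, rfl⟩ | ⟨p, hp, rfl⟩
  · rw [cdgMatrix_submatrix_det] at hg0 hle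
    obtain ⟨σ, hσ, h3⟩ := exists_isLead_degree_minor (m := m) r.injective c.injective hg0
    rw [h3, matchExp_le_iff c.injective] at hle
    exact Or.inr ⟨_, _, _, ⟨fun _ => Finset.mem_univ _, fun _ => Finset.mem_univ _, p.1, p.2,
      fun a => hr _, hc, Nat.lt_succ_self _⟩, hσ, hle⟩
  · rw [m.degree_X, Finsupp.single_le_iff] at hle
    exact Or.inl ⟨p, dominantPart_eq_zeroSet w ▸ hp, Nat.one_le_iff_ne_zero.1 hle⟩

end Groebner

/-! ### Exchanging rows and columns, which replaces `w` by its inverse -/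

section Transpose

/-- The monomial order obtained by exchanging rows and columns. -/
noncomputable def transposeOrder (m : MonomialOrder (Fin n × Fin n)) :
    MonomialOrder (Fin n × Fin n) where
  syn := m.syn
  toSyn := (Finsupp.domCongr (Equiv.prodComm _ _)).trans m.toSyn
  toSyn_monotone := fun a b h => m.toSyn_monotone
    (a := a.equivMapDomain (Equiv.prodComm _ _)) (b := b.equivMapDomain (Equiv.prodComm _ _))
    fun v => h ((Equiv.prodComm _ _).symm v)

theorem transposeOrder_toSyn_le {a b : Fin n × Fin n →₀ ℕ} :
    a ≼[transposeOrder m] b ↔ a.equivMapDomain (Equiv.prodComm _ _) ≼[m]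
      b.equivMapDomain (Equiv.prodComm _ _) := Iff.rfl

theorem matchExp_swap {k : ℕ} (r c : Fin k → Fin n) :
    (matchExp r c).equivMapDomain (Equiv.prodComm _ _) = matchExp c r := by
  ext ⟨i, j⟩
  rw [Finsupp.equivMapDomain_apply, matchExp_apply, matchExp_apply]
  congr 1
  ext a
  simp [and_comm]

theorem IsDiagonalTwo.transpose (hm : IsDiagonalTwo m) : IsDiagonalTwo (transposeOrder m) := by
  intro i i' j j' hi hj
  have h := hm j j' i i' hj hi
  change m.toSyn (Finsupp.equivMapDomain _ _) < m.toSyn (Finsupp.equivMapDomain _ _)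
  have h1 : ∀ a b c d : Fin n, (Finsupp.single (a, b) 1 + Finsupp.single (c, d) 1 :
      Fin n × Fin n →₀ ℕ).equivMapDomain (Equiv.prodComm _ _) =
      Finsupp.single (b, a) 1 + Finsupp.single (d, c) 1 := fun a b c d => by
    have := map_add (Finsupp.domCongr (M := ℕ) (Equiv.prodComm (Fin n) (Fin n)))
      (Finsupp.single (a, b) 1) (Finsupp.single (c, d) 1)
    simpa [Finsupp.domCongr_apply, Finsupp.equivMapDomain_single] using this
  rw [h1, h1, add_comm]
  exact h

theorem matchExp_reindex {k : ℕ} (r c : Fin k → Fin n) (σ : Equiv.Perm (Fin k)) :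
    matchExp (r ∘ σ) (c ∘ σ) = matchExp r c :=
  Equiv.sum_comp σ fun a => Finsupp.single (r a, c a) 1

theorem IsLead.transpose {Z : Set (Fin n × Fin n)} {k : ℕ} {r c : Fin k → Fin n}
    (h : IsLead m Z r c) : IsLead (transposeOrder m) (Prod.swap ⁻¹' Z) c r where
  inj_row := h.inj_col
  inj_col := h.inj_row
  notMem a := h.notMem a
  le σ hσ := by
    rw [transposeOrder_toSyn_le, matchExp_swap, matchExp_swap]
    have h1 : matchExp r (c ∘ σ) = matchExp (r ∘ ⇑(σ⁻¹)) c := by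
      rw [← matchExp_reindex (r ∘ ⇑(σ⁻¹)) c σ]
      congr 1
      ext a
      simp
    rw [h1]
    refine h.le σ⁻¹ fun a => ?_
    have := hσ (σ⁻¹ a)
    simpa using this

theorem rkOn_inv_univ (x y : Fin n) :
    rkOn w⁻¹ Finset.univ x y = rkOn w Finset.univ y x := by
  refine Finset.card_bij (fun k _ => w⁻¹ k) ?_ (fun a _ b _ h => w⁻¹.injective h) ?_
  · intro a ha
    simpa [and_comm] using ha
  · intro b hb
    exact ⟨w b, by simpa [and_comm] using hb, by simp⟩

theorem zeroSet_inv_univ : zeroSet w⁻¹ Finset.univ = Prod.swap ⁻¹' zeroSet w Finset.univ := by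
  ext v
  constructor
  · intro h k _ h1 h2
    exact h (w k) (Finset.mem_univ _) h2 (by simpa using h1)
  · intro h k _ h1 h2
    exact h (w⁻¹ k) (Finset.mem_univ _) h2 (by simpa using h1)

theorem IsBig.transpose {k : ℕ} {r c : Fin k → Fin n} (h : IsBig w Finset.univ r c) :
    IsBig w⁻¹ Finset.univ c r := by
  obtain ⟨x, y, hx, hy, hxy⟩ := h.exists_rkOn_lt
  exact ⟨fun _ => Finset.mem_univ _, fun _ => Finset.mem_univ _, y, x, hy, hx,
    rkOn_inv_univ (w := w) y x ▸ hxy⟩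

theorem rename_swap_minor {k : ℕ} (r c : Fin k → Fin n) :
    rename (Equiv.prodComm _ _) (minor ∅ r c : Poly n) = minor ∅ c r := by
  rw [minor, minor, AlgHom.map_det, ← Matrix.det_transpose]
  congr 1
  ext i j : 1
  simp

theorem rename_swap_mem {f : Poly n} (hf : f ∈ minorIdeal w Finset.univ) :
    rename (Equiv.prodComm _ _) f ∈ minorIdeal w⁻¹ Finset.univ := by
  have h : minorIdeal w Finset.univ ≤
      (minorIdeal w⁻¹ Finset.univ).comap (rename (Equiv.prodComm _ _) : Poly n →ₐ[ℂ] Poly n) := by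
    rw [minorIdeal, Ideal.span_le]
    rintro _ ⟨k, r, c, h, rfl⟩
    rw [SetLike.mem_coe, Ideal.mem_comap, rename_swap_minor]
    exact minor_mem_minorIdeal h.transpose
  exact h hf

theorem HasReducibleMonomials.transpose (h : HasReducibleMonomials m w Finset.univ) :
    HasReducibleMonomials (transposeOrder m) w⁻¹ Finset.univ := by
  intro f hf _ hf0
  have h1 := rename_swap_mem hf
  rw [inv_inv] at h1
  have hinj : Function.Injective (Equiv.prodComm (Fin n) (Fin n)) := (Equiv.prodComm _ _).injective
  have h2 : rename (Equiv.prodComm (Fin n) (Fin n)) f ≠ 0 := fun h0 =>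
    hf0 (rename_injective _ hinj (h0.trans (map_zero _).symm))
  obtain ⟨d, hd, hred⟩ := h _ h1 (mem_supported_iff_support.2 fun _ _ _ _ =>
    ⟨Finset.mem_univ _, Finset.mem_univ _⟩) h2
  rw [support_rename_of_injective hinj, Finset.mem_image] at hd
  obtain ⟨d, hd, rfl⟩ := hd
  have h3 : ∀ i j, d.mapDomain (Equiv.prodComm (Fin n) (Fin n)) (i, j) = d (j, i) := fun i j =>
    Finsupp.mapDomain_apply hinj d (j, i)
  refine ⟨d, hd, ?_⟩
  rcases hred with ⟨⟨i, j⟩, hv, hdv⟩ | ⟨k, r, c, hb, hl, hle⟩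
  · refine Or.inl ⟨(j, i), ?_, by rwa [h3] at hdv⟩
    rw [zeroSet_inv_univ]
    exact hv
  · refine Or.inr ⟨k, c, r, hb.transpose, ?_, fun a => by rw [← h3]; exact hle a⟩
    rw [zeroSet_inv_univ]
    exact hl.transpose

end Transpose

end MatrixSchubert

/-! ### First obstruction: the remainder of a single minor -/

namespace MatrixSchubert

open MvPolynomial

open scoped MonomialOrder

variable {n : ℕ} {m : MonomialOrder (Fin n × Fin n)} {w : Equiv.Perm (Fin n)}
  {S : Finset (Fin n)}

theorem eval_minor {k : ℕ} (Z : Set (Fin n × Fin n)) (r c : Fin k → Fin n)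
    (y : Fin n × Fin n → ℂ) :
    eval y (minor Z r c) = ∑ σ : Equiv.Perm (Fin k), eval y (monomial (matchExp (r ∘ σ) c)
      (open Classical in
        if ∀ a, (r (σ a), c a) ∉ Z then ((Equiv.Perm.sign σ : ℤ) : ℂ) else 0)) := by
  rw [minor_eq_sum, map_sum]

theorem exists_perm_of_eval_minor_ne_zero {k : ℕ} {Z : Set (Fin n × Fin n)} {r c : Fin k → Fin n}
    {y : Fin n × Fin n → ℂ} (h : eval y (minor Z r c) ≠ 0) :
    ∃ σ : Equiv.Perm (Fin k), ∀ a, y (r (σ a), c a) ≠ 0 := by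
  classical
  rw [eval_minor] at h
  obtain ⟨σ, -, hσ⟩ := Finset.exists_ne_zero_of_sum_ne_zero h
  refine ⟨σ, fun a h0 => hσ ?_⟩
  rw [eval_monomial]
  have h1 : matchExp (r ∘ σ) c (r (σ a), c a) ≠ 0 := matchExp_apply_ne_zero.2 ⟨a, rfl⟩
  have h2 : ((matchExp (r ∘ σ) c).prod fun v e => y v ^ e) = 0 :=
    Finset.prod_eq_zero (Finsupp.mem_support_iff.2 h1) (by simp only [h0, zero_pow h1])
  rw [h2, mul_zero]

/-- A partial permutation with one more entry than the rank at its last entry, and otherwise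
satisfying the rank conditions, in a region without zero entries: the corresponding minor has a
remainder that obstructs the Gröbner property as soon as its diagonal violates some other rank
condition. -/
theorem not_hasReducibleMonomials_of_transversal_fin (hm : IsDiagonalTwo m) {k : ℕ}
    {φ r c : Fin k → Fin n} {A B i₀ x₀ y₀ : Fin n} (hφ : Function.Injective φ)
    (hφS : ∀ a, φ a ∈ S) (hr : Function.Injective r) (hc : Function.Injective c)
    (hrS : ∀ a, r a ∈ S) (hcS : ∀ a, w.symm (c a) ∈ S) (hAS : A ∈ S) (hBS : w.symm B ∈ S)
    (hφr : ∀ a, φ a ≤ r a) (hφc : ∀ a, w (φ a) ≤ c a) (hrA : ∀ a, r a < A) (hcB : ∀ a, c a < B)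
    (hrk : rkOn w S A B ≤ k) (h₀ : i₀ ∈ S) (h₀r : ∀ a, i₀ ≤ r a) (h₀c : ∀ a, w i₀ ≤ c a)
    (h₀A : i₀ ≤ A) (h₀B : w i₀ ≤ B) (hx₀ : x₀ < A)
    (hrow : rkOn w S x₀ y₀ < (Finset.univ.filter fun a => r a ≤ x₀).card)
    (hcol : rkOn w S x₀ y₀ < (Finset.univ.filter fun a => c a ≤ y₀).card) :
    ¬ HasReducibleMonomials m w S := by
  classical
  intro hP
  set Z := zeroSet w S with hZ
  set R : Fin (k + 1) → Fin n := Fin.cons A r with hR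
  set C : Fin (k + 1) → Fin n := Fin.cons B c with hC
  have hR0 : R 0 = A := rfl
  have hC0 : C 0 = B := rfl
  have hRs : ∀ a, R (Fin.succ a) = r a := fun a => rfl
  have hCs : ∀ a, C (Fin.succ a) = c a := fun a => rfl
  have hRinj : Function.Injective R := Fin.cons_injective_iff.2
    ⟨fun ⟨a, ha⟩ => (hrA a).ne ha, hr⟩
  have hCinj : Function.Injective C := Fin.cons_injective_iff.2
    ⟨fun ⟨a, ha⟩ => (hcB a).ne ha, hc⟩
  have hRA : ∀ a, R a ≤ A := Fin.cases le_rfl fun a => (hrA a).le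
  have hCB : ∀ a, C a ≤ B := Fin.cases le_rfl fun a => (hcB a).le
  have hRi : ∀ a, i₀ ≤ R a := Fin.cases h₀A h₀r
  have hCi : ∀ a, w i₀ ≤ C a := Fin.cases h₀B h₀c
  -- All these positions are weakly southeast of the entry in row `i₀`, so no zeros occur among
  -- them.
  have hRC : ∀ a b, (R a, C b) ∉ Z := fun a b h => h i₀ h₀ (hRi a) (hCi b)
  have hbig : IsBig w S R C := ⟨Fin.cases hAS hrS, Fin.cases hBS hcS, A, B, hRA, hCB, by omega⟩
  -- The 0/1 matrix of the transversal: the shifted entries of `w` together with the corner `(A,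
  -- B)`.
  let y : Fin n × Fin n → ℂ := fun v => if ∃ a, (R a, C a) = v then 1 else 0
  have hyD : eval y (minor ∅ R C) = 1 := by
    rw [minor, RingHom.map_det]
    convert Matrix.det_one (n := Fin (k + 1)) (R := ℂ)
    ext i j : 1
    simp only [RingHom.mapMatrix_apply, Matrix.map_apply, Matrix.of_apply,
      Set.mem_empty_iff_false, if_false, eval_X, Matrix.one_apply, y, Prod.mk.injEq]
    refine if_congr ⟨?_, fun h => ⟨i, rfl, h ▸ rfl⟩⟩ rfl rfl
    rintro ⟨a, h1, h2⟩
    exact (hRinj h1).symm.trans (hCinj h2)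
  -- A too large minor that is nonzero at `y` selects `l` ones of `y` in its region. If the corner
  -- is not among them, `φ` maps them to `l` entries of `w` in the same region, against the rank
  -- bound. With the corner, the region contains all `k` entries `φ a`, so `l = k + 1` and every row
  -- and column of the transversal is used.
  have key : ∀ {l : ℕ} {r' c' : Fin l → Fin n} {x z : Fin n}, Function.Injective c' →
      (∀ a, r' a ≤ x) → (∀ a, c' a ≤ z) → rkOn w S x z < l → eval y (minor Z r' c') ≠ 0 →
      A ≤ x ∧ l = k + 1 ∧ (∀ a, ∃ b, R a = r' b) ∧ (∀ a, ∃ b, C a = c' b) ∧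
        ∀ b, ∃ a, R a = r' b := by
    intro l r' c' x z hc' hx hz hlt hne
    obtain ⟨σ, hσ⟩ := exists_perm_of_eval_minor_ne_zero hne
    have h1 : ∀ a, ∃ b, (R b, C b) = (r' (σ a), c' a) := fun a => by
      by_contra h
      exact hσ a (if_neg h)
    choose b hb using h1
    simp only [Prod.mk.injEq] at hb
    have hbinj : Function.Injective b := fun a a' h => hc' (by
      rw [← (hb a).2, ← (hb a').2, h])
    have hRx : ∀ a, R (b a) ≤ x := fun a => (hb a).1 ▸ hx _
    have hCz : ∀ a, C (b a) ≤ z := fun a => (hb a).2 ▸ hz _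
    have h0 : ∃ a, b a = 0 := by
      by_contra h0
      push Not at h0
      have h2 : ∀ a, ∃ s, Fin.succ s = b a := fun a => Fin.exists_succ_eq.2 (h0 a)
      choose s hs using h2
      have h3 : l ≤ rkOn w S x z := by
        rw [← Fintype.card_fin l, ← Finset.card_univ]
        refine Finset.card_le_card_of_injOn (fun a => φ (s a)) (fun a _ => ?_) ?_
        · simp only [Finset.coe_filter, Set.mem_ofPred_eq]
          refine ⟨hφS _, (hφr _).trans ?_, (hφc _).trans ?_⟩
          · rw [← hRs, hs]; exact hRx a
          · rw [← hCs, hs]; exact hCz a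
        · intro a _ a' _ h
          exact hbinj (by rw [← hs, ← hs, hφ h])
      omega
    obtain ⟨a₀, ha₀⟩ := h0
    have hAx : A ≤ x := by rw [← hR0, ← ha₀]; exact hRx a₀
    have hBz : B ≤ z := by rw [← hC0, ← ha₀]; exact hCz a₀
    have h4 : k ≤ rkOn w S x z := by
      rw [← Fintype.card_fin k, ← Finset.card_univ]
      refine Finset.card_le_card_of_injOn φ (fun a _ => ?_) hφ.injOn
      simp only [Finset.coe_filter, Set.mem_ofPred_eq]
      exact ⟨hφS _, (hφr _).trans ((hrA a).le.trans hAx), (hφc _).trans ((hcB a).le.trans hBz)⟩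
    have h5 : l ≤ k + 1 := by
      simpa using Fintype.card_le_of_injective b hbinj
    have h6 : l = k + 1 := by omega
    subst h6
    have hbs : Function.Surjective b := Finite.surjective_of_injective hbinj
    refine ⟨hAx, rfl, fun a => ?_, fun a => ?_, fun a => ⟨b (σ⁻¹ a), ?_⟩⟩
    · obtain ⟨a', rfl⟩ := hbs a
      exact ⟨_, (hb a').1⟩
    · obtain ⟨a', rfl⟩ := hbs a
      exact ⟨_, (hb a').2⟩
    · rw [(hb _).1]
      simp
  -- Only divisors vanishing at `y` are used, so the remainder keeps the value 1 at `y` and is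
  -- nonzero.
  let G : Set (Poly n) := {g | ∃ v ∈ Z, v ∈ grid w S ∧ g = X v} ∪
    {g | ∃ (l : ℕ) (r' c' : Fin l → Fin n), IsBig w S r' c' ∧ IsLead m Z r' c' ∧
      eval y (minor Z r' c') = 0 ∧ g = minor Z r' c'}
  have hGu : ∀ b ∈ G, IsUnit (m.leadingCoeff b) := by
    rintro b (⟨v, -, -, rfl⟩ | ⟨k, r, c, -, hl, -, rfl⟩)
    · rw [m.leadingCoeff_X]
      exact isUnit_one
    · exact hl.isUnit_leadingCoeff
  have hGs : ∀ b ∈ G, b ∈ supported ℂ (grid w S) := by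
    rintro b (⟨v, hv, hg, rfl⟩ | ⟨k, r, c, hb, hl, hn, rfl⟩)
    · exact X_mem_supported.2 hg
    · exact minor_mem_supported fun i j _ => hb.mem_grid i j
  have hGI : Ideal.span G ≤ minorIdeal w S := by
    rw [Ideal.span_le]
    rintro b (⟨v, hv, hg, rfl⟩ | ⟨k, r, c, hb, hl, hn, rfl⟩)
    · exact X_mem_minorIdeal hv hg
    · exact minor_zeroSet_mem_minorIdeal hb
  have hG0 : Ideal.span G ≤ RingHom.ker (eval y) := by
    rw [Ideal.span_le]
    rintro b (⟨v, hv, hg, rfl⟩ | ⟨k, r, c, hb, hl, hn, rfl⟩)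
    · rw [SetLike.mem_coe, RingHom.mem_ker, eval_X]
      refine if_neg ?_
      rintro ⟨a, rfl⟩
      exact hRC a a hv
    · exact hn
  obtain ⟨q, hqs, hDq, hqG⟩ := exists_remainder m hGu hGs
    (minor_mem_supported (Z := ∅) fun i j _ => hbig.mem_grid i j)
  have hq0 : q ≠ 0 := by
    rintro rfl
    have := hG0 hDq
    rw [RingHom.mem_ker, sub_zero, hyD] at this
    exact one_ne_zero this
  have hqI : q ∈ minorIdeal w S := by
    have := sub_mem (minor_mem_minorIdeal hbig) (hGI hDq)
    rwa [sub_sub_cancel] at this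
  obtain ⟨d, hd, ⟨v, hv, hdv⟩ | ⟨l, r', c', hb, hl, hle⟩⟩ := hP q hqI hqs hq0
  · refine hqG d hd (X v) (Or.inl ⟨v, hv, mem_supported_iff_support.1 hqs d hd v hdv, rfl⟩) ?_
    rw [m.degree_X, Finsupp.single_le_iff]
    exact Nat.one_le_iff_ne_zero.2 hdv
  have hdvd : ∀ {l : ℕ} {r' c' : Fin l → Fin n}, IsBig w S r' c' → IsLead m Z r' c' →
      (∀ a, d (r' a, c' a) ≠ 0) → eval y (minor Z r' c') ≠ 0 := by
    intro l r' c' hb hl hle h0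
    refine hqG d hd _ (Or.inr ⟨l, r', c', hb, hl, h0, rfl⟩) ?_
    rwa [hl.degree_minor, matchExp_le_iff hl.inj_col]
  obtain ⟨x, z, hx, hz, hlt⟩ := hb.exists_rkOn_lt
  obtain ⟨-, rfl, hrow', hcol', hsurj⟩ := key hl.inj_col hx hz hlt (hdvd hb hl hle)
  have hsurjC : ∀ b, ∃ a, C a = c' b := by
    choose e he using hcol'
    have : Function.Surjective e := Finite.surjective_of_injective fun a b h =>
      hCinj (by rw [he, he, h])
    intro b
    obtain ⟨a, rfl⟩ := this b
    exact ⟨a, he a⟩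
  -- The surviving divisor has the rows `R` and columns `C`, among which nothing is zero, so its
  -- leading transversal has no inversion.
  have hmono : ∀ a b, r' a < r' b → ¬ c' b < c' a := by
    intro a b h1 h2
    have h3 := hl.mem_of_inversion hm (isLowerSet_zeroSet w S) h1 h2
    obtain ⟨i, hi⟩ := hsurj a
    obtain ⟨j, hj⟩ := hsurjC b
    rw [← hi, ← hj] at h3
    exact hRC i j h3
  set T : Finset (Fin (k + 1)) := Finset.univ.filter fun a => r' a ≤ x₀ ∧ c' a ≤ y₀ with hT
  -- Along an increasing transversal, the entries in rows up to `x₀` and those in columns up to `y₀`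
  -- are nested initial segments. `T` is the shorter one, and each is longer than the rank at `(x₀,
  -- y₀)`.
  have hTcard : rkOn w S x₀ y₀ < T.card := by
    by_cases hcase : ∀ a, r' a ≤ x₀ → c' a ≤ y₀
    · refine hrow.trans_le ?_
      choose e he using hrow'
      refine Finset.card_le_card_of_injOn (fun a => e (Fin.succ a)) (fun a ha => ?_) ?_
      · have h1 : r' (e (Fin.succ a)) ≤ x₀ := by
          rw [← he]; exact (Finset.mem_filter.1 ha).2
        exact Finset.mem_coe.2 (Finset.mem_filter.2 ⟨Finset.mem_univ _, h1, hcase _ h1⟩)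
      · intro a _ b _ h
        refine Fin.succ_injective _ (hRinj ?_)
        rw [he, he]
        exact congrArg r' h
    · push Not at hcase
      obtain ⟨a₁, h1, h2⟩ := hcase
      have hcase' : ∀ a, c' a ≤ y₀ → r' a ≤ x₀ := fun a ha => by
        by_contra h3
        exact hmono a₁ a (h1.trans_lt (not_le.1 h3)) (ha.trans_lt h2)
      refine hcol.trans_le ?_
      choose e he using hcol'
      refine Finset.card_le_card_of_injOn (fun a => e (Fin.succ a)) (fun a ha => ?_) ?_
      · have h1 : c' (e (Fin.succ a)) ≤ y₀ := by
          rw [← he]; exact (Finset.mem_filter.1 ha).2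
        exact Finset.mem_coe.2 (Finset.mem_filter.2 ⟨Finset.mem_univ _, hcase' _ h1, h1⟩)
      · intro a _ b _ h
        refine Fin.succ_injective _ (hCinj ?_)
        rw [he, he]
        exact congrArg c' h
  let ψ : Fin T.card ↪ Fin (k + 1) := (T.orderEmbOfFin rfl).toEmbedding
  have hψ : ∀ a, r' (ψ a) ≤ x₀ ∧ c' (ψ a) ≤ y₀ := fun a =>
    (Finset.mem_filter.1 (T.orderEmbOfFin_mem rfl a)).2
  have hb' : IsBig w S (r' ∘ ψ) (c' ∘ ψ) := ⟨fun a => hb.row_mem _, fun a => hb.col_mem _,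
    x₀, y₀, fun a => (hψ a).1, fun a => (hψ a).2, hTcard⟩
  have hl' := hl.comp ψ
  -- The part `T` of the diagonal leads a minor too large for `(x₀, y₀)` and divides the same
  -- monomial, so this minor cannot vanish at `y`; but then `A ≤ x₀`.
  have := (key hl'.inj_col (fun a => (hψ a).1) (fun a => (hψ a).2) hTcard
    (hdvd hb' hl' fun a => hle _)).1
  exact absurd (this.trans_lt hx₀) (lt_irrefl _)

theorem card_lt_card_filter_of_cover {ι α : Type*} [Fintype ι] {φ : ι → α} {T : Finset α}
    {p : ι → Prop} [DecidablePred p] (h : ∀ k ∈ T, ∃ a, φ a = k ∧ p a) {a₀ : ι} (h₀ : p a₀)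
    (h₁ : φ a₀ ∉ T) : T.card < (Finset.univ.filter p).card := by
  classical
  rw [Nat.lt_iff_add_one_le, ← Finset.card_insert_of_notMem h₁]
  refine le_trans (Finset.card_le_card fun k hk => ?_) (Finset.card_image_le (f := φ))
  rcases Finset.mem_insert.1 hk with rfl | hk
  · exact Finset.mem_image_of_mem φ (Finset.mem_filter.2 ⟨Finset.mem_univ _, h₀⟩)
  · obtain ⟨a, rfl, ha⟩ := h k hk
    exact Finset.mem_image_of_mem φ (Finset.mem_filter.2 ⟨Finset.mem_univ _, ha⟩)

/-- The two counting hypotheses are put in usable form: the entries counted by the rank at `(x₀,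
y₀)` stay in that region when shifted, while `a₁` supplies one more row and `a₂` one more column
whose original entries are not counted. -/
theorem not_hasReducibleMonomials_of_transversal (hm : IsDiagonalTwo m) {ι : Type*} [Fintype ι]
    (φ r c : ι → Fin n) {A B i₀ x₀ y₀ : Fin n} (hφ : Function.Injective φ)
    (hφS : ∀ a, φ a ∈ S) (hr : Function.Injective r) (hc : Function.Injective c)
    (hrS : ∀ a, r a ∈ S) (hcS : ∀ a, w.symm (c a) ∈ S) (hAS : A ∈ S) (hBS : w.symm B ∈ S)
    (hφr : ∀ a, φ a ≤ r a) (hφc : ∀ a, w (φ a) ≤ c a) (hrA : ∀ a, r a < A) (hcB : ∀ a, c a < B)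
    (hrk : ∀ k ∈ S, k ≤ A → w k ≤ B → ∃ a, φ a = k) (h₀ : i₀ ∈ S) (h₀r : ∀ a, i₀ ≤ r a)
    (h₀c : ∀ a, w i₀ ≤ c a) (h₀A : i₀ ≤ A) (h₀B : w i₀ ≤ B) (hx₀ : x₀ < A)
    (hcov : ∀ k ∈ S, k ≤ x₀ → w k ≤ y₀ → ∃ a, φ a = k ∧ r a ≤ x₀ ∧ c a ≤ y₀)
    {a₁ a₂ : ι} (h₁ : r a₁ ≤ x₀) (h₁' : φ a₁ ≤ x₀ → ¬ w (φ a₁) ≤ y₀)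
    (h₂ : c a₂ ≤ y₀) (h₂' : φ a₂ ≤ x₀ → ¬ w (φ a₂) ≤ y₀) :
    ¬ HasReducibleMonomials m w S := by
  classical
  let e : Fin (Fintype.card ι) ≃ ι := (Fintype.equivFin ι).symm
  have hcard : rkOn w S A B ≤ Fintype.card ι := by
    rw [← Finset.card_univ]
    refine le_trans (Finset.card_le_card fun k hk => ?_) (Finset.card_image_le (f := φ))
    simp only [Finset.mem_filter] at hk
    obtain ⟨a, rfl⟩ := hrk k hk.1 hk.2.1 hk.2.2
    exact Finset.mem_image_of_mem φ (Finset.mem_univ _)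
  have hcov' : ∀ k ∈ S.filter (fun k => k ≤ x₀ ∧ w k ≤ y₀),
      ∃ a, (φ ∘ e) a = k ∧ (r ∘ e) a ≤ x₀ ∧ (c ∘ e) a ≤ y₀ := fun k hk => by
    simp only [Finset.mem_filter] at hk
    obtain ⟨a, ha⟩ := hcov k hk.1 hk.2.1 hk.2.2
    exact ⟨e.symm a, by simpa using ha⟩
  refine not_hasReducibleMonomials_of_transversal_fin hm (φ := φ ∘ e) (r := r ∘ e) (c := c ∘ e) (y₀ := y₀)
    (hφ.comp e.injective) (fun a => hφS _) (hr.comp e.injective) (hc.comp e.injective)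
    (fun a => hrS _) (fun a => hcS _) hAS hBS (fun a => hφr _) (fun a => hφc _) (fun a => hrA _)
    (fun a => hcB _) hcard h₀ (fun a => h₀r _) (fun a => h₀c _) h₀A h₀B hx₀
    (card_lt_card_filter_of_cover (φ := φ ∘ e) (a₀ := e.symm a₁) (fun k hk => ?_) ?_ ?_)
    (card_lt_card_filter_of_cover (φ := φ ∘ e) (a₀ := e.symm a₂) (fun k hk => ?_) ?_ ?_)
  · obtain ⟨a, ha⟩ := hcov' k hk
    exact ⟨a, ha.1, ha.2.1⟩
  · simpa using h₁
  · simp only [Function.comp_apply, Equiv.apply_symm_apply, Finset.mem_filter]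
    exact fun h => h₁' h.2.1 h.2.2
  · obtain ⟨a, ha⟩ := hcov' k hk
    exact ⟨a, ha.1, ha.2.2⟩
  · simpa using h₂
  · simp only [Function.comp_apply, Equiv.apply_symm_apply, Finset.mem_filter]
    exact fun h => h₂' h.2.1 h.2.2

end MatrixSchubert

/-! ### The patterns 13254, 241635 and 4261735 -/

namespace MatrixSchubert

variable {n : ℕ} {m : MonomialOrder (Fin n × Fin n)} {w : Equiv.Perm (Fin n)}

/-- The rows of the entries of `w` that lie weakly southeast of the entry of `w` in a row in `I`. -/
def upperRows (w : Equiv.Perm (Fin n)) (I : Finset (Fin n)) : Finset (Fin n) :=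
  Finset.univ.filter fun k => ∃ i ∈ I, i ≤ k ∧ w i ≤ w k

theorem mem_upperRows {I : Finset (Fin n)} {k : Fin n} :
    k ∈ upperRows w I ↔ ∃ i ∈ I, i ≤ k ∧ w i ≤ w k := by simp [upperRows]

theorem HasReducibleMonomials.upperRows (hm : IsDiagonalTwo m)
    (h : HasReducibleMonomials m w Finset.univ) (I : Finset (Fin n)) :
    HasReducibleMonomials m w (upperRows w I) := by
  refine h.of_upper hm fun i hi k hik hwik => ?_
  obtain ⟨j, hj, h1, h2⟩ := mem_upperRows.1 hi
  exact mem_upperRows.2 ⟨j, hj, h1.trans hik, h2.trans hwik⟩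

/-- No shift is needed: the transversal is `w` itself southeast of `i₁` and northwest of the box
`(a, w u)`. The second box is `(i₂, w i₃)`: its last row and last column carry the entries of rows
`i₂` and `i₃`, neither of which its rank counts. -/
theorem not_hasReducibleMonomials_13254 (hm : IsDiagonalTwo m) {i₁ i₂ i₃ a u : Fin n}
    (h12 : i₁ < i₂) (h23 : i₂ < i₃) (h3a : i₃ < a) (hau : a < u) (w13 : w i₁ < w i₃)
    (w32 : w i₃ < w i₂) (w2u : w i₂ < w u) (wua : w u < w a) :
    ¬ HasReducibleMonomials m w Finset.univ := by
  intro hP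
  have hS : ∀ k, k ∈ upperRows w {i₁} ↔ i₁ ≤ k ∧ w i₁ ≤ w k := fun k => by simp [mem_upperRows]
  let ι := {k // i₁ ≤ k ∧ w i₁ ≤ w k ∧ k < a ∧ w k < w u}
  have hu : ∀ k, k ≤ a → w k ≤ w u → k < a ∧ w k < w u := fun k h1 h2 =>
    ⟨lt_of_le_of_ne h1 fun h => by rw [h] at h2; order, lt_of_le_of_ne h2 fun h => by
      rw [w.injective h] at h1; order⟩
  refine not_hasReducibleMonomials_of_transversal hm (S := upperRows w {i₁}) (ι := ι)
    (fun k => k.1) (fun k => k.1) (fun k => w k.1) (A := a) (B := w u) (i₀ := i₁) (x₀ := i₂)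
    (y₀ := w i₃) (a₁ := ⟨i₂, by refine ⟨?_, ?_, ?_, ?_⟩ <;> order⟩)
    (a₂ := ⟨i₃, by refine ⟨?_, ?_, ?_, ?_⟩ <;> order⟩)
    Subtype.val_injective (fun k => (hS _).2 ⟨k.2.1, k.2.2.1⟩) Subtype.val_injective
    (w.injective.comp Subtype.val_injective) (fun k => (hS _).2 ⟨k.2.1, k.2.2.1⟩)
    (fun k => by simpa using (hS _).2 ⟨k.2.1, k.2.2.1⟩) ((hS _).2 (by constructor <;> order))
    (by simpa using (hS u).2 (by constructor <;> order)) (fun k => le_rfl) (fun k => le_rfl)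
    (fun k => k.2.2.2.1) (fun k => k.2.2.2.2) ?_ ((hS _).2 ⟨le_rfl, le_rfl⟩) (fun k => k.2.1)
    (fun k => k.2.2.1) (by order) (by order) (by order) ?_ le_rfl (fun _ => by
      simp only; order) le_rfl (fun h => by simp only at h; order) (hP.upperRows hm _)
  · intro k hk h1 h2
    obtain ⟨h3, h4⟩ := hu k h1 h2
    exact ⟨⟨k, ((hS k).1 hk).1, ((hS k).1 hk).2, h3, h4⟩, rfl⟩
  · intro k hk h1 h2
    exact ⟨⟨k, ((hS k).1 hk).1, ((hS k).1 hk).2, by order, by order⟩, rfl, h1, h2⟩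

/-- The corner is `(a, w t)`. The entry in row `i₃` is moved right to the free column `w u`, which
brings it southeast of `i₁`. At `(i₂, w u)` the extra row is `i₂` and the extra column is `w u`. -/
theorem not_hasReducibleMonomials_241635 (hm : IsDiagonalTwo m) {i₁ i₂ i₃ a u t : Fin n}
    (h12 : i₁ < i₂) (h23 : i₂ < i₃) (h3a : i₃ < a) (hau : a < u) (hat : a < t) (w31 : w i₃ < w i₁)
    (w1u : w i₁ < w u) (wu2 : w u < w i₂) (w2t : w i₂ < w t) (wta : w t < w a) :
    ¬ HasReducibleMonomials m w Finset.univ := by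
  intro hP
  -- With the lowest such row, `i₃` is the only entry of `S` in the corner rectangle that is not
  -- southeast of `i₁`.
  obtain ⟨i₃, hi₃, hmax⟩ := (Finset.univ.filter fun e => i₂ < e ∧ e < a ∧ w e < w i₁).exists_max_image
    id ⟨i₃, by simp [*]⟩
  clear h23 h3a w31
  simp only [Finset.mem_filter, Finset.mem_univ, true_and, id] at hi₃ hmax
  obtain ⟨h23, h3a, w31⟩ := hi₃
  have hS : ∀ k, k ∈ upperRows w {i₁, i₃} ↔ (i₁ ≤ k ∧ w i₁ ≤ w k) ∨ (i₃ ≤ k ∧ w i₃ ≤ w k) :=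
    fun k => by simp [mem_upperRows]
  let κ := {k // i₁ ≤ k ∧ w i₁ ≤ w k ∧ k < a ∧ w k < w t}
  have hκ : ∀ k : κ, k.1 ∈ upperRows w {i₁, i₃} := fun k => (hS _).2 (Or.inl ⟨k.2.1, k.2.2.1⟩)
  have hu : ∀ k, k ≤ a → w k ≤ w t → k < a ∧ w k < w t := fun k h1 h2 =>
    ⟨lt_of_le_of_ne h1 fun h => by rw [h] at h2; order, lt_of_le_of_ne h2 fun h => by
      rw [w.injective h] at h1; order⟩
  let r : Option κ → Fin n := fun o => o.elim i₃ fun k => k.1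
  let c : Option κ → Fin n := fun o => o.elim (w u) fun k => w k.1
  have hr : Function.Injective r := by
    rintro (_ | k) (_ | l) h
    · rfl
    · have h' : i₃ = l.1 := h
      have := l.2.2.1
      rw [← h'] at this; order
    · have h' : k.1 = i₃ := h
      have := k.2.2.1
      rw [h'] at this; order
    · exact congrArg some (Subtype.ext h)
  have hc : Function.Injective c := by
    rintro (_ | k) (_ | l) h
    · rfl
    · have h' : u = l.1 := w.injective h
      have := l.2.2.2.1
      rw [← h'] at this; order
    · have h' : k.1 = u := w.injective h
      have := k.2.2.2.1
      rw [h'] at this; order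
    · exact congrArg some (Subtype.ext (w.injective h))
  have hrS : ∀ o, r o ∈ upperRows w {i₁, i₃} := by
    rintro (_ | k)
    · exact (hS _).2 (Or.inr ⟨le_rfl, le_rfl⟩)
    · exact hκ k
  refine not_hasReducibleMonomials_of_transversal hm (S := upperRows w {i₁, i₃}) r r c (A := a)
    (B := w t) (i₀ := i₁) (x₀ := i₂) (y₀ := w u)
    (a₁ := some ⟨i₂, by refine ⟨?_, ?_, ?_, ?_⟩ <;> order⟩) (a₂ := none)
    hr hrS hr hc hrS ?_ ((hS _).2 (Or.inl (by constructor <;> order)))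
    (by simpa using (hS t).2 (Or.inl (by constructor <;> order))) (fun _ => le_rfl) ?_ ?_ ?_ ?_
    ((hS _).2 (Or.inl ⟨le_rfl, le_rfl⟩)) ?_ ?_ (by order) (by order) (by order) ?_ le_rfl
    (fun _ => not_le.2 wu2) le_rfl (fun h => absurd h (not_le.2 h23)) (hP.upperRows hm _)
  · rintro (_ | k)
    · simpa [c] using (hS u).2 (Or.inl (by constructor <;> order))
    · simpa [c] using hκ k
  · rintro (_ | k)
    · change w i₃ ≤ w u; order
    · exact le_rfl
  · rintro (_ | k)
    · exact h3a
    · exact k.2.2.2.1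
  · rintro (_ | k)
    · change w u < w t; order
    · exact k.2.2.2.2
  · intro k hk h1 h2
    obtain ⟨h3, h4⟩ := hu k h1 h2
    by_cases hk1 : i₁ ≤ k ∧ w i₁ ≤ w k
    · exact ⟨some ⟨k, hk1.1, hk1.2, h3, h4⟩, rfl⟩
    · have hk3 := ((hS k).1 hk).resolve_left hk1
      refine ⟨none, le_antisymm hk3.1 (hmax k ⟨by order, h3, not_le.1 fun h => hk1 ⟨by order, h⟩⟩)⟩
  · rintro (_ | k)
    · change i₁ ≤ i₃; order
    · exact k.2.1
  · rintro (_ | k)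
    · change w i₁ ≤ w u; order
    · exact k.2.2.1
  · intro k hk h1 h2
    have hk1 := ((hS k).1 hk).resolve_right fun h => by order
    exact ⟨some ⟨k, hk1.1, hk1.2, by order, by order⟩, rfl, h1, h2⟩

/-- Two entries are shifted to come southeast of `i₂`: that of row `i₁` down to the free row `i₃`,
and that of row `i₄` right to the free column `w u`. They supply the extra row and column at `(i₃, w
u)`. Taking `i₁` and `i₄` lowest leaves no other entry to shift. -/
theorem not_hasReducibleMonomials_4261735 (hm : IsDiagonalTwo m) {i₁ i₂ i₃ i₄ a u t : Fin n}
    (h12 : i₁ < i₂) (h23 : i₂ < i₃) (h34 : i₃ < i₄) (h4a : i₄ < a) (hau : a < u) (hat : a < t)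
    (w42 : w i₄ < w i₂) (w2u : w i₂ < w u) (wu1 : w u < w i₁) (w1t : w i₁ < w t)
    (wta : w t < w a) (wt3 : w t < w i₃) :
    ¬ HasReducibleMonomials m w Finset.univ := by
  intro hP
  obtain ⟨i₄, hi₄, hmax₄⟩ :=
    (Finset.univ.filter fun e => i₃ < e ∧ e < a ∧ w e < w i₂).exists_max_image id ⟨i₄, by simp [*]⟩
  obtain ⟨i₁, hi₁, hmax₁⟩ :=
    (Finset.univ.filter fun e => e < i₂ ∧ w u < w e ∧ w e < w t).exists_max_image id
      ⟨i₁, by simp [*]⟩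
  clear h12 h34 h4a w42 wu1 w1t
  simp only [Finset.mem_filter, Finset.mem_univ, true_and, id] at hi₄ hmax₄ hi₁ hmax₁
  obtain ⟨h34, h4a, w42⟩ := hi₄
  obtain ⟨h12, wu1, w1t⟩ := hi₁
  set S := upperRows w {i₂, i₁, i₄} with hSdef
  have hS : ∀ k, k ∈ S ↔ (i₂ ≤ k ∧ w i₂ ≤ w k) ∨ (i₁ ≤ k ∧ w i₁ ≤ w k) ∨
      (i₄ ≤ k ∧ w i₄ ≤ w k) := fun k => by simp [hSdef, mem_upperRows]
  let κ := {k // i₂ ≤ k ∧ w i₂ ≤ w k ∧ k < a ∧ w k < w t}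
  have hκ : ∀ k : κ, k.1 ∈ S := fun k => (hS _).2 (Or.inl ⟨k.2.1, k.2.2.1⟩)
  have hu : ∀ k, k ≤ a → w k ≤ w t → k < a ∧ w k < w t := fun k h1 h2 =>
    ⟨lt_of_le_of_ne h1 fun h => by rw [h] at h2; order, lt_of_le_of_ne h2 fun h => by
      rw [w.injective h] at h1; order⟩
  have h1κ : ∀ k : κ, k.1 ≠ i₁ := fun k h => by
    have := k.2.1
    rw [h] at this; order
  have h3κ : ∀ k : κ, k.1 ≠ i₃ := fun k h => by
    have := k.2.2.2.2
    rw [h] at this; order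
  have h4κ : ∀ k : κ, k.1 ≠ i₄ := fun k h => by
    have := k.2.2.1
    rw [h] at this; order
  have huκ : ∀ k : κ, k.1 ≠ u := fun k h => by
    have := k.2.2.2.1
    rw [h] at this; order
  let φ : Option (Option κ) → Fin n := fun o => o.elim i₁ fun o => o.elim i₄ fun k => k.1
  let r : Option (Option κ) → Fin n := fun o => o.elim i₃ fun o => o.elim i₄ fun k => k.1
  let c : Option (Option κ) → Fin n := fun o => w (o.elim i₁ fun o => o.elim u fun k => k.1)
  have hφ : Function.Injective φ := by
    rintro (_ | _ | k) (_ | _ | l) h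
    · rfl
    · exact absurd h (by change ¬ i₁ = i₄; order)
    · exact absurd h.symm (h1κ l)
    · exact absurd h (by change ¬ i₄ = i₁; order)
    · rfl
    · exact absurd h.symm (h4κ l)
    · exact absurd h (h1κ k)
    · exact absurd h (h4κ k)
    · exact congrArg (some ∘ some) (Subtype.ext h)
  have hr : Function.Injective r := by
    rintro (_ | _ | k) (_ | _ | l) h
    · rfl
    · exact absurd h (by change ¬ i₃ = i₄; order)
    · exact absurd h.symm (h3κ l)
    · exact absurd h (by change ¬ i₄ = i₃; order)
    · rfl
    · exact absurd h.symm (h4κ l)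
    · exact absurd h (h3κ k)
    · exact absurd h (h4κ k)
    · exact congrArg (some ∘ some) (Subtype.ext h)
  have hc : Function.Injective c := by
    refine w.injective.comp ?_
    rintro (_ | _ | k) (_ | _ | l) h
    · rfl
    · exact absurd h (by change ¬ i₁ = u; order)
    · exact absurd h.symm (h1κ l)
    · exact absurd h (by change ¬ u = i₁; order)
    · rfl
    · exact absurd h.symm (huκ l)
    · exact absurd h (h1κ k)
    · exact absurd h (huκ k)
    · exact congrArg (some ∘ some) (Subtype.ext h)
  have h1S : i₁ ∈ S := (hS _).2 (Or.inr (Or.inl ⟨le_rfl, le_rfl⟩))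
  have h4S : i₄ ∈ S := (hS _).2 (Or.inr (Or.inr ⟨le_rfl, le_rfl⟩))
  have hse : ∀ k, i₂ ≤ k → w i₂ ≤ w k → k ∈ S := fun k h1 h2 => (hS _).2 (Or.inl ⟨h1, h2⟩)
  refine not_hasReducibleMonomials_of_transversal hm (S := S) φ r c (A := a)
    (B := w t) (i₀ := i₂) (x₀ := i₃) (y₀ := w u) (a₁ := none) (a₂ := some none)
    hφ ?_ hr hc ?_ ?_ (hse a (by order) (by order)) (by simpa using hse t (by order) (by order))
    ?_ ?_ ?_ ?_ ?_ (hse _ le_rfl le_rfl) ?_ ?_ (by order) (by order) (by order) ?_ le_rfl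
    (fun _ => not_le.2 wu1) le_rfl (fun h => absurd h (not_le.2 h34)) (hP.upperRows hm _)
  · rintro (_ | _ | k)
    · exact h1S
    · exact h4S
    · exact hκ k
  · rintro (_ | _ | k)
    · exact hse i₃ (by order) (by order)
    · exact h4S
    · exact hκ k
  · rintro (_ | _ | k)
    · simpa [c] using h1S
    · simpa [c] using hse u (by order) (by order)
    · simpa [c] using hκ k
  · rintro (_ | _ | k)
    · change i₁ ≤ i₃; order
    · exact le_rfl
    · exact le_rfl
  · rintro (_ | _ | k)
    · exact le_rfl
    · change w i₄ ≤ w u; order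
    · exact le_rfl
  · rintro (_ | _ | k)
    · change i₃ < a; order
    · exact h4a
    · exact k.2.2.2.1
  · rintro (_ | _ | k)
    · exact w1t
    · change w u < w t; order
    · exact k.2.2.2.2
  · intro k hk h1 h2
    obtain ⟨h3, h4⟩ := hu k h1 h2
    by_cases hk2 : i₂ ≤ k ∧ w i₂ ≤ w k
    · exact ⟨some (some ⟨k, hk2.1, hk2.2, h3, h4⟩), rfl⟩
    · rcases ((hS k).1 hk).resolve_left hk2 with hk1 | hk4
      · exact ⟨none, le_antisymm hk1.1 (hmax₁ k ⟨not_le.1 fun h => hk2 ⟨h, by order⟩,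
          by order, h4⟩)⟩
      · exact ⟨some none, le_antisymm hk4.1 (hmax₄ k ⟨by order, h3, not_le.1 fun h =>
          hk2 ⟨by order, h⟩⟩)⟩
  · rintro (_ | _ | k)
    · change i₂ ≤ i₃; order
    · change i₂ ≤ i₄; order
    · exact k.2.1
  · rintro (_ | _ | k)
    · change w i₂ ≤ w i₁; order
    · change w i₂ ≤ w u; order
    · exact k.2.2.1
  · intro k hk h1 h2
    have hk2 := ((hS k).1 hk).resolve_right fun h => h.elim (fun h => by order) fun h => by order
    exact ⟨some (some ⟨k, hk2.1, hk2.2, by order, by order⟩), rfl, h1, h2⟩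

end MatrixSchubert

/-! ### Second obstruction: eliminating a variable from two minors -/

namespace MatrixSchubert

open MvPolynomial

variable {n : ℕ} {m : MonomialOrder (Fin n × Fin n)} {w : Equiv.Perm (Fin n)}
  {S : Finset (Fin n)}

theorem minor_congr {k : ℕ} {Z Z' : Set (Fin n × Fin n)} {r c : Fin k → Fin n}
    (h : ∀ i j, (r i, c j) ∈ Z ↔ (r i, c j) ∈ Z') : minor Z r c = minor Z' r c := by
  classical
  unfold minor
  congr 1
  ext i j : 1
  simp only [Matrix.of_apply, h]

open Classical in
theorem minor_succ {k : ℕ} (Z : Set (Fin n × Fin n)) (r c : Fin (k + 1) → Fin n) :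
    minor Z r c = ∑ j : Fin (k + 1), (-1) ^ (j : ℕ) *
      (if (r 0, c j) ∈ Z then (0 : Poly n) else X (r 0, c j)) *
      minor Z (r ∘ Fin.succ) (c ∘ j.succAbove) := by
  rw [minor, Matrix.det_succ_row_zero]
  rfl

/-- Changing the zero set in the first entry of the first row only. -/
theorem minor_sub_minor_of_corner {k : ℕ} {Z : Set (Fin n × Fin n)} {r c : Fin (k + 1) → Fin n}
    (h₀ : (r 0, c 0) ∈ Z) (h₁ : ∀ j : Fin k, (r 0, c j.succ) ∉ Z)
    (h₂ : ∀ (i : Fin k) j, (r i.succ, c j) ∉ Z) :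
    minor ∅ r c = X (r 0, c 0) * minor Z (r ∘ Fin.succ) (c ∘ Fin.succ) + minor Z r c := by
  have h3 : ∀ j : Fin (k + 1), minor ∅ (r ∘ Fin.succ) (c ∘ j.succAbove) =
      minor Z (r ∘ Fin.succ) (c ∘ j.succAbove) := fun j =>
    minor_congr fun i j' => ⟨fun h => h.elim, fun h => absurd h (h₂ i _)⟩
  rw [minor_succ, minor_succ Z r c, Fin.sum_univ_succ, Fin.sum_univ_succ, if_pos h₀]
  simp only [Set.mem_empty_iff_false, if_false, h₁, h3, Fin.val_zero, pow_zero, one_mul, mul_zero,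
    zero_mul, zero_add]
  rfl

/-- Here the first row has a second zero whose variable lies in the ideal, so the expansion holds
only modulo the ideal. -/
theorem minor_sub_minor_mem {k : ℕ} {I : Ideal (Poly n)} {Z : Set (Fin n × Fin n)}
    {r c : Fin (k + 2) → Fin n}
    (h₀ : (r 0, c 0) ∈ Z) (h₀' : (X (r 0, c 1) : Poly n) ∈ I)
    (h₀'' : (r 0, c 1) ∈ Z) (h₁ : ∀ j : Fin k, (r 0, c j.succ.succ) ∉ Z)
    (h₂ : ∀ (i : Fin (k + 1)) j, (r i.succ, c j) ∉ Z) :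
    minor ∅ r c - (X (r 0, c 0) * minor Z (r ∘ Fin.succ) (c ∘ Fin.succ) + minor Z r c) ∈ I := by
  have h3 : ∀ j : Fin (k + 2), minor ∅ (r ∘ Fin.succ) (c ∘ j.succAbove) =
      minor Z (r ∘ Fin.succ) (c ∘ j.succAbove) := fun j =>
    minor_congr fun i j' => ⟨fun h => h.elim, fun h => absurd h (h₂ i _)⟩
  have h0s : (r 0, c (Fin.succ 0)) ∈ Z := h₀''
  rw [minor_succ, minor_succ Z r c, Fin.sum_univ_succ, Fin.sum_univ_succ, Fin.sum_univ_succ,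
    Fin.sum_univ_succ (n := k), if_pos h₀, if_pos h0s]
  simp only [Set.mem_empty_iff_false, if_false, h₁, h3, Fin.val_zero, pow_zero, one_mul, mul_zero,
    zero_mul, zero_add]
  rw [← add_assoc, add_sub_add_right_eq_sub, add_comm, add_sub_assoc]
  refine add_mem (Ideal.mul_mem_right _ _ (Ideal.mul_mem_left _ _ h₀')) ?_
  convert I.zero_mem
  exact sub_self _

theorem eval_minor_eq_det {k : ℕ} (Z : Set (Fin n × Fin n)) (r c : Fin k → Fin n)
    (y : Fin n × Fin n → ℂ) : eval y (minor Z r c) =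
      Matrix.det (Matrix.of fun i j => open Classical in
        if (r i, c j) ∈ Z then 0 else y (r i, c j)) := by
  classical
  rw [minor, RingHom.map_det]
  congr 1
  ext i j : 1
  simp only [RingHom.mapMatrix_apply, Matrix.map_apply, Matrix.of_apply]
  split_ifs <;> simp

/-- Two minors that share the rows `ρ` and columns `κ` and the entry at `(i₁, w i₁)` have, when
`(i₁, w i₂)` vanishes, a nonzero combination that does not involve these two variables. -/
theorem exists_combination_of_minors {i₁ i₂ : Fin n} {ρ κ : ℕ → Fin n} {N p q l : ℕ}
    (hpN : p ≤ N) (hqN : l + q + 1 ≤ N) (hqp : q ≤ p + 1)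
    (hρ : ∀ j < N, ∀ j' < N, ρ j = ρ j' → j = j')
    (hκ : ∀ j ≤ p, ∀ j' ≤ p, κ j = κ j' → j = j')
    (hi : i₁ ≠ i₂) (hρ₁ : ∀ j < N, ρ j ≠ i₁) (hρ₂ : ∀ j < N, ρ j ≠ i₂)
    (hκ₁ : ∀ j ≤ p, κ j ≠ w i₁) (hκ₂ : ∀ j ≤ p, κ j ≠ w i₂)
    {ra ca : Fin (p + 2) → Fin n} {rb cb : Fin (q + 2) → Fin n}
    (hra : ra = Fin.cons i₁ (Fin.cons i₂ fun j : Fin p => ρ j))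
    (hca : ca = Fin.cons (w i₁) fun j : Fin (p + 1) => κ j)
    (hrb : rb = Fin.cons i₁ fun j : Fin (q + 1) => ρ (l + j))
    (hcb : cb = Fin.cons (w i₁) (Fin.cons (w i₂) fun j : Fin q => κ j))
    (hA : IsBig w S ra ca) (hB : IsBig w S rb cb) (hz : (i₁, w i₂) ∈ zeroSet w S) :
    ∃ f ∈ minorIdeal w S, f ≠ 0 ∧ f ∈ supported ℂ {v | ((∃ a b, v = (ra a, ca b)) ∨
      ∃ a b, v = (rb a, cb b)) ∧ v ≠ (i₁, w i₁) ∧ v ≠ (i₁, w i₂)} := by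
  classical
  have hwi : w i₁ ≠ w i₂ := fun h => hi (w.injective h)
  set Z : Set (Fin n × Fin n) := {(i₁, w i₁), (i₁, w i₂)} with hZ
  have hZ' : ∀ v, v ∈ Z ↔ v = (i₁, w i₁) ∨ v = (i₁, w i₂) := fun v => by simp [hZ]
  have hZrow : ∀ i j, i ≠ i₁ → (i, j) ∉ Z := fun i j h h' => by
    rcases (hZ' _).1 h' with h' | h' <;> exact h (Prod.mk.inj h').1
  have hZcol : ∀ i, ∀ t ≤ p, (i, κ t) ∉ Z := fun i t ht h' => by
    rcases (hZ' _).1 h' with h' | h'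
    · exact hκ₁ t ht (Prod.mk.inj h').2
    · exact hκ₂ t ht (Prod.mk.inj h').2
  have hra0 : ra 0 = i₁ := by rw [hra]; rfl
  have hra1 : ra 1 = i₂ := by rw [hra]; rfl
  have hras : ∀ j : Fin p, ra j.succ.succ = ρ j := fun j => by rw [hra]; rfl
  have hca0 : ca 0 = w i₁ := by rw [hca]; rfl
  have hcas : ∀ j : Fin (p + 1), ca j.succ = κ j := fun j => by rw [hca]; rfl
  have hrb0 : rb 0 = i₁ := by rw [hrb]; rfl
  have hrbs : ∀ j : Fin (q + 1), rb j.succ = ρ (l + j) := fun j => by rw [hrb]; rfl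
  have hcb0 : cb 0 = w i₁ := by rw [hcb]; rfl
  have hcb1 : cb 1 = w i₂ := by rw [hcb]; rfl
  have hcbs : ∀ j : Fin q, cb j.succ.succ = κ j := fun j => by rw [hcb]; rfl
  have hras' : ∀ j : Fin (p + 1), ra j.succ ≠ i₁ := by
    refine Fin.cases ?_ fun j => ?_
    · exact hra1 ▸ hi.symm
    · rw [hras]; exact hρ₁ _ (by omega)
  have hrbs' : ∀ j : Fin (q + 1), rb j.succ ≠ i₁ := fun j => by
    rw [hrbs]; exact hρ₁ _ (by omega)
  have ha := minor_sub_minor_of_corner (Z := Z) (r := ra) (c := ca)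
    ((hZ' _).2 (Or.inl (by rw [hra0, hca0]))) (fun j => by rw [hcas]; exact hZcol _ _ (by omega))
    fun i j => hZrow _ _ (hras' i)
  have hb := minor_sub_minor_mem (I := minorIdeal w S) (Z := Z) (r := rb) (c := cb)
    ((hZ' _).2 (Or.inl (by rw [hrb0, hcb0])))
    (by
      rw [hrb0, hcb1]
      refine X_mem_minorIdeal hz ⟨?_, ?_⟩
      · rw [← hrb0]; exact hB.row_mem 0
      · rw [← hcb1]; exact hB.col_mem 1)
    ((hZ' _).2 (Or.inr (by rw [hrb0, hcb1])))
    (fun j => by rw [hcbs]; exact hZcol _ _ (by omega)) fun i j => hZrow _ _ (hrbs' i)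
  rw [hra0, hca0] at ha
  rw [hrb0, hcb0] at hb
  set a₁ := minor Z (ra ∘ Fin.succ) (ca ∘ Fin.succ) with ha₁
  set a₂ := minor Z ra ca with ha₂
  set b₁ := minor Z (rb ∘ Fin.succ) (cb ∘ Fin.succ) with hb₁
  set b₂ := minor Z rb cb with hb₂
  -- With `x` the variable at `(i₁, w i₁)`, the minors are `x a₁ + a₂` and, modulo the ideal, `x b₁
  -- + b₂`; this combination cancels `x`.
  refine ⟨b₁ * a₂ - a₁ * b₂, ?_, ?_, ?_⟩
  · have h1 := Ideal.mul_mem_left _ b₁ (minor_mem_minorIdeal hA)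
    have h2 := Ideal.mul_mem_left _ a₁ (minor_mem_minorIdeal hB)
    have h3 := Ideal.mul_mem_left _ a₁ hb
    rw [ha] at h1
    convert add_mem (sub_mem h1 h2) h3 using 1
    ring
  · intro h0
    -- Nonvanishing is tested at a 0/1 point. The first three families form a transversal of `a₂`,
    -- the last two one of `b₁`. Each family falls on one side of the other's diagonal, so both
    -- matrices are triangular up to a row swap, while row `i₂` of `a₁` is zero.
    set Y : Set (Fin n × Fin n) := {v | v = (i₁, κ 0) ∨ v = (i₂, w i₁) ∨
      (∃ j < p, v = (ρ j, κ (j + 1))) ∨ v = (ρ l, w i₂) ∨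
      ∃ j < q, v = (ρ (l + 1 + j), κ j)} with hY
    let y : Fin n × Fin n → ℂ := fun v => if v ∈ Y then 1 else 0
    have hY₁ : ∀ t ≤ p, (i₁, κ t) ∈ Y ↔ t = 0 := by
      intro t ht
      constructor
      · rintro (h | h | ⟨j, hj, h⟩ | h | ⟨j, hj, h⟩) <;> rw [Prod.mk.injEq] at h
        · exact hκ _ ht _ (by omega) h.2
        · exact absurd h.1 hi
        · exact absurd h.1.symm (hρ₁ _ (by omega))
        · exact absurd h.1.symm (hρ₁ _ (by omega))
        · exact absurd h.1.symm (hρ₁ _ (by omega))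
      · rintro rfl
        exact Or.inl rfl
    have hY₂ : ∀ t ≤ p, (i₂, κ t) ∉ Y := by
      rintro t ht (h | h | ⟨j, hj, h⟩ | h | ⟨j, hj, h⟩) <;> rw [Prod.mk.injEq] at h
      · exact hi h.1.symm
      · exact hκ₁ t ht h.2
      · exact hρ₂ _ (by omega) h.1.symm
      · exact hρ₂ _ (by omega) h.1.symm
      · exact hρ₂ _ (by omega) h.1.symm
    have hYw₁ : ∀ j < N, (ρ j, w i₁) ∉ Y := by
      rintro t ht (h | h | ⟨j, hj, h⟩ | h | ⟨j, hj, h⟩) <;> rw [Prod.mk.injEq] at h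
      · exact hρ₁ t ht h.1
      · exact hρ₂ t ht h.1
      · exact hκ₁ _ (by omega) h.2.symm
      · exact hwi h.2
      · exact hκ₁ _ (by omega) h.2.symm
    have hYw₂ : ∀ j < N, (ρ j, w i₂) ∈ Y ↔ j = l := by
      intro t ht
      constructor
      · rintro (h | h | ⟨j, hj, h⟩ | h | ⟨j, hj, h⟩) <;> rw [Prod.mk.injEq] at h
        · exact absurd h.1 (hρ₁ t ht)
        · exact absurd h.1 (hρ₂ t ht)
        · exact absurd h.2.symm (hκ₂ _ (by omega))
        · exact hρ _ ht _ (by omega) h.1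
        · exact absurd h.2.symm (hκ₂ _ (by omega))
      · rintro rfl
        exact Or.inr (Or.inr (Or.inr (Or.inl rfl)))
    have hYρ : ∀ j < N, ∀ t ≤ p, (ρ j, κ t) ∈ Y ↔
        (j < p ∧ t = j + 1) ∨ (t < q ∧ j = l + 1 + t) := by
      intro j hj t ht
      constructor
      · rintro (h | h | ⟨s, hs, h⟩ | h | ⟨s, hs, h⟩) <;> rw [Prod.mk.injEq] at h
        · exact absurd h.1 (hρ₁ j hj)
        · exact absurd h.1 (hρ₂ j hj)
        · have h1 := hρ _ hj _ (by omega) h.1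
          have h2 := hκ _ ht _ (by omega) h.2
          omega
        · exact absurd h.2 (hκ₂ t ht)
        · have h1 := hρ _ hj _ (by omega) h.1
          have h2 := hκ _ ht _ (by omega) h.2
          omega
      · rintro (⟨h1, rfl⟩ | ⟨h1, rfl⟩)
        · exact Or.inr (Or.inr (Or.inl ⟨j, h1, rfl⟩))
        · exact Or.inr (Or.inr (Or.inr (Or.inr ⟨t, h1, rfl⟩)))
    have h1 : eval y a₁ = 0 := by
      rw [ha₁, eval_minor_eq_det]
      refine Matrix.det_eq_zero_of_row_eq_zero 0 fun j => ?_
      rw [Matrix.of_apply]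
      have : ((ra ∘ Fin.succ) 0, (ca ∘ Fin.succ) j) = (i₂, κ j) := by
        rw [Function.comp_apply, Function.comp_apply, hcas]
        exact congrArg (·, κ j) hra1
      rw [this, if_neg (hZrow _ _ hi.symm)]
      exact if_neg (hY₂ _ (by omega))
    have h2 : eval y b₁ = 1 := by
      rw [hb₁, eval_minor_eq_det, Matrix.det_of_isUpperTriangular]
      · refine Finset.prod_eq_one fun i _ => ?_
        rw [Matrix.of_apply, Function.comp_apply, Function.comp_apply, if_neg (hZrow _ _ (hrbs' _))]
        refine if_pos ?_
        rw [hrbs]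
        refine Fin.cases ?_ (fun j => ?_) i
        · rw [show cb (Fin.succ 0) = w i₂ from hcb1]
          exact (hYw₂ l (by omega)).2 rfl
        · have hj := j.2
          rw [hcbs, Fin.val_succ, hYρ (l + (j + 1)) (by omega) j (by omega)]
          omega
      · intro i j hij
        change j < i at hij
        rw [Matrix.of_apply, Function.comp_apply, Function.comp_apply, if_neg (hZrow _ _ (hrbs' _))]
        refine if_neg ?_
        rw [hrbs]
        revert hij
        refine Fin.cases (fun hij => ?_) (fun j hij => ?_) j
        · have hij' : 0 < (i : ℕ) := hij
          rw [show cb (Fin.succ 0) = w i₂ from hcb1]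
          exact fun h => absurd ((hYw₂ (l + i) (by omega)).1 h) (by omega)
        · have hij' : (j : ℕ) + 1 < (i : ℕ) := hij
          rw [hcbs, hYρ _ (by omega) _ (by omega)]
          omega
    have h3 : eval y a₂ ≠ 0 := by
      rw [ha₂, eval_minor_eq_det]
      set M := (Matrix.of fun i j : Fin (p + 2) =>
        if (ra i, ca j) ∈ Z then (0 : ℂ) else y (ra i, ca j)) with hM
      have h4 : (M.submatrix (Equiv.swap 0 1) id).det = 1 := by
        have hs0 : (Equiv.swap (0 : Fin (p + 2)) 1) 0 = 1 := Equiv.swap_apply_left _ _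
        have hs1 : (Equiv.swap (0 : Fin (p + 2)) 1) (Fin.succ 0) = 0 := Equiv.swap_apply_right _ _
        have hss : ∀ j : Fin p, (Equiv.swap (0 : Fin (p + 2)) 1) j.succ.succ = j.succ.succ :=
          fun j => Equiv.swap_apply_of_ne_of_ne (Fin.succ_ne_zero _)
            fun h => Fin.succ_ne_zero j (Fin.succ_injective _ h)
        have hZn : ∀ (i : Fin (p + 2)) (j : Fin (p + 1)), M i j.succ = y (ra i, κ j) :=
          fun i j => by
            rw [hM, Matrix.of_apply, hcas, if_neg (hZcol _ _ (by omega))]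
        have hZ0 : ∀ (i : Fin (p + 1)), M i.succ 0 = y (ra i.succ, w i₁) :=
          fun i => by
            rw [hM, Matrix.of_apply, hca0, if_neg (hZrow _ _ (hras' _))]
        rw [Matrix.det_of_isLowerTriangular]
        · refine Finset.prod_eq_one fun i _ => ?_
          rw [Matrix.submatrix_apply, id]
          refine Fin.cases ?_ (fun i => Fin.cases ?_ (fun j => ?_) i) i
          · rw [hs0]
            refine (hZ0 0).trans (if_pos ?_)
            exact Or.inr (Or.inl (congrArg (·, w i₁) hra1))
          · rw [hs1, hZn, hra0]
            exact if_pos ((hY₁ _ (by simp)).2 (by simp))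
          · rw [hss, hZn, hras]
            refine if_pos ((hYρ _ (by omega) _ (by simp)).2 (Or.inl ⟨j.2, by simp⟩))
        · intro i j hij
          change i < j at hij
          rw [Matrix.submatrix_apply, id]
          obtain ⟨j, rfl⟩ := Fin.exists_succ_eq.2 (Fin.ne_zero_of_lt hij)
          rw [hZn]
          refine if_neg ?_
          revert hij
          refine Fin.cases (fun hij => ?_) (fun i => Fin.cases (fun hij => ?_) (fun i hij => ?_) i) i
          · rw [hs0, hra1]
            exact hY₂ _ (by omega)
          · rw [hs1, hra0, hY₁ _ (by omega)]
            have : 1 < (j : ℕ) + 1 := hij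
            omega
          · rw [hss, hras, hYρ _ (by omega) _ (by omega)]
            have : (i : ℕ) + 1 + 1 < (j : ℕ) + 1 := hij
            omega
      intro h5
      rw [Matrix.det_permute, show M.det = 0 by rw [hM]; convert h5, mul_zero] at h4
      exact zero_ne_one h4
    have h6 := congrArg (eval y) h0
    rw [map_sub, map_mul, map_mul, h1, h2, zero_mul, sub_zero, one_mul, map_zero] at h6
    exact h3 h6
  · have hV : ∀ v, v ∉ Z → v ≠ (i₁, w i₁) ∧ v ≠ (i₁, w i₂) := fun v hv =>
      ⟨fun h => hv ((hZ' v).2 (Or.inl h)), fun h => hv ((hZ' v).2 (Or.inr h))⟩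
    refine sub_mem (mul_mem ?_ ?_) (mul_mem ?_ ?_)
    · exact minor_mem_supported fun i j h => ⟨Or.inr ⟨_, _, rfl⟩, hV _ h⟩
    · exact minor_mem_supported fun i j h => ⟨Or.inl ⟨_, _, rfl⟩, hV _ h⟩
    · exact minor_mem_supported fun i j h => ⟨Or.inl ⟨_, _, rfl⟩, hV _ h⟩
    · exact minor_mem_supported fun i j h => ⟨Or.inr ⟨_, _, rfl⟩, hV _ h⟩

end MatrixSchubert

/-! ### Counting criterion for the combination of two minors -/

namespace MatrixSchubert

open MvPolynomial

variable {n : ℕ} {m : MonomialOrder (Fin n × Fin n)} {w : Equiv.Perm (Fin n)}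
  {S : Finset (Fin n)}

/-- The number of the first `N` terms of the sequence `ρ` that are at most `x`. -/
def countLE (ρ : ℕ → Fin n) (N : ℕ) (x : Fin n) : ℕ :=
  ((Finset.range N).filter fun j => ρ j ≤ x).card

theorem countLE_le (ρ : ℕ → Fin n) (N : ℕ) (x : Fin n) : countLE ρ N x ≤ N :=
  (Finset.card_filter_le _ _).trans (Finset.card_range N).le

theorem lt_countLE_iff {ρ : ℕ → Fin n} {N : ℕ} (hρ : ∀ j j', j < j' → j' < N → ρ j < ρ j')
    {x : Fin n} {j : ℕ} : j < countLE ρ N x ↔ j < N ∧ ρ j ≤ x := by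
  constructor
  · intro h
    by_contra hn
    refine absurd h (not_lt.2 ?_)
    rw [← Finset.card_range j]
    refine Finset.card_le_card fun i hi => ?_
    obtain ⟨h1, h2⟩ := Finset.mem_filter.1 hi
    rw [Finset.mem_range] at h1 ⊢
    by_contra hji
    have hjN : j < N := by omega
    refine hn ⟨hjN, ?_⟩
    rcases (not_lt.1 hji).eq_or_lt with rfl | h3
    · exact h2
    · exact (hρ j i h3 h1).le.trans h2
  · rintro ⟨h1, h2⟩
    rw [Nat.lt_iff_add_one_le, ← Finset.card_range (j + 1)]
    refine Finset.card_le_card fun i hi => ?_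
    rw [Finset.mem_range] at hi
    refine Finset.mem_filter.2 ⟨Finset.mem_range.2 (by omega), ?_⟩
    rcases (Nat.lt_succ_iff.1 hi).eq_or_lt with rfl | h3
    · exact h2
    · exact (hρ i j h3 h1).le.trans h2

theorem le_card_add_countLE {k : ℕ} {r : Fin k → Fin n} (hr : Function.Injective r)
    {E : Finset (Fin n)} {ρ : ℕ → Fin n} {N : ℕ} {x : Fin n} (hx : ∀ a, r a ≤ x)
    (h : ∀ a, r a ∈ E ∨ ∃ j < N, r a = ρ j) : k ≤ E.card + countLE ρ N x := by
  classical
  have h1 : Finset.univ.image r ⊆ E ∪ ((Finset.range N).filter fun j => ρ j ≤ x).image ρ := by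
    intro z hz
    obtain ⟨a, -, rfl⟩ := Finset.mem_image.1 hz
    rw [Finset.mem_union, Finset.mem_image]
    refine (h a).imp id ?_
    rintro ⟨j, hj, hja⟩
    exact ⟨j, Finset.mem_filter.2 ⟨Finset.mem_range.2 hj, hja ▸ hx a⟩, hja.symm⟩
  have h2 := (Finset.card_le_card h1).trans (Finset.card_union_le _ _)
  rw [Finset.card_image_of_injective _ hr, Finset.card_univ, Fintype.card_fin] at h2
  exact h2.trans (Nat.add_le_add_left Finset.card_image_le _)

/-- A leading transversal dividing a monomial of the combination can be inverted only around `(i₁, w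
i₂)`. So using row `i₁` forbids column `w i₁`, and using column `w i₂` forbids row `i₂`. The numeric
hypotheses treat the resulting cases: `h₂` when only row `i₁` is used, `h₃` when only column `w i₂`
is used, `h₁` when both or neither are, with one exceptional size settled by a missing variable. -/
theorem not_hasReducibleMonomials_of_two_minors (hm : IsDiagonalTwo m) {i₁ i₂ : Fin n}
    {ρ κ : ℕ → Fin n} {N p q l : ℕ} (hpN : p ≤ N) (hqN : l + q + 1 ≤ N) (hqp : q ≤ p + 1)
    (hρ : ∀ j j', j < j' → j' < N → ρ j < ρ j') (hκ : ∀ j j', j < j' → j' < p + 1 → κ j < κ j')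
    (hi : i₁ < i₂) (hw : w i₂ < w i₁) (hiρ : ∀ j < N, i₂ < ρ j) (hiκ : ∀ j < p + 1, w i₁ < κ j)
    (h1S : i₁ ∈ S) (h2S : i₂ ∈ S) (hSρ : ∀ j < N, ρ j ∈ S) (hSκ : ∀ j < p + 1, w.symm (κ j) ∈ S)
    (hz : (i₁, w i₂) ∈ zeroSet w S) {xA yA xB yB : Fin n}
    (hAi : i₂ ≤ xA) (hAρ : ∀ j < p, ρ j ≤ xA) (hAκ : ∀ j < p + 1, κ j ≤ yA)
    (hA : rkOn w S xA yA < p + 2)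
    (hBρ : ∀ j < q + 1, ρ (l + j) ≤ xB) (hBi : w i₁ ≤ yB) (hBκ : ∀ j < q, κ j ≤ yB)
    (hB : rkOn w S xB yB < q + 2)
    (h₁ : ∀ x y k, i₂ ≤ x → w i₁ ≤ y → rkOn w S x y < k → k ≤ 1 + countLE ρ N x →
      k ≤ 1 + countLE κ (p + 1) y → p < N ∧ q ≤ p ∧ 3 ≤ k ∧ k = N + 1 ∧ k = p + 2)
    (h₂ : ∀ x y k, i₂ ≤ x → w i₁ ≤ y → rkOn w S x y < k → k ≤ countLE κ (p + 1) y →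
      k ≤ 2 + countLE ρ N x → False)
    (h₃ : ∀ x y k, i₂ ≤ x → w i₁ ≤ y → rkOn w S x y < k → k ≤ countLE ρ N x → k + l ≤ N →
      k ≤ 2 + countLE κ (p + 1) y → False) :
    ¬ HasReducibleMonomials m w S := by
  classical
  intro hP
  obtain ⟨ra, hra⟩ : ∃ ra : Fin (p + 2) → Fin n,
    ra = Fin.cons i₁ (Fin.cons i₂ fun j : Fin p => ρ j) := ⟨_, rfl⟩
  obtain ⟨ca, hca⟩ : ∃ ca : Fin (p + 2) → Fin n,
    ca = Fin.cons (w i₁) fun j : Fin (p + 1) => κ j := ⟨_, rfl⟩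
  obtain ⟨rb, hrb⟩ : ∃ rb : Fin (q + 2) → Fin n,
    rb = Fin.cons i₁ fun j : Fin (q + 1) => ρ (l + j) := ⟨_, rfl⟩
  obtain ⟨cb, hcb⟩ : ∃ cb : Fin (q + 2) → Fin n,
    cb = Fin.cons (w i₁) (Fin.cons (w i₂) fun j : Fin q => κ j) := ⟨_, rfl⟩
  have hra' : ∀ a, ra a = i₁ ∨ ra a = i₂ ∨ ∃ j < p, ra a = ρ j := by
    rw [hra]
    refine Fin.cases (Or.inl rfl) fun a => Or.inr ?_
    exact Fin.cases (Or.inl rfl) (fun j => Or.inr ⟨j, j.2, rfl⟩) a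
  have hca' : ∀ a, ca a = w i₁ ∨ ∃ j < p + 1, ca a = κ j := by
    rw [hca]
    exact Fin.cases (Or.inl rfl) fun j => Or.inr ⟨j, j.2, rfl⟩
  have hrb' : ∀ a, rb a = i₁ ∨ ∃ j < q + 1, rb a = ρ (l + j) := by
    rw [hrb]
    exact Fin.cases (Or.inl rfl) fun j => Or.inr ⟨j, j.2, rfl⟩
  have hcb' : ∀ a, cb a = w i₁ ∨ cb a = w i₂ ∨ ∃ j < q, cb a = κ j := by
    rw [hcb]
    refine Fin.cases (Or.inl rfl) fun a => Or.inr ?_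
    exact Fin.cases (Or.inl rfl) (fun j => Or.inr ⟨j, j.2, rfl⟩) a
  have hAbig : IsBig w S ra ca := by
    refine ⟨fun a => ?_, fun a => ?_, xA, yA, fun a => ?_, fun a => ?_, hA⟩
    · rcases hra' a with h | h | ⟨j, hj, h⟩ <;> rw [h]
      exacts [h1S, h2S, hSρ j (by omega)]
    · rcases hca' a with h | ⟨j, hj, h⟩ <;> rw [h]
      exacts [by simpa using h1S, hSκ j hj]
    · rcases hra' a with h | h | ⟨j, hj, h⟩ <;> rw [h]
      exacts [hi.le.trans hAi, hAi, hAρ j hj]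
    · rcases hca' a with h | ⟨j, hj, h⟩ <;> rw [h]
      exacts [(hiκ 0 (by omega)).le.trans (hAκ 0 (by omega)), hAκ j hj]
  have hBbig : IsBig w S rb cb := by
    refine ⟨fun a => ?_, fun a => ?_, xB, yB, fun a => ?_, fun a => ?_, hB⟩
    · rcases hrb' a with h | ⟨j, hj, h⟩ <;> rw [h]
      exacts [h1S, hSρ _ (by omega)]
    · rcases hcb' a with h | h | ⟨j, hj, h⟩ <;> rw [h]
      exacts [by simpa using h1S, by simpa using h2S, hSκ j (by omega)]
    · rcases hrb' a with h | ⟨j, hj, h⟩ <;> rw [h]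
      exacts [hi.le.trans ((hiρ _ (by omega)).le.trans (hBρ 0 (by omega))), hBρ j hj]
    · rcases hcb' a with h | h | ⟨j, hj, h⟩ <;> rw [h]
      exacts [hBi, hw.le.trans hBi, hBκ j hj]
  have hρi : ∀ j < N, ∀ j' < N, ρ j = ρ j' → j = j' := fun j hj j' hj' h => by
    rcases lt_trichotomy j j' with h' | h' | h'
    · exact absurd h (hρ _ _ h' hj').ne
    · exact h'
    · exact absurd h (hρ _ _ h' hj).ne'
  have hκi : ∀ j < p + 1, ∀ j' < p + 1, κ j = κ j' → j = j' := fun j hj j' hj' h => by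
    rcases lt_trichotomy j j' with h' | h' | h'
    · exact absurd h (hκ _ _ h' hj').ne
    · exact h'
    · exact absurd h (hκ _ _ h' hj).ne'
  obtain ⟨f, hf, hf0, hfs⟩ := exists_combination_of_minors (w := w) (S := S) hpN hqN hqp hρi
    (fun j hj j' hj' => hκi j (by omega) j' (by omega)) hi.ne (fun j hj => (hi.trans (hiρ j hj)).ne')
    (fun j hj => (hiρ j hj).ne') (fun j hj => (hiκ j (by omega)).ne')
    (fun j hj => (hw.trans (hiκ j (by omega))).ne') hra hca hrb hcb hAbig hBbig hz
  obtain ⟨d, hd, hred⟩ := hP f hf (supported_mono (by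
    rintro v ⟨⟨a, b, rfl⟩ | ⟨a, b, rfl⟩, -⟩
    exacts [hAbig.mem_grid a b, hBbig.mem_grid a b]) hfs) hf0
  have hdV := mem_supported_iff_support.1 hfs d hd
  have hsh : ∀ x y, d (x, y) ≠ 0 → (x = i₁ ∧ ∃ j < p + 1, y = κ j) ∨
      (x = i₂ ∧ (y = w i₁ ∨ ∃ j < p + 1, y = κ j)) ∨
      ∃ j < N, x = ρ j ∧ (y = w i₁ ∨ (y = w i₂ ∧ l ≤ j) ∨ ∃ j < p + 1, y = κ j) := by
    intro x y hxy
    obtain ⟨⟨a, b, hab⟩ | ⟨a, b, hab⟩, hne₁, hne₂⟩ := hdV _ hxy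
    · obtain ⟨rfl, rfl⟩ := Prod.mk.inj hab
      rcases hra' a with h | h | ⟨j, hj, h⟩ <;> rcases hca' b with h' | ⟨j', hj', h'⟩ <;>
        rw [h, h']
      · exact absurd (Prod.ext h h') hne₁
      · exact Or.inl ⟨rfl, j', hj', rfl⟩
      · exact Or.inr (Or.inl ⟨rfl, Or.inl rfl⟩)
      · exact Or.inr (Or.inl ⟨rfl, Or.inr ⟨j', hj', rfl⟩⟩)
      · exact Or.inr (Or.inr ⟨j, by omega, rfl, Or.inl rfl⟩)
      · exact Or.inr (Or.inr ⟨j, by omega, rfl, Or.inr (Or.inr ⟨j', hj', rfl⟩)⟩)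
    · obtain ⟨rfl, rfl⟩ := Prod.mk.inj hab
      rcases hrb' a with h | ⟨j, hj, h⟩ <;> rcases hcb' b with h' | h' | ⟨j', hj', h'⟩ <;>
        rw [h, h']
      · exact absurd (Prod.ext h h') hne₁
      · exact absurd (Prod.ext h h') hne₂
      · exact Or.inl ⟨rfl, j', by omega, rfl⟩
      · exact Or.inr (Or.inr ⟨l + j, by omega, rfl, Or.inl rfl⟩)
      · exact Or.inr (Or.inr ⟨l + j, by omega, rfl, Or.inr (Or.inl ⟨rfl, by omega⟩)⟩)
      · exact Or.inr (Or.inr ⟨l + j, by omega, rfl, Or.inr (Or.inr ⟨j', by omega, rfl⟩)⟩)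
  -- The first minor stops before row `ρ (N - 1)` and the second before column `κ p`, so neither
  -- involves this variable.
  have hlast : p < N → q ≤ p → d (ρ (N - 1), κ p) = 0 := by
    intro h1 h2
    by_contra h3
    have h4 := hiρ (N - 1) (by omega)
    have h5 := hiκ p (by omega)
    obtain ⟨⟨a, b, hab⟩ | ⟨a, b, hab⟩, -⟩ := hdV _ h3 <;> obtain ⟨ha, hb⟩ := Prod.mk.inj hab
    · rcases hra' a with h | h | ⟨j, hj, h⟩ <;> rw [h] at ha
      · order
      · order
      · have := hρi _ (by omega) _ (by omega) ha
        omega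
    · rcases hcb' b with h | h | ⟨j, hj, h⟩ <;> rw [h] at hb
      · order
      · order
      · have := hκi _ (by omega) _ (by omega) hb
        omega
  have hz₁ : ∀ x y, i₁ ≤ x → w i₁ ≤ y → (x, y) ∉ zeroSet w S := fun x y h1 h2 h =>
    h i₁ h1S h1 h2
  have hz₂ : ∀ x y, i₂ ≤ x → w i₂ ≤ y → (x, y) ∉ zeroSet w S := fun x y h1 h2 h =>
    h i₂ h2S h1 h2
  rcases hred with ⟨⟨x, y⟩, hvz, hdv⟩ | ⟨k, r, c, hbig, hlead, hdrc⟩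
  · rcases hsh x y hdv with ⟨rfl, j, hj, rfl⟩ | ⟨rfl, rfl | ⟨j, hj, rfl⟩⟩ |
      ⟨j, hj, rfl, rfl | ⟨rfl, -⟩ | ⟨j', hj', rfl⟩⟩
    · exact hz₁ _ _ le_rfl (hiκ _ hj).le hvz
    · exact hz₂ _ _ le_rfl hw.le hvz
    · exact hz₂ _ _ le_rfl (hw.trans (hiκ _ hj)).le hvz
    · exact hz₂ _ _ (hiρ _ hj).le hw.le hvz
    · exact hz₂ _ _ (hiρ _ hj).le le_rfl hvz
    · exact hz₂ _ _ (hiρ _ hj).le (hw.trans (hiκ _ hj')).le hvz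
  have hrow : ∀ a, r a = i₁ ∨ r a = i₂ ∨ ∃ j < N, r a = ρ j := fun a => by
    rcases hsh _ _ (hdrc a) with ⟨h, -⟩ | ⟨h, -⟩ | ⟨j, hj, h, -⟩
    exacts [Or.inl h, Or.inr (Or.inl h), Or.inr (Or.inr ⟨j, hj, h⟩)]
  have hcol : ∀ a, c a = w i₂ ∨ c a = w i₁ ∨ ∃ j < p + 1, c a = κ j := fun a => by
    rcases hsh _ _ (hdrc a) with ⟨-, h⟩ | ⟨-, h⟩ | ⟨j, hj, -, h | ⟨h, -⟩ | h⟩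
    exacts [Or.inr (Or.inr h), Or.inr h, Or.inr (Or.inl h), Or.inl h, Or.inr (Or.inr h)]
  have hrow₂ : ∀ a, r a ≠ i₁ → i₂ ≤ r a := fun a h => by
    rcases (hrow a).resolve_left h with h | ⟨j, hj, h⟩ <;> rw [h]
    exact (hiρ j hj).le
  have hcol₁ : ∀ a, c a ≠ w i₂ → w i₁ ≤ c a := fun a h => by
    rcases (hcol a).resolve_left h with h | ⟨j, hj, h⟩ <;> rw [h]
    exact (hiκ j hj).le
  have hrow₁ : ∀ a, i₁ ≤ r a := fun a => by
    by_cases h : r a = i₁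
    · exact h.ge
    · exact hi.le.trans (hrow₂ a h)
  have hcol₂ : ∀ a, w i₂ ≤ c a := fun a => by
    by_cases h : c a = w i₂
    · exact h.ge
    · exact hw.le.trans (hcol₁ a h)
  have hinv : ∀ a b, r a < r b → c b < c a → r a = i₁ ∧ c b = w i₂ := fun a b h1 h2 => by
    have h3 := hlead.mem_of_inversion hm (isLowerSet_zeroSet w S) h1 h2
    exact ⟨by_contra fun h => hz₂ _ _ (hrow₂ a h) (hcol₂ b) h3,
      by_contra fun h => hz₁ _ _ (hrow₁ a) (hcol₁ b h) h3⟩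
  obtain ⟨x, y, hx, hy, hxy⟩ := hbig.exists_rkOn_lt
  have hk : 0 < k := by omega
  have hr₁ : ∀ a, r a = i₁ → ∃ j < p + 1, c a = κ j := fun a h => by
    rcases hsh _ _ (hdrc a) with ⟨-, h'⟩ | ⟨h', -⟩ | ⟨j, hj, h', -⟩
    · exact h'
    · order
    · have := hiρ j hj
      order
  have hc₂ : ∀ a, c a = w i₂ → ∃ j < N, l ≤ j ∧ r a = ρ j := fun a h => by
    rcases hsh _ _ (hdrc a) with ⟨-, j, hj, h'⟩ | ⟨-, h' | ⟨j, hj, h'⟩⟩ |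
      ⟨j, hj, h', h'' | ⟨h'', h3⟩ | ⟨j', hj', h''⟩⟩
    · have := hiκ j hj
      order
    · order
    · have := hiκ j hj
      order
    · order
    · exact ⟨j, hj, h3, h'⟩
    · have := hiκ j' hj'
      order
  have hc₁ : ∀ a, r a = i₁ → ∀ b, c b ≠ w i₁ := fun a ha b hb => by
    obtain ⟨j, hj, hj'⟩ := hr₁ a ha
    have h1 := hiκ j hj
    have h2 : r b ≠ i₁ := fun h => by
      rw [← hlead.inj_row (ha.trans h.symm)] at hb
      order
    have := (hinv a b (by have := hrow₂ b h2; order) (by order)).2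
    order
  have hr₂ : ∀ a, c a = w i₂ → ∀ b, r b ≠ i₂ := fun a ha b hb => by
    obtain ⟨j, hj, -, hj'⟩ := hc₂ a ha
    have h1 := hiρ j hj
    have h2 : c b ≠ w i₂ := fun h => by
      rw [← hlead.inj_col (ha.trans h.symm)] at hb
      order
    have := (hinv b a (by order) (by have := hcol₁ b h2; order)).1
    order
  -- Covers both cases with a single row besides the `ρ` and a single column besides the `κ`: `i₁`
  -- and `w i₂`, or `i₂` and `w i₁`. In the exceptional size, the last row and the last column must
  -- both occur.
  have hfull : ∀ z z', z ≤ i₂ → z' ≤ w i₁ →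
      (∀ a, r a ∈ ({z} : Finset (Fin n)) ∨ ∃ j < N, r a = ρ j) →
      (∀ a, c a ∈ ({z'} : Finset (Fin n)) ∨ ∃ j < p + 1, c a = κ j) → i₂ ≤ x → w i₁ ≤ y →
      False := by
    intro z z' hz' hz'' h1 h2 h3 h4
    obtain ⟨h5, h6, h7, h8, h9⟩ := h₁ x y k h3 h4 hxy
      (le_card_add_countLE hlead.inj_row hx h1) (le_card_add_countLE hlead.inj_col hy h2)
    obtain ⟨a, ha⟩ : ∃ a, r a = ρ (N - 1) := by
      by_contra! h
      have := le_card_add_countLE (N := N - 1) hlead.inj_row hx fun a => (h1 a).imp id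
        fun ⟨j, hj, hj'⟩ => ⟨j, by
          have : j ≠ N - 1 := fun hj'' => h a (hj'' ▸ hj')
          omega, hj'⟩
      have := countLE_le ρ (N - 1) x
      simp only [Finset.card_singleton] at *
      omega
    obtain ⟨b, hb⟩ : ∃ b, c b = κ p := by
      by_contra! h
      have := le_card_add_countLE (N := p) hlead.inj_col hy fun a => (h2 a).imp id
        fun ⟨j, hj, hj'⟩ => ⟨j, by
          have : j ≠ p := fun hj'' => h a (hj'' ▸ hj')
          omega, hj'⟩
      have := countLE_le κ p y
      simp only [Finset.card_singleton] at *
      omega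
    have hamax : ∀ e, e ≠ a → r e < r a := fun e he => by
      refine lt_of_le_of_ne ?_ fun h => he (hlead.inj_row h)
      rw [ha]
      rcases h1 e with h | ⟨j, hj, h⟩
      · rw [Finset.mem_singleton.1 h]
        exact hz'.trans (hiρ _ (by omega)).le
      · rw [h]
        rcases (show j ≤ N - 1 by omega).eq_or_lt with rfl | h'
        · exact le_rfl
        · exact (hρ _ _ h' (by omega)).le
    have hbmax : ∀ e, e ≠ b → c e < c b := fun e he => by
      refine lt_of_le_of_ne ?_ fun h => he (hlead.inj_col h)
      rw [hb]
      rcases h2 e with h | ⟨j, hj, h⟩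
      · rw [Finset.mem_singleton.1 h]
        exact hz''.trans (hiκ _ (by omega)).le
      · rw [h]
        rcases (show j ≤ p by omega).eq_or_lt with rfl | h'
        · exact le_rfl
        · exact (hκ _ _ h' (by omega)).le
    by_cases hab : a = b
    · subst hab
      refine hdrc a ?_
      rw [ha, hb]
      exact hlast h5 h6
    -- The last row and the last column lie on different entries, which form an inversion. A third
    -- entry exists as `3 ≤ k`; it is inverted with `a` too, hence also lies in row `i₁`, which is
    -- impossible.
    · obtain ⟨h10, h11⟩ := hinv b a (hamax b (Ne.symm hab)) (hbmax a hab)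
      obtain ⟨e, he⟩ : ∃ e, e ∉ ({a, b} : Finset (Fin k)) := by
        by_contra! h
        have := Finset.card_le_card (fun e _ => h e : Finset.univ ⊆ ({a, b} : Finset (Fin k)))
        have := this.trans Finset.card_le_two
        rw [Finset.card_univ, Fintype.card_fin] at this
        omega
      rw [Finset.mem_insert, Finset.mem_singleton, not_or] at he
      have h12 : c a < c e := by
        rw [h11]
        exact lt_of_le_of_ne (hcol₂ e) fun h => he.1 (hlead.inj_col (h11.trans h)).symm
      exact he.2 (hlead.inj_row ((hinv e a (hamax e he.1) h12).1.trans h10.symm))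
  by_cases hr : ∃ a, r a = i₁ <;> by_cases hc : ∃ a, c a = w i₂
  · obtain ⟨a, ha⟩ := hr
    obtain ⟨b, hb⟩ := hc
    refine hfull i₁ (w i₂) hi.le hw.le
      (fun e => (hrow e).imp Finset.mem_singleton.2 fun h => h.resolve_left (hr₂ b hb e))
      (fun e => (hcol e).imp Finset.mem_singleton.2 fun h => h.resolve_left (hc₁ a ha e)) ?_ ?_
    · obtain ⟨j, hj, -, h⟩ := hc₂ b hb
      exact (hiρ j hj).le.trans (h ▸ hx b)
    · obtain ⟨j, hj, h⟩ := hr₁ a ha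
      exact (hiκ j hj).le.trans (h ▸ hy a)
  · obtain ⟨a, ha⟩ := hr
    push Not at hc
    have h1 := le_card_add_countLE (E := ∅) hlead.inj_col hy fun e =>
      Or.inr (((hcol e).resolve_left (hc e)).resolve_left (hc₁ a ha e))
    have h2 : i₂ ≤ x := by
      have h3 : 0 < rkOn w S x y := Finset.card_pos.2 ⟨i₁, Finset.mem_filter.2
        ⟨h1S, ha ▸ hx a, (hcol₁ a (hc a)).trans (hy a)⟩⟩
      have := Fin.nontrivial_iff_two_le.2 (show 2 ≤ k by omega)
      obtain ⟨e, he⟩ := exists_ne a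
      exact (hrow₂ e fun h => he (hlead.inj_row (h.trans ha.symm))).trans (hx e)
    refine h₂ x y k h2 ((hcol₁ a (hc a)).trans (hy a)) hxy (by simpa using h1) ?_
    have h3 := le_card_add_countLE (E := {i₁, i₂}) hlead.inj_row hx fun e =>
      (or_assoc.2 (hrow e)).imp (by simp) id
    exact h3.trans (Nat.add_le_add_right Finset.card_le_two _)
  · obtain ⟨a, ha⟩ := hc
    push Not at hr
    have h1 := le_card_add_countLE (E := ∅) hlead.inj_row hx fun e =>
      Or.inr (((hrow e).resolve_left (hr e)).resolve_left (hr₂ a ha e))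
    have h2 : w i₁ ≤ y := by
      have h3 : 0 < rkOn w S x y := Finset.card_pos.2 ⟨i₂, Finset.mem_filter.2
        ⟨h2S, (hrow₂ a (hr a)).trans (hx a), ha ▸ hy a⟩⟩
      have := Fin.nontrivial_iff_two_le.2 (show 2 ≤ k by omega)
      obtain ⟨e, he⟩ := exists_ne a
      exact (hcol₁ e fun h => he (hlead.inj_col (h.trans ha.symm))).trans (hy e)
    refine h₃ x y k ((hrow₂ a (hr a)).trans (hx a)) h2 hxy (by simpa using h1) ?_ ?_
    · obtain ⟨j, hj, hlj, hja⟩ := hc₂ a ha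
      -- Only the second minor has column `w i₂`, so the entry there is in a row `ρ j` with `l ≤ j`.
      -- A higher row would create an inversion outside row `i₁`; hence all rows have index at least
      -- `l`.
      have h3 := le_card_add_countLE (E := ∅) (ρ := fun j => ρ (l + j)) (N := N - l)
        hlead.inj_row hx fun e => Or.inr <| by
          obtain ⟨j', hj', h4⟩ := ((hrow e).resolve_left (hr e)).resolve_left (hr₂ a ha e)
          have h5 : j ≤ j' := by
            by_contra! h
            have h6 := hρ _ _ h hj
            rw [← h4, ← hja] at h6
            refine hr e (hinv e a h6 (ha ▸ lt_of_le_of_ne (hcol₂ e) fun h7 => ?_)).1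
            rw [hlead.inj_col (ha.trans h7)] at h6
            exact lt_irrefl _ h6
          refine ⟨j' - l, by omega, ?_⟩
          rw [h4, Nat.add_sub_of_le (hlj.trans h5)]
      have h4 := countLE_le (fun j => ρ (l + j)) (N - l) x
      rw [Finset.card_empty] at h3
      omega
    · have h3 := le_card_add_countLE (E := {w i₂, w i₁}) hlead.inj_col hy fun e =>
        (or_assoc.2 (hcol e)).imp (by simp) id
      exact h3.trans (Nat.add_le_add_right Finset.card_le_two _)
  · push Not at hr hc
    exact hfull i₂ (w i₁) le_rfl le_rfl
      (fun e => ((hrow e).resolve_left (hr e)).imp Finset.mem_singleton.2 id)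
      (fun e => ((hcol e).resolve_left (hc e)).imp Finset.mem_singleton.2 id)
      ((hrow₂ ⟨0, hk⟩ (hr _)).trans (hx _)) ((hcol₁ ⟨0, hk⟩ (hc _)).trans (hy _))

end MatrixSchubert

/-! ### The pattern 214635 -/

namespace MatrixSchubert

variable {n : ℕ} {m : MonomialOrder (Fin n × Fin n)} {w : Equiv.Perm (Fin n)}
  {S : Finset (Fin n)}

theorem exists_enumeration (Q : Finset (Fin n)) (z : Fin n) : ∃ e : ℕ → Fin n,
    (∀ j j', j < j' → j' < Q.card → e j < e j') ∧ (∀ j < Q.card, e j ∈ Q) ∧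
      ∀ k ∈ Q, ∃ j < Q.card, k = e j := by
  refine ⟨fun j => if h : j < Q.card then Q.orderEmbOfFin rfl ⟨j, h⟩ else z, ?_, ?_, ?_⟩
  · intro j j' h h'
    simp only [h', h.trans h', dif_pos]
    exact (Q.orderEmbOfFin rfl).strictMono h
  · intro j h
    simp only [h, dif_pos]
    exact Q.orderEmbOfFin_mem rfl _
  · intro k hk
    rw [← Finset.mem_coe, ← Finset.range_orderEmbOfFin Q rfl] at hk
    obtain ⟨j, rfl⟩ := hk
    exact ⟨j, j.2, by simp [j.2]⟩

theorem countLE_le_of_not {ρ : ℕ → Fin n} {N : ℕ} (hρ : ∀ j j', j < j' → j' < N → ρ j < ρ j')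
    {x : Fin n} {j : ℕ} (h : j < N → ¬ ρ j ≤ x) : countLE ρ N x ≤ j :=
  not_lt.1 fun h' => h ((lt_countLE_iff hρ).1 h').1 ((lt_countLE_iff hρ).1 h').2

/-- The entries of rows `i₁` and `i₂` and an initial piece of the increasing chain lie in the
region; this lower bound feeds the counting criterion. -/
theorem two_add_min_le_rkOn {i₁ i₂ : Fin n} {e : ℕ → Fin n} {M : ℕ} (hi : i₁ < i₂)
    (hw : w i₂ < w i₁) (h1 : i₁ ∈ S) (h2 : i₂ ∈ S) (heS : ∀ j < M, e j ∈ S)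
    (hie : ∀ j < M, i₂ < e j) (he : ∀ j j', j < j' → j' < M → e j < e j')
    (hwe : ∀ j j', j < j' → j' < M → w (e j) < w (e j')) {x y : Fin n} (hx : i₂ ≤ x)
    (hy : w i₁ ≤ y) :
    2 + min (countLE e M x) (countLE (fun j => w (e j)) M y) ≤ rkOn w S x y := by
  set μ := min (countLE e M x) (countLE (fun j => w (e j)) M y)
  have hμ : ∀ j < μ, j < M ∧ e j ≤ x ∧ w (e j) ≤ y := fun j hj => by
    have h3 := (lt_countLE_iff he).1 (hj.trans_le (min_le_left _ _))
    exact ⟨h3.1, h3.2, ((lt_countLE_iff hwe).1 (hj.trans_le (min_le_right _ _))).2⟩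
  have hinj : Set.InjOn e (Finset.range μ) := fun j hj j' hj' h => by
    rw [Finset.coe_range, Set.mem_Iio] at hj hj'
    rcases lt_trichotomy j j' with h' | h' | h'
    · exact absurd h (he _ _ h' (hμ _ hj').1).ne
    · exact h'
    · exact absurd h (he _ _ h' (hμ _ hj).1).ne'
  have hni : ∀ z ≤ i₂, z ∉ (Finset.range μ).image e := fun z hz h => by
    obtain ⟨j, hj, rfl⟩ := Finset.mem_image.1 h
    exact absurd (hie j (hμ j (Finset.mem_range.1 hj)).1) (not_lt.2 hz)
  have hcard : (insert i₁ (insert i₂ ((Finset.range μ).image e))).card = 2 + μ := by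
    rw [Finset.card_insert_of_notMem, Finset.card_insert_of_notMem (hni _ le_rfl),
      Finset.card_image_of_injOn hinj, Finset.card_range]
    · ring
    · rw [Finset.mem_insert, not_or]
      exact ⟨hi.ne, hni _ hi.le⟩
  rw [← hcard]
  refine Finset.card_le_card fun k hk => ?_
  rw [Finset.mem_filter]
  rcases Finset.mem_insert.1 hk with rfl | hk
  · exact ⟨h1, hi.le.trans hx, hy⟩
  rcases Finset.mem_insert.1 hk with rfl | hk
  · exact ⟨h2, hx, hw.le.trans hy⟩
  obtain ⟨j, hj, rfl⟩ := Finset.mem_image.1 hk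
  have h3 := hμ j (Finset.mem_range.1 hj)
  exact ⟨heS j h3.1, h3.2⟩

theorem rkOn_lt_of_forall {i₁ i₂ : Fin n} {e : ℕ → Fin n} {M : ℕ} {x y : Fin n}
    (h : ∀ k ∈ S, k ≤ x → w k ≤ y → k = i₁ ∨ k = i₂ ∨ ∃ j < M, k = e j) :
    rkOn w S x y < M + 3 := by
  have h1 : (S.filter fun k => k ≤ x ∧ w k ≤ y) ⊆
      insert i₁ (insert i₂ ((Finset.range M).image e)) := fun k hk => by
    obtain ⟨h1, h2, h3⟩ := Finset.mem_filter.1 hk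
    rw [Finset.mem_insert, Finset.mem_insert, Finset.mem_image]
    refine (h k h1 h2 h3).imp id (Or.imp id ?_)
    rintro ⟨j, hj, rfl⟩
    exact ⟨j, Finset.mem_range.2 hj, rfl⟩
  have h2 := Finset.card_le_card h1
  have h3 := Finset.card_insert_le i₁ (insert i₂ ((Finset.range M).image e))
  have h4 := Finset.card_insert_le i₂ ((Finset.range M).image e)
  have h5 := Finset.card_image_le (s := Finset.range M) (f := e)
  rw [Finset.card_range] at h5
  rw [rkOn]
  omega

/-- The two minors belong to the corners `(a, w t)` and `(a, w u)`. Excluding 13254 makes the middle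
entries `Q` an increasing chain; the choice of `i₁`, `i₂` and the exclusion of 241635 leave only
`i₁`, `i₂` and `Q` in the first rectangle. -/
theorem not_hasReducibleMonomials_214635 (hm : IsDiagonalTwo m) {i₁ i₂ P a u t : Fin n}
    (h12 : i₁ < i₂) (h2P : i₂ < P) (hPa : P < a) (hau : a < u) (hat : a < t) (w21 : w i₂ < w i₁)
    (w1u : w i₁ < w u) (wuP : w u < w P) (wPt : w P < w t) (wta : w t < w a) :
    ¬ HasReducibleMonomials m w Finset.univ := by
  intro hU
  -- Maximizing the sum of the rows makes it impossible to lower either row of the inversion while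
  -- keeping the other.
  obtain ⟨⟨i₁, i₂⟩, hi₁₂, hmax⟩ := (Finset.univ.filter fun v : Fin n × Fin n => v.1 < v.2 ∧
    v.2 < P ∧ w v.2 < w v.1 ∧ w v.1 < w u).exists_max_image (fun v => (v.1 : ℕ) + v.2)
      ⟨(i₁, i₂), by simp [*]⟩
  clear h12 h2P w21 w1u
  simp only [Finset.mem_filter, Finset.mem_univ, true_and, Prod.forall] at hi₁₂ hmax
  obtain ⟨h12, h2P, w21, w1u⟩ := hi₁₂
  set S := upperRows w {i₁, i₂} with hSdef
  have hS : ∀ k, k ∈ S ↔ (i₁ ≤ k ∧ w i₁ ≤ w k) ∨ (i₂ ≤ k ∧ w i₂ ≤ w k) :=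
    fun k => by simp [hSdef, mem_upperRows]
  set Q := Finset.univ.filter fun k => i₂ < k ∧ k < a ∧ w i₁ < w k ∧ w k < w t with hQdef
  have hQ : ∀ k, k ∈ Q ↔ i₂ < k ∧ k < a ∧ w i₁ < w k ∧ w k < w t := fun k => by simp [hQdef]
  obtain ⟨e, he, heQ, hes⟩ := exists_enumeration Q i₁
  set M := Q.card
  have hwe : ∀ j j', j < j' → j' < M → w (e j) < w (e j') := fun j j' h h' => by
    by_contra h1
    have h2 := he j j' h h'
    have h3 : w (e j') < w (e j) := lt_of_le_of_ne (not_lt.1 h1) fun h4 =>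
      h2.ne' (w.injective h4)
    obtain ⟨h4, h5, h6, h7⟩ := (hQ _).1 (heQ j (h.trans h'))
    obtain ⟨h4', h5', h6', h7'⟩ := (hQ _).1 (heQ j' h')
    exact not_hasReducibleMonomials_13254 hm (i₁ := i₁) (h12.trans h4) h2 h5' hat h6' h3 h7 wta hU
  have hNW : ∀ k ∈ S, k ≤ a → w k ≤ w t → k = i₁ ∨ k = i₂ ∨ k ∈ Q := by
    intro k hk hka hkt
    have hkt' : w k < w t := lt_of_le_of_ne hkt fun h => by
      rw [w.injective h] at hka; order
    have hka' : k < a := lt_of_le_of_ne hka fun h => by rw [h] at hkt; order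
    have hku : w k ≠ w u := fun h => by rw [w.injective h] at hka; order
    have hk2 : ∀ z, z ≠ k → w z ≠ w k := fun z hz h => hz (w.injective h)
    by_cases hk1 : i₁ ≤ k ∧ w i₁ ≤ w k
    · by_cases hki : i₁ = k
      · exact Or.inl hki.symm
      have h1 := hk2 _ hki
      rcases lt_trichotomy k i₂ with h | h | h
      · exfalso
        rcases lt_or_gt_of_ne hku with h3 | h3
        · have := hmax k i₂ ⟨h, h2P, by order, h3⟩
          have : i₁ < k := by order
          rw [Fin.lt_def] at this
          omega
        · exact not_hasReducibleMonomials_241635 hm (i₁ := i₁) (i₂ := k) (i₃ := i₂) (a := a)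
            (u := u) (t := t) (by order) h (by order) hau hat w21 w1u h3 hkt' wta hU
      · exact Or.inr (Or.inl h)
      · exact Or.inr (Or.inr ((hQ _).2 ⟨h, hka', by order, hkt'⟩))
    · obtain ⟨h1, h2⟩ := ((hS k).1 hk).resolve_left hk1
      by_cases hki : i₂ = k
      · exact Or.inr (Or.inl hki.symm)
      have h3 := hk2 _ hki
      have h4 : w k < w i₁ := not_le.1 fun h => hk1 ⟨by order, h⟩
      exfalso
      rcases lt_trichotomy k P with h | h | h
      · have := hmax i₁ k ⟨by order, h, h4, w1u⟩
        have : i₂ < k := by order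
        rw [Fin.lt_def] at this
        omega
      · rw [h] at h4; order
      · exact not_hasReducibleMonomials_241635 hm (i₁ := i₁) (i₂ := P) (i₃ := k) (a := a)
            (u := u) (t := t) (by order) h (by order) hau hat h4 w1u wuP wPt wta hU
  -- The number of chain entries left of column `w u`. It is less than `M`, because the entry of row
  -- `P` belongs to the chain and lies to the right.
  obtain ⟨t₀, ht₀⟩ : ∃ t₀, t₀ = countLE (fun j => w (e j)) M (w u) := ⟨_, rfl⟩
  have ht₀' : ∀ j, j < t₀ ↔ j < M ∧ w (e j) ≤ w u := fun j => by rw [ht₀, lt_countLE_iff hwe]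
  have hueq : ∀ j < M, w (e j) ≠ w u := fun j hj h => by
    have := ((hQ _).1 (heQ j hj)).2.1
    rw [w.injective h] at this
    order
  have ht₀M : t₀ < M := by
    obtain ⟨j, hj, hPj⟩ := hes P ((hQ P).2 ⟨h2P, hPa, by order, wPt⟩)
    by_contra h
    have := ((ht₀' j).1 (by omega)).2
    rw [← hPj] at this
    order
  -- The rows are those of the chain followed by `a`; the columns are those of the chain with `w u`
  -- inserted at index `t₀` and `w t` appended.
  obtain ⟨ρ, hρdef⟩ : ∃ ρ : ℕ → Fin n, ρ = fun j => if j < M then e j else a := ⟨_, rfl⟩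
  obtain ⟨κ, hκdef⟩ : ∃ κ : ℕ → Fin n, κ = fun j => if j < t₀ then w (e j) else
    if j = t₀ then w u else if j ≤ M then w (e (j - 1)) else w t := ⟨_, rfl⟩
  have hρe : ∀ j < M, ρ j = e j := fun j hj => by rw [hρdef]; exact if_pos hj
  have hρa : ρ M = a := by rw [hρdef]; exact if_neg (lt_irrefl _)
  have hκe : ∀ j < t₀, κ j = w (e j) := fun j hj => by rw [hκdef]; exact if_pos hj
  have hκu : κ t₀ = w u := by rw [hκdef]; simp
  have hκe' : ∀ j < M, t₀ ≤ j → κ (j + 1) = w (e j) := fun j hj h => by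
    rw [hκdef]
    simp only [show ¬ j + 1 < t₀ by omega, show ¬ j + 1 = t₀ by omega, show j + 1 ≤ M by omega,
      if_true, if_false, Nat.add_sub_cancel]
  have hκt : κ (M + 1) = w t := by
    rw [hκdef]
    simp only [show ¬ M + 1 < t₀ by omega, show ¬ M + 1 = t₀ by omega, show ¬ M + 1 ≤ M by omega,
      if_false]
  have hρc : ∀ j < M + 1, j < M ∨ j = M := fun j hj => by omega
  have hκc : ∀ j < M + 1 + 1, j < t₀ ∨ j = t₀ ∨ (∃ j', j = j' + 1 ∧ j' < M ∧ t₀ ≤ j') ∨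
      j = M + 1 := fun j hj => by
    rcases lt_trichotomy j t₀ with h | h | h
    · exact Or.inl h
    · exact Or.inr (Or.inl h)
    · by_cases h' : j = M + 1
      · exact Or.inr (Or.inr (Or.inr h'))
      · exact Or.inr (Or.inr (Or.inl ⟨j - 1, by omega, by omega, by omega⟩))
  have hρ : ∀ j j', j < j' → j' < M + 1 → ρ j < ρ j' := fun j j' h h' => by
    rw [hρe j (by omega)]
    rcases hρc j' h' with h1 | rfl
    · rw [hρe _ h1]; exact he _ _ h h1
    · rw [hρa]; exact ((hQ _).1 (heQ j h)).2.1
  have hlow : ∀ j < t₀, w (e j) < w u := fun j hj =>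
    lt_of_le_of_ne ((ht₀' j).1 hj).2 (hueq j (by omega))
  have hhigh : ∀ j < M, t₀ ≤ j → w u < w (e j) := fun j hj h => by
    by_contra h'
    have := (ht₀' j).2 ⟨hj, not_lt.1 h'⟩
    omega
  have hκ : ∀ j j', j < j' → j' < M + 1 + 1 → κ j < κ j' := fun j j' h h' => by
    have ht : ∀ j < M, w (e j) < w t := fun j hj => ((hQ _).1 (heQ j hj)).2.2.2
    rcases hκc j (by omega) with h1 | h1 | ⟨i, rfl, h1, h2⟩ | h1 <;>
      rcases hκc j' h' with h3 | h3 | ⟨i', rfl, h3, h4⟩ | h3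
    · rw [hκe _ h1, hκe _ h3]; exact hwe _ _ h (by omega)
    · rw [hκe _ h1, h3, hκu]; exact hlow _ h1
    · rw [hκe _ h1, hκe' _ h3 h4]; exact hwe _ _ (by omega) h3
    · rw [hκe _ h1, h3, hκt]; exact ht _ (by omega)
    · omega
    · omega
    · rw [h1, hκu, hκe' _ h3 h4]; exact hhigh _ h3 h4
    · rw [h1, hκu, h3, hκt]; order
    · omega
    · omega
    · rw [hκe' _ h1 h2, hκe' _ h3 h4]; exact hwe _ _ (by omega) h3
    · rw [hκe' _ h1 h2, h3, hκt]; exact ht _ h1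
    · omega
    · omega
    · omega
    · omega
  have hie : ∀ j < M, i₂ < e j := fun j hj => ((hQ _).1 (heQ j hj)).1
  have hiw : ∀ j < M, w i₁ < w (e j) := fun j hj => ((hQ _).1 (heQ j hj)).2.2.1
  have hse : ∀ k, i₂ ≤ k → w i₂ ≤ w k → k ∈ S := fun k h1 h2 => (hS k).2 (Or.inr ⟨h1, h2⟩)
  have h1S : i₁ ∈ S := (hS _).2 (Or.inl ⟨le_rfl, le_rfl⟩)
  have h2S : i₂ ∈ S := hse _ le_rfl le_rfl
  have heS : ∀ j < M, e j ∈ S := fun j hj => hse _ (hie j hj).le (w21.trans (hiw j hj)).le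
  have hμ : ∀ x y, i₂ ≤ x → w i₁ ≤ y → ∃ τ₁ τ₂, 2 + min τ₁ τ₂ ≤ rkOn w S x y ∧ τ₁ ≤ M ∧ τ₂ ≤ M ∧
      countLE ρ (M + 1) x ≤ M + 1 ∧ countLE κ (M + 1 + 1) y ≤ M + 2 ∧
      (τ₁ < M → countLE ρ (M + 1) x ≤ τ₁) ∧ (τ₂ < t₀ → countLE κ (M + 1 + 1) y ≤ τ₂) ∧
      (t₀ ≤ τ₂ → τ₂ < M → countLE κ (M + 1 + 1) y ≤ τ₂ + 1) := by
    intro x y hx hy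
    refine ⟨countLE e M x, countLE (fun j => w (e j)) M y,
      two_add_min_le_rkOn h12 w21 h1S h2S heS hie he hwe hx hy, countLE_le _ _ _, countLE_le _ _ _,
      countLE_le _ _ _, countLE_le _ _ _, fun h => countLE_le_of_not hρ fun _ h2 => ?_,
      fun h => countLE_le_of_not hκ fun _ h2 => ?_,
      fun h h' => countLE_le_of_not hκ fun _ h2 => ?_⟩
    · rw [hρe _ h] at h2
      exact lt_irrefl _ ((lt_countLE_iff he).2 ⟨h, h2⟩)
    · rw [hκe _ h] at h2
      exact lt_irrefl _ ((lt_countLE_iff hwe).2 ⟨h.trans ht₀M, h2⟩)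
    · rw [hκe' _ h' h] at h2
      exact lt_irrefl _ ((lt_countLE_iff hwe).2 ⟨h', h2⟩)
  -- The ranks at the corners are at most `M + 2` and `t₀ + 2`, so the minors have sizes `M + 3` and
  -- `t₀ + 3`. The second takes the last `t₀ + 2` of the `M + 1` rows `ρ`, whence `l`. As `p = N`,
  -- the exceptional size cannot occur.
  refine not_hasReducibleMonomials_of_two_minors hm (S := S) (i₁ := i₁) (i₂ := i₂) (ρ := ρ)
    (κ := κ) (N := M + 1) (p := M + 1) (q := t₀ + 1) (l := M - t₀ - 1) (xA := a) (yA := w t)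
    (xB := a) (yB := w u) le_rfl (by omega) (by omega) hρ hκ h12 w21 ?_ ?_ h1S h2S ?_ ?_ ?_
    (by order) ?_ ?_ ?_ ?_ (by order) ?_ ?_ ?_ ?_ ?_ (hU.upperRows hm _)
  · intro j hj
    rcases hρc j hj with h | rfl
    · rw [hρe _ h]; exact hie _ h
    · rw [hρa]; order
  · intro j hj
    rcases hκc j hj with h | rfl | ⟨j, rfl, h, h'⟩ | rfl
    · rw [hκe _ h]; exact hiw _ (by omega)
    · rw [hκu]; order
    · rw [hκe' _ h h']; exact hiw _ h
    · rw [hκt]; order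
  · intro j hj
    rcases hρc j hj with h | rfl
    · rw [hρe _ h]; exact heS _ h
    · rw [hρa]; exact hse _ (by order) (by order)
  · intro j hj
    rcases hκc j hj with h | rfl | ⟨j, rfl, h, h'⟩ | rfl
    · rw [hκe _ h, Equiv.symm_apply_apply]; exact heS _ (by omega)
    · rw [hκu, Equiv.symm_apply_apply]; exact hse _ (by order) (by order)
    · rw [hκe' _ h h', Equiv.symm_apply_apply]; exact heS _ h
    · rw [hκt, Equiv.symm_apply_apply]; exact hse _ (by order) (by order)
  · intro k hk h1 h2
    rcases (hS k).1 hk with ⟨h3, h4⟩ | ⟨h3, h4⟩ <;> dsimp only at h1 h2 <;> order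
  · intro j hj
    rcases hρc j hj with h | rfl
    · rw [hρe _ h]; exact ((hQ _).1 (heQ j h)).2.1.le
    · rw [hρa]
  · intro j hj
    rcases (show j ≤ M + 1 by omega).eq_or_lt with rfl | h
    · rw [hκt]
    · rw [← hκt]; exact (hκ _ _ h (by omega)).le
  · refine rkOn_lt_of_forall (e := e) (i₁ := i₁) (i₂ := i₂) fun k hk h1 h2 => ?_
    exact (hNW k hk h1 h2).imp id (Or.imp id (hes k))
  · intro j hj
    rw [← hρa]
    rcases (show M - t₀ - 1 + j ≤ M by omega).eq_or_lt with h | h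
    · rw [h]
    · exact (hρ _ _ h (by omega)).le
  · intro j hj
    rw [← hκu]
    rcases (show j ≤ t₀ by omega).eq_or_lt with h | h
    · rw [h]
    · exact (hκ _ _ h (by omega)).le
  · refine rkOn_lt_of_forall (e := e) (i₁ := i₁) (i₂ := i₂) fun k hk h1 h2 => ?_
    refine (hNW k hk h1 (by order)).imp id (Or.imp id fun h => ?_)
    obtain ⟨j, hj, rfl⟩ := hes k h
    exact ⟨j, (ht₀' j).2 ⟨hj, h2⟩, rfl⟩
  · intro x y k hx hy h1 h2 h3
    obtain ⟨τ₁, τ₂, h⟩ := hμ x y hx hy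
    omega
  · intro x y k hx hy h1 h2 h3
    obtain ⟨τ₁, τ₂, h⟩ := hμ x y hx hy
    omega
  · intro x y k hx hy h1 h2 h3 h4
    obtain ⟨τ₁, τ₂, h⟩ := hμ x y hx hy
    omega

end MatrixSchubert

/-! ### Inverse patterns, and the patterns 21543 and 215634 -/

namespace MatrixSchubert

variable {n : ℕ} {m : MonomialOrder (Fin n × Fin n)} {w : Equiv.Perm (Fin n)}

/-- The inverse of 315264 is 241635, so the hypotheses on rows and on values change places. -/
theorem not_hasReducibleMonomials_315264 (hm : IsDiagonalTwo m) {k₁ k₂ k₃ a u t : Fin n}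
    (w12 : w k₁ < w k₂) (w23 : w k₂ < w k₃) (w3a : w k₃ < w a) (wau : w a < w u) (wat : w a < w t)
    (h31 : k₃ < k₁) (h1u : k₁ < u) (hu2 : u < k₂) (h2t : k₂ < t) (hta : t < a) :
    ¬ HasReducibleMonomials m w Finset.univ := fun h =>
  not_hasReducibleMonomials_241635 hm.transpose w12 w23 w3a wau wat (by simpa using h31)
    (by simpa using h1u) (by simpa using hu2) (by simpa using h2t) (by simpa using hta) h.transpose

/-- The inverse of 215364 is 214635. -/
theorem not_hasReducibleMonomials_215364 (hm : IsDiagonalTwo m) {k₁ k₂ P a u t : Fin n}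
    (w12 : w k₁ < w k₂) (w2P : w k₂ < w P) (wPa : w P < w a) (wau : w a < w u) (wat : w a < w t)
    (h21 : k₂ < k₁) (h1u : k₁ < u) (huP : u < P) (hPt : P < t) (hta : t < a) :
    ¬ HasReducibleMonomials m w Finset.univ := fun h =>
  not_hasReducibleMonomials_214635 hm.transpose w12 w2P wPa wau wat (by simpa using h21)
    (by simpa using h1u) (by simpa using huP) (by simpa using hPt) (by simpa using hta) h.transpose

/-- Excludes both `21543` (with `b = t`) and `215634`. -/
theorem not_hasReducibleMonomials_of_two_corners (hm : IsDiagonalTwo m) {i₁ i₂ a b u t : Fin n}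
    (h12 : i₁ < i₂) (h2a : i₂ < a) (hab : a < b) (hat : a < t) (hbu : b < u) (w21 : w i₂ < w i₁)
    (w1u : w i₁ < w u) (wut : w u < w t) (wta : w t < w a) (wub : w u < w b) :
    ¬ HasReducibleMonomials m w Finset.univ := by
  intro hU
  obtain ⟨⟨i₁, i₂⟩, hi₁₂, hmax⟩ := (Finset.univ.filter fun v : Fin n × Fin n => v.1 < v.2 ∧
    v.2 < a ∧ w v.2 < w v.1 ∧ w v.1 < w u).exists_max_image (fun v => (v.1 : ℕ) + v.2)
      ⟨(i₁, i₂), by simp [*]⟩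
  clear h12 h2a w21 w1u
  simp only [Finset.mem_filter, Finset.mem_univ, true_and, Prod.forall] at hi₁₂ hmax
  obtain ⟨h12, h2a, w21, w1u⟩ := hi₁₂
  set S := upperRows w {i₁, i₂} with hSdef
  have hS : ∀ k, k ∈ S ↔ (i₁ ≤ k ∧ w i₁ ≤ w k) ∨ (i₂ ≤ k ∧ w i₂ ≤ w k) :=
    fun k => by simp [hSdef, mem_upperRows]
  set Q := Finset.univ.filter fun k => i₂ < k ∧ k < a ∧ w i₁ < w k ∧ w k < w u with hQdef
  have hQ : ∀ k, k ∈ Q ↔ i₂ < k ∧ k < a ∧ w i₁ < w k ∧ w k < w u := fun k => by simp [hQdef]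
  obtain ⟨e, he, heQ, hes⟩ := exists_enumeration Q i₁
  set M := Q.card
  have hwe : ∀ j j', j < j' → j' < M → w (e j) < w (e j') := fun j j' h h' => by
    by_contra h1
    have h2 := he j j' h h'
    have h3 : w (e j') < w (e j) := lt_of_le_of_ne (not_lt.1 h1) fun h4 =>
      h2.ne' (w.injective h4)
    obtain ⟨h4, h5, h6, h7⟩ := (hQ _).1 (heQ j (h.trans h'))
    obtain ⟨h4', h5', h6', h7'⟩ := (hQ _).1 (heQ j' h')
    exact not_hasReducibleMonomials_13254 hm (i₁ := i₁) (u := t) (h12.trans h4) h2 h5' hat h6' h3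
      (h7.trans wut) wta hU
  have hk2 : ∀ k z, z ≠ k → w z ≠ w k := fun k z hz h => hz (w.injective h)
  have hmax₁ : ∀ k, i₁ < k → k < i₂ → w i₁ < w k → ¬ w k < w u := fun k h h' h1 h2 => by
    have := hmax k i₂ ⟨h', h2a, by order, h2⟩
    rw [Fin.lt_def] at h
    omega
  have hmax₂ : ∀ k, i₂ < k → k < a → ¬ w k < w i₁ := fun k h h' h1 => by
    have := hmax i₁ k ⟨by order, h', h1, w1u⟩
    rw [Fin.lt_def] at h
    omega
  -- Any further entry in the rectangle of the first corner `(a, w t)` would contradict the choice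
  -- of `i₁`, `i₂` or create 241635 or 214635.
  have hNW₁ : ∀ k ∈ S, k ≤ a → w k ≤ w t → k = i₁ ∨ k = i₂ ∨ k ∈ Q := by
    intro k hk hka hkt
    have hkt' : w k < w t := lt_of_le_of_ne hkt fun h => by
      rw [w.injective h] at hka; order
    have hka' : k < a := lt_of_le_of_ne hka fun h => by rw [h] at hkt; order
    have hku : w k ≠ w u := fun h => by rw [w.injective h] at hka; order
    by_cases hk1 : i₁ ≤ k ∧ w i₁ ≤ w k
    · by_cases hki : i₁ = k
      · exact Or.inl hki.symm
      have h1 := hk2 _ _ hki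
      rcases lt_trichotomy k i₂ with h | h | h
      · have h3 : w u < w k :=
          lt_of_le_of_ne (not_lt.1 (hmax₁ k (by order) h (by order))) hku.symm
        exact (not_hasReducibleMonomials_241635 hm (i₁ := i₁) (i₂ := k) (i₃ := i₂) (a := a)
          (u := u) (t := t) (by order) h (by order) (by order) hat w21 w1u h3 hkt' wta hU).elim
      · exact Or.inr (Or.inl h)
      · rcases lt_or_gt_of_ne hku with h3 | h3
        · exact Or.inr (Or.inr ((hQ _).2 ⟨h, hka', by order, h3⟩))
        · exact (not_hasReducibleMonomials_214635 hm h12 h hka' (by order) hat w21 w1u h3 hkt' wta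
            hU).elim
    · obtain ⟨h1, h2⟩ := ((hS k).1 hk).resolve_left hk1
      by_cases hki : i₂ = k
      · exact Or.inr (Or.inl hki.symm)
      have h4 : w k < w i₁ := not_le.1 fun h => hk1 ⟨by order, h⟩
      exact absurd h4 (hmax₂ k (by order) hka')
  -- In the rectangle of the second corner `(b, w u)` the inverse patterns 215364 and 315264 play
  -- this role.
  have hNW₂ : ∀ k ∈ S, k ≤ b → w k ≤ w u → k = i₁ ∨ k = i₂ ∨ k ∈ Q := by
    intro k hk hkb hku
    have hku' : w k < w u := lt_of_le_of_ne hku fun h => by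
      rw [w.injective h] at hkb; order
    have hkb' : k < b := lt_of_le_of_ne hkb fun h => by rw [h] at hku; order
    have hka : k ≠ a := fun h => by rw [h] at hku; order
    by_cases hk1 : i₁ ≤ k ∧ w i₁ ≤ w k
    · by_cases hki : i₁ = k
      · exact Or.inl hki.symm
      have h1 := hk2 _ _ hki
      rcases lt_trichotomy k i₂ with h | h | h
      · exact absurd hku' (hmax₁ k (by order) h (by order))
      · exact Or.inr (Or.inl h)
      · rcases lt_or_gt_of_ne hka with h3 | h3
        · exact Or.inr (Or.inr ((hQ _).2 ⟨h, h3, by order, hku'⟩))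
        · exact (not_hasReducibleMonomials_215364 hm w21 (P := k) (by order) hku' (by order) wub
            h12 h2a h3 hkb' hbu hU).elim
    · obtain ⟨h1, h2⟩ := ((hS k).1 hk).resolve_left hk1
      by_cases hki : i₂ = k
      · exact Or.inr (Or.inl hki.symm)
      have h3 := hk2 _ _ hki
      have h4 : w k < w i₁ := not_le.1 fun h => hk1 ⟨by order, h⟩
      rcases lt_or_gt_of_ne hka with h5 | h5
      · exact absurd h4 (hmax₂ k (by order) h5)
      · exact (not_hasReducibleMonomials_315264 hm (k₁ := i₂) (k₂ := k) (k₃ := i₁) (by order) h4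
          w1u (by order) wub h12 h2a h5 hkb' hbu hU).elim
  obtain ⟨ρ, hρdef⟩ : ∃ ρ : ℕ → Fin n, ρ = fun j => if j < M then e j else if j = M then a else b :=
    ⟨_, rfl⟩
  obtain ⟨κ, hκdef⟩ : ∃ κ : ℕ → Fin n, κ = fun j => if j < M then w (e j) else
    if j = M then w u else w t := ⟨_, rfl⟩
  have hρe : ∀ j < M, ρ j = e j := fun j hj => by rw [hρdef]; exact if_pos hj
  have hρa : ρ M = a := by rw [hρdef]; simp
  have hρb : ρ (M + 1) = b := by rw [hρdef]; simp
  have hκe : ∀ j < M, κ j = w (e j) := fun j hj => by rw [hκdef]; exact if_pos hj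
  have hκu : κ M = w u := by rw [hκdef]; simp
  have hκt : κ (M + 1) = w t := by rw [hκdef]; simp
  have hc : ∀ j < M + 2, j < M ∨ j = M ∨ j = M + 1 := fun j hj => by omega
  have hρ : ∀ j j', j < j' → j' < M + 2 → ρ j < ρ j' := fun j j' h h' => by
    have hea : ∀ j < M, e j < a := fun j hj => ((hQ _).1 (heQ j hj)).2.1
    rcases hc j (by omega) with h1 | rfl | rfl <;> rcases hc j' h' with h2 | rfl | rfl
    · rw [hρe _ h1, hρe _ h2]; exact he _ _ h h2
    · rw [hρe _ h1, hρa]; exact hea _ h1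
    · rw [hρe _ h1, hρb]; exact (hea _ h1).trans hab
    · omega
    · omega
    · rw [hρa, hρb]; exact hab
    · omega
    · omega
    · omega
  have hκ : ∀ j j', j < j' → j' < M + 2 → κ j < κ j' := fun j j' h h' => by
    have heu : ∀ j < M, w (e j) < w u := fun j hj => ((hQ _).1 (heQ j hj)).2.2.2
    rcases hc j (by omega) with h1 | rfl | rfl <;> rcases hc j' h' with h2 | rfl | rfl
    · rw [hκe _ h1, hκe _ h2]; exact hwe _ _ h h2
    · rw [hκe _ h1, hκu]; exact heu _ h1
    · rw [hκe _ h1, hκt]; exact (heu _ h1).trans wut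
    · omega
    · omega
    · rw [hκu, hκt]; exact wut
    · omega
    · omega
    · omega
  have hie : ∀ j < M, i₂ < e j := fun j hj => ((hQ _).1 (heQ j hj)).1
  have hiw : ∀ j < M, w i₁ < w (e j) := fun j hj => ((hQ _).1 (heQ j hj)).2.2.1
  have hse : ∀ k, i₂ ≤ k → w i₂ ≤ w k → k ∈ S := fun k h1 h2 => (hS k).2 (Or.inr ⟨h1, h2⟩)
  have h1S : i₁ ∈ S := (hS _).2 (Or.inl ⟨le_rfl, le_rfl⟩)
  have h2S : i₂ ∈ S := hse _ le_rfl le_rfl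
  have heS : ∀ j < M, e j ∈ S := fun j hj => hse _ (hie j hj).le (w21.trans (hiw j hj)).le
  have hμ : ∀ x y, i₂ ≤ x → w i₁ ≤ y → ∃ τ₁ τ₂, 2 + min τ₁ τ₂ ≤ rkOn w S x y ∧ τ₁ ≤ M ∧ τ₂ ≤ M ∧
      countLE ρ (M + 2) x ≤ M + 2 ∧ countLE κ (M + 1 + 1) y ≤ M + 2 ∧
      (τ₁ < M → countLE ρ (M + 2) x ≤ τ₁) ∧ (τ₂ < M → countLE κ (M + 1 + 1) y ≤ τ₂) := by
    intro x y hx hy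
    refine ⟨countLE e M x, countLE (fun j => w (e j)) M y,
      two_add_min_le_rkOn h12 w21 h1S h2S heS hie he hwe hx hy, countLE_le _ _ _, countLE_le _ _ _,
      countLE_le _ _ _, countLE_le _ _ _, fun h => countLE_le_of_not hρ fun _ h2 => ?_,
      fun h => countLE_le_of_not hκ fun _ h2 => ?_⟩
    · rw [hρe _ h] at h2
      exact lt_irrefl _ ((lt_countLE_iff he).2 ⟨h, h2⟩)
    · rw [hκe _ h] at h2
      exact lt_irrefl _ ((lt_countLE_iff hwe).2 ⟨h, h2⟩)
  -- Both ranks are at most `M + 2` and both minors have size `M + 3`; they share the rows `i₁`, `ρ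
  -- 0`, …, `ρ M`. Here `p + 1 = N`, so the exceptional size `M + 3` is possible; the variable at
  -- `(b, w t)` is the one in neither minor.
  refine not_hasReducibleMonomials_of_two_minors hm (S := S) (i₁ := i₁) (i₂ := i₂) (ρ := ρ)
    (κ := κ) (N := M + 2) (p := M + 1) (q := M + 1) (l := 0) (xA := a) (yA := w t)
    (xB := b) (yB := w u) (by omega) (by omega) (by omega) hρ hκ h12 w21 ?_ ?_ h1S h2S ?_ ?_ ?_
    (by order) ?_ ?_ ?_ ?_ (by order) ?_ ?_ ?_ ?_ ?_ (hU.upperRows hm _)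
  · intro j hj
    rcases hc j hj with h | rfl | rfl
    · rw [hρe _ h]; exact hie _ h
    · rw [hρa]; order
    · rw [hρb]; order
  · intro j hj
    rcases hc j hj with h | rfl | rfl
    · rw [hκe _ h]; exact hiw _ h
    · rw [hκu]; order
    · rw [hκt]; order
  · intro j hj
    rcases hc j hj with h | rfl | rfl
    · rw [hρe _ h]; exact heS _ h
    · rw [hρa]; exact hse _ (by order) (by order)
    · rw [hρb]; exact hse _ (by order) (by order)
  · intro j hj
    rcases hc j hj with h | rfl | rfl
    · rw [hκe _ h, Equiv.symm_apply_apply]; exact heS _ h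
    · rw [hκu, Equiv.symm_apply_apply]; exact hse _ (by order) (by order)
    · rw [hκt, Equiv.symm_apply_apply]; exact hse _ (by order) (by order)
  · intro k hk h1 h2
    rcases (hS k).1 hk with ⟨h3, h4⟩ | ⟨h3, h4⟩ <;> dsimp only at h1 h2 <;> order
  · intro j hj
    rw [← hρa]
    rcases (Nat.lt_succ_iff.1 hj).eq_or_lt with rfl | h
    · exact le_rfl
    · exact (hρ _ _ h (by omega)).le
  · intro j hj
    rw [← hκt]
    rcases (Nat.lt_succ_iff.1 hj).eq_or_lt with rfl | h
    · exact le_rfl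
    · exact (hκ _ _ h (by omega)).le
  · refine rkOn_lt_of_forall (e := e) (i₁ := i₁) (i₂ := i₂) fun k hk h1 h2 => ?_
    exact (hNW₁ k hk h1 h2).imp id (Or.imp id (hes k))
  · intro j hj
    rw [← hρb, Nat.zero_add]
    rcases (Nat.lt_succ_iff.1 hj).eq_or_lt with rfl | h
    · exact le_rfl
    · exact (hρ _ _ h (by omega)).le
  · intro j hj
    rw [← hκu]
    rcases (Nat.lt_succ_iff.1 hj).eq_or_lt with rfl | h
    · exact le_rfl
    · exact (hκ _ _ h (by omega)).le
  · refine rkOn_lt_of_forall (e := e) (i₁ := i₁) (i₂ := i₂) fun k hk h1 h2 => ?_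
    exact (hNW₂ k hk h1 h2).imp id (Or.imp id (hes k))
  · intro x y k hx hy h1 h2 h3
    obtain ⟨τ₁, τ₂, h⟩ := hμ x y hx hy
    omega
  · intro x y k hx hy h1 h2 h3
    obtain ⟨τ₁, τ₂, h⟩ := hμ x y hx hy
    omega
  · intro x y k hx hy h1 h2 h3 h4
    obtain ⟨τ₁, τ₂, h⟩ := hμ x y hx hy
    omega

end MatrixSchubert

theorem corollary4p2 {n : ℕ} (w : Equiv.Perm (Fin n))
    (m : MonomialOrder (Fin n × Fin n)) (hm : MatrixSchubert.IsDiagonal m)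
    (hG : MatrixSchubert.IsGroebnerBasis m (MatrixSchubert.cdgGenerators w)
      (MatrixSchubert.schubertIdeal w)) :
    MatrixSchubert.AvoidsPattern w ![1, 3, 2, 5, 4] ∧
    MatrixSchubert.AvoidsPattern w ![2, 1, 5, 4, 3] ∧
    MatrixSchubert.AvoidsPattern w ![2, 1, 4, 6, 3, 5] ∧
    MatrixSchubert.AvoidsPattern w ![2, 1, 5, 3, 6, 4] ∧
    MatrixSchubert.AvoidsPattern w ![2, 1, 5, 6, 3, 4] ∧
    MatrixSchubert.AvoidsPattern w ![2, 4, 1, 6, 3, 5] ∧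
    MatrixSchubert.AvoidsPattern w ![3, 1, 5, 2, 6, 4] ∧
    MatrixSchubert.AvoidsPattern w ![4, 2, 6, 1, 7, 3, 5] := by
  have h2 := hm.isDiagonalTwo
  have hP := MatrixSchubert.hasReducibleMonomials_of_isGroebnerBasis hG
  have hlt : ∀ {k : ℕ} (f : Fin k ↪o Fin n) (a b : Fin k), a < b → f a < f b :=
    fun f a b h => f.strictMono h
  refine ⟨?_, ?_, ?_, ?_, ?_, ?_, ?_, ?_⟩ <;> rintro ⟨f, hf⟩ <;>
    replace hf := fun a b => (hf a b).2 <;> revert hP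
  · exact MatrixSchubert.not_hasReducibleMonomials_13254 h2 (hlt f 0 1 (by decide))
      (hlt f 1 2 (by decide)) (hlt f 2 3 (by decide)) (hlt f 3 4 (by decide)) (hf 0 2 (by decide))
      (hf 2 1 (by decide)) (hf 1 4 (by decide)) (hf 4 3 (by decide))
  · exact MatrixSchubert.not_hasReducibleMonomials_of_two_corners h2 (hlt f 0 1 (by decide))
      (hlt f 1 2 (by decide)) (hlt f 2 3 (by decide)) (hlt f 2 3 (by decide))
      (hlt f 3 4 (by decide)) (hf 1 0 (by decide)) (hf 0 4 (by decide)) (hf 4 3 (by decide))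
      (hf 3 2 (by decide)) (hf 4 3 (by decide))
  · exact MatrixSchubert.not_hasReducibleMonomials_214635 h2 (hlt f 0 1 (by decide))
      (hlt f 1 2 (by decide)) (hlt f 2 3 (by decide)) (hlt f 3 4 (by decide))
      (hlt f 3 5 (by decide)) (hf 1 0 (by decide)) (hf 0 4 (by decide)) (hf 4 2 (by decide))
      (hf 2 5 (by decide)) (hf 5 3 (by decide))
  · exact MatrixSchubert.not_hasReducibleMonomials_215364 h2 (hf 1 0 (by decide))
      (hf 0 3 (by decide)) (hf 3 5 (by decide)) (hf 5 2 (by decide)) (hf 5 4 (by decide))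
      (hlt f 0 1 (by decide)) (hlt f 1 2 (by decide)) (hlt f 2 3 (by decide))
      (hlt f 3 4 (by decide)) (hlt f 4 5 (by decide))
  · exact MatrixSchubert.not_hasReducibleMonomials_of_two_corners h2 (hlt f 0 1 (by decide))
      (hlt f 1 2 (by decide)) (hlt f 2 3 (by decide)) (hlt f 2 5 (by decide))
      (hlt f 3 4 (by decide)) (hf 1 0 (by decide)) (hf 0 4 (by decide)) (hf 4 5 (by decide))
      (hf 5 2 (by decide)) (hf 4 3 (by decide))
  · exact MatrixSchubert.not_hasReducibleMonomials_241635 h2 (hlt f 0 1 (by decide))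
      (hlt f 1 2 (by decide)) (hlt f 2 3 (by decide)) (hlt f 3 4 (by decide))
      (hlt f 3 5 (by decide)) (hf 2 0 (by decide)) (hf 0 4 (by decide)) (hf 4 1 (by decide))
      (hf 1 5 (by decide)) (hf 5 3 (by decide))
  · exact MatrixSchubert.not_hasReducibleMonomials_315264 h2 (hf 1 3 (by decide))
      (hf 3 0 (by decide)) (hf 0 5 (by decide)) (hf 5 2 (by decide)) (hf 5 4 (by decide))
      (hlt f 0 1 (by decide)) (hlt f 1 2 (by decide)) (hlt f 2 3 (by decide))
      (hlt f 3 4 (by decide)) (hlt f 4 5 (by decide))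
  · exact MatrixSchubert.not_hasReducibleMonomials_4261735 h2 (hlt f 0 1 (by decide))
      (hlt f 1 2 (by decide)) (hlt f 2 3 (by decide)) (hlt f 3 4 (by decide))
      (hlt f 4 5 (by decide)) (hlt f 4 6 (by decide)) (hf 3 1 (by decide)) (hf 1 5 (by decide))
      (hf 5 0 (by decide)) (hf 0 6 (by decide)) (hf 6 4 (by decide)) (hf 6 2 (by decide))
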